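/- Let $d\in\{2,3\}$ and let $\Omega\subset\mathbb R^d$ be a bounded domain with connected Lipschitz boundary. Then there is a constant $C=C(\Omega)>0$ with the following property. Let $D\subset\Omega$ be a domain with connected boundary of class $C^{2,\alpha}$ for some $\alpha\in(0,1]$, with $\operatorname{dist}(D,\partial\Omega)>0$ and $\Omega\setminus\overline D$ connected. Write $e(u)=\frac12(\nabla u+\nabla u^T)$ and $\sigma(u,p)=2e(u)-pI$. Let $g$ be a vector field on $\partial\Omega$, let $(u_0,p_0)\in H^1(\Omega)^d\times L^2(\Omega)$ be a weak solution of $$-\operatorname{div}\sigma(u_0,p_0)=0,\quad \operatorname{div}u_0=0\ \text{ in }\Omega,\qquad u_0=g\ \text{ on }\partial\Omega,$$ and let $(u,p)\in H^1(\Omega\setminus\overline D)^d\times L^2(\Omega\setminus\overline D)$ be a weak solution of $$-\operatorname{div}\sigma(u,p)=0,\quad \operatorname{div}u=0\ \text{ in }\Omega\setminus\overline D,\qquad u=g\ \text{ on }\partial\Omega,\quad u=0\ \text{ on }\partial D,$$ the boundary conditions being understood in the sense of traces. Put $$W_0=\int_{\partial\Omega}(\sigma(u_0,p_0)n)\cdot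 g,\qquad W=\int_{\partial\Omega}(\sigma(u,p)n)\cdot g .$$ Then $$\int_D|\nabla u_0|^2\le C\,(W-W_0)\qquad\text{and}\qquad W-W_0=\int_{\partial D}u_0\cdot\sigma(u,p)n ,$$ where $n$ is the exterior unit normal to $\partial\Omega$ and to $\partial D$, respectively. Here the three boundary integrals are read (i) in general as duality pairings between $H^{-1/2}$ and $H^{1/2}$, $\sigma n$ being the weak normal trace of a divergence free $\sigma\in L^2$; and (ii) whenever $\sigma(u_0,p_0)$ and $\sigma(u,p)$ belong to $H^1$ (in particular if $(u_0,p_0)$ and $(u,p)$ are in $H^2\times H^1$), also as surface integrals of the traces. The assertion holds in both readings, with the same $C$. -/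

import Mathlib

open MeasureTheory Set Filter Topology
open scoped ContDiff

/-! ### Domains -/

/-- The space `ℝ^d` with `d = n + 1` and its Euclidean norm. -/
abbrev Space (n : ℕ) := EuclideanSpace ℝ (Fin (n + 1))

/-- `x ↦ x' = (x_1, …, x_{d-1})`. -/
noncomputable def tangentialPart {n : ℕ} (y : Space n) : EuclideanSpace ℝ (Fin n) :=
  WithLp.toLp 2 (fun i : Fin n => y i.castSucc)

/-- `φ` is of class `C^{k,α}` on the ball `B'_ρ(0)`, with `φ(0) = 0`, with `∇φ(0) = 0` if `k ≥ 1`,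
and with `∑_{i ≤ k} ρ^i ‖D^i φ‖_∞ + ρ^{k+α} |D^k φ|_α ≤ M ρ`.
The numbers `b i` and `h` bound the sup norms and the Hölder seminorm. -/
structure IsBoundaryGraph {n : ℕ} (k : ℕ) (α ρ M : ℝ) (φ : EuclideanSpace ℝ (Fin n) → ℝ) :
    Prop where
  contDiffOn : ContDiffOn ℝ k φ (Metric.ball 0 ρ)
  zero : φ 0 = 0
  fderiv_zero : 1 ≤ k → fderiv ℝ φ 0 = 0
  norm_le : ∃ (b : ℕ → ℝ) (h : ℝ),
    (∀ i ≤ k, ∀ x ∈ Metric.ball (0 : EuclideanSpace ℝ (Fin n)) ρ,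
      ‖iteratedFDeriv ℝ i φ x‖ ≤ b i) ∧
    (∀ x ∈ Metric.ball (0 : EuclideanSpace ℝ (Fin n)) ρ,
      ∀ y ∈ Metric.ball (0 : EuclideanSpace ℝ (Fin n)) ρ,
        ‖iteratedFDeriv ℝ k φ x - iteratedFDeriv ℝ k φ y‖ ≤ h * ‖x - y‖ ^ α) ∧
    (∑ i ∈ Finset.range (k + 1), ρ ^ i * b i) + ρ ^ ((k : ℝ) + α) * h ≤ M * ρ

/-- `A` is a bounded domain (open, connected, nonempty) of `ℝ^d` whose boundary is of class
`C^{k,α}` with constants `ρ, M`: near every boundary point, in suitable rigid coordinates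
`y ↦ x₀ + R y`, the set `A ∩ B_ρ(x₀)` is `{y ∈ B_ρ(0) : y_d > φ(y')}`.
The case `k = 0`, `α = 1` is that of a Lipschitz boundary. -/
structure IsDomainOfClass {n : ℕ} (k : ℕ) (α ρ M : ℝ) (A : Set (Space n)) : Prop where
  isOpen : IsOpen A
  isConnected : IsConnected A
  isBounded : Bornology.IsBounded A
  rho_pos : 0 < ρ
  const_pos : 0 < M
  graph : ∀ x₀ ∈ frontier A,
    ∃ (R : Space n ≃ₗᵢ[ℝ] Space n) (φ : EuclideanSpace ℝ (Fin n) → ℝ),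
      IsBoundaryGraph k α ρ M φ ∧
      ∀ y : Space n, ‖y‖ < ρ → (x₀ + R y ∈ A ↔ φ (tangentialPart y) < y (Fin.last n))

/-- The assumption on the cavity `D`: it is a domain of class `C^{2,α}` for some `α ∈ (0,1]`, with
connected boundary, contained in `Ω` at positive distance from `∂Ω`, and `Ω \ closure D` is
connected. -/
structure IsCavity {n : ℕ} (Ω D : Set (Space n)) : Prop where
  subset : D ⊆ Ω
  connected_compl : IsConnected (Ω \ closure D)
  dist_pos : ∃ d₀ : ℝ, 0 < d₀ ∧ ∀ x ∈ D, ∀ y ∈ frontier Ω, d₀ ≤ dist x y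
  connected_frontier : IsConnected (frontier D)
  smooth : ∃ α ρ L : ℝ, 0 < α ∧ α ≤ 1 ∧ IsDomainOfClass 2 α ρ L D

/-! ### Surface measure and exterior normal -/

/-- Surface measure on a boundary piece `Γ`: the `(d-1)`-dimensional Hausdorff measure, normalised
so as to be the usual area. -/
noncomputable def surfaceMeasure {n : ℕ} (Γ : Set (Space n)) : Measure (Space n) :=
  (Measure.euclideanHausdorffMeasure n).restrict Γ

/-- `ν` is the exterior unit normal to `A` at the boundary point `x`: up to `o(|y - x|)`, near `x`
the set `A` is the half space `{y : (y - x) · ν < 0}`. There is at most one such `ν`. -/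
def IsOuterNormal {n : ℕ} (A : Set (Space n)) (x ν : Space n) : Prop :=
  ‖ν‖ = 1 ∧ ∀ ε > 0, ∀ᶠ y in 𝓝 x,
    (inner ℝ (y - x) ν < -(ε * ‖y - x‖) → y ∈ A) ∧
    (ε * ‖y - x‖ < inner ℝ (y - x) ν → y ∉ A)

open Classical in
/-- The exterior unit normal field on `∂A`. It exists at almost every point of a Lipschitz
boundary; the value `0` is used elsewhere. -/
noncomputable def outerNormal {n : ℕ} (A : Set (Space n)) (x : Space n) : Space n :=
  if h : ∃ ν, IsOuterNormal A x ν then h.choose else 0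

/-! ### Sobolev functions and traces -/

/-- The classical partial derivative `∂_j φ`. -/
noncomputable def partialDeriv {n : ℕ} (j : Fin (n + 1)) (φ : Space n → ℝ) (x : Space n) : ℝ :=
  fderiv ℝ φ x (EuclideanSpace.single j 1)

/-- `f ∈ H^1(U)` with weak partial derivatives `Df j`. -/
structure MemH1 {n : ℕ} (U : Set (Space n)) (f : Space n → ℝ) (Df : Fin (n + 1) → Space n → ℝ) :
    Prop where
  memLp : MemLp f 2 (volume.restrict U)
  memLp_deriv : ∀ j, MemLp (Df j) 2 (volume.restrict U)
  weak_deriv : ∀ φ : Space n → ℝ, ContDiff ℝ ∞ φ → HasCompactSupport φ → tsupport φ ⊆ U →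
    ∀ j, ∫ x in U, f x * partialDeriv j φ x = -∫ x in U, Df j x * φ x

/-- `f ∈ H^1(U)` and `h ∈ L²(Γ)` is the trace of `f` on the closed part `Γ` of the boundary of `U`:
some smooth functions converge to `f` in `H^1(U)` while their restrictions to `Γ` converge to `h`
in `L²(Γ)`. -/
def HasTrace {n : ℕ} (U Γ : Set (Space n)) (f h : Space n → ℝ) : Prop :=
  ∃ Df : Fin (n + 1) → Space n → ℝ, MemH1 U f Df ∧ MemLp h 2 (surfaceMeasure Γ) ∧
    ∃ φ : ℕ → Space n → ℝ, (∀ k, ContDiff ℝ ∞ (φ k)) ∧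
      Tendsto (fun k => eLpNorm (fun x => φ k x - f x) 2 (volume.restrict U)) atTop (𝓝 0) ∧
      (∀ j, Tendsto (fun k => eLpNorm (fun x => partialDeriv j (φ k) x - Df j x) 2
        (volume.restrict U)) atTop (𝓝 0)) ∧
      Tendsto (fun k => eLpNorm (fun x => φ k x - h x) 2 (surfaceMeasure Γ)) atTop (𝓝 0)

/-! ### The Stokes system (viscosity `1`) -/

/-- The stress `σ(u,p) = 2 e(u) - p I = ∇u + ∇uᵀ - p I`, where `Du x i j = ∂_j u_i (x)`. -/
def stress {n : ℕ} (Du : Space n → Matrix (Fin (n + 1)) (Fin (n + 1)) ℝ) (p : Space n → ℝ)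
    (x : Space n) : Matrix (Fin (n + 1)) (Fin (n + 1)) ℝ :=
  Du x + (Du x).transpose - p x • (1 : Matrix (Fin (n + 1)) (Fin (n + 1)) ℝ)

/-- `(u,p) ∈ H^1(U)^d × L²(U)` is a weak solution of `-div σ(u,p) = 0`, `div u = 0` in `U`, where
`Du` is the weak gradient of `u`. The test fields `v` run through `H^1_0(U)^d`. -/
structure IsStokesSolution {n : ℕ} (U : Set (Space n)) (u : Space n → Space n)
    (Du : Space n → Matrix (Fin (n + 1)) (Fin (n + 1)) ℝ) (p : Space n → ℝ) : Prop where
  memH1 : ∀ i, MemH1 U (fun x => u x i) (fun j x => Du x i j)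
  memLp_pressure : MemLp p 2 (volume.restrict U)
  div_free : ∀ᵐ x ∂(volume.restrict U), (Du x).trace = 0
  momentum : ∀ (v : Space n → Space n) (Dv : Space n → Matrix (Fin (n + 1)) (Fin (n + 1)) ℝ),
    (∀ i, MemH1 U (fun x => v x i) (fun j x => Dv x i j)) →
    (∀ i, HasTrace U (frontier U) (fun x => v x i) (fun _ => 0)) →
    ∫ x in U, ∑ i, ∑ j, stress Du p x i j * Dv x i j = 0

/-- The vector field `u` on `U` has the boundary values `g` on `Γ`, in the sense of traces. -/
def HasBoundaryValues {n : ℕ} (U Γ : Set (Space n)) (u g : Space n → Space n) : Prop :=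
  ∀ i, HasTrace U Γ (fun x => u x i) (fun x => g x i)

/-- The matrix field `σ` on `U` belongs to `H^1(U)^{d×d}` and has the trace `T` on `Γ`. -/
def HasMatrixTrace {n : ℕ} (U Γ : Set (Space n))
    (σ T : Space n → Matrix (Fin (n + 1)) (Fin (n + 1)) ℝ) : Prop :=
  ∀ i j, HasTrace U Γ (fun x => σ x i j) (fun x => T x i j)

/-- The surface integral `∫_{∂A} (T n) · g`, with `n` the exterior unit normal to `∂A`. -/
noncomputable def tractionIntegral {n : ℕ} (A : Set (Space n))
    (T : Space n → Matrix (Fin (n + 1)) (Fin (n + 1)) ℝ) (g : Space n → Space n) : ℝ :=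
  ∫ x, ∑ i, (∑ j, T x i j * outerNormal A x j) * g x i ∂(surfaceMeasure (frontier A))

/-- `c` is the duality pairing `⟨σ n_U, v⟩` on the part `Γ` of `∂U` between `H^{-1/2}` and
`H^{1/2}`, for a divergence free `σ ∈ L²(U)^{d×d}` and `v ∈ H^1(U)^d` with gradient `Dv`, where
`n_U` is exterior to `U`. By definition of the weak normal trace this is `∫_U σ · ∇(χ v)`, where
`χ` is a smooth cut-off that is `1` near `Γ` and `0` near the rest of `∂U`. -/
def IsTractionPairing {n : ℕ} (U Γ : Set (Space n))
    (σ : Space n → Matrix (Fin (n + 1)) (Fin (n + 1)) ℝ) (v : Space n → Space n)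
    (Dv : Space n → Matrix (Fin (n + 1)) (Fin (n + 1)) ℝ) (c : ℝ) : Prop :=
  ∃ χ : Space n → ℝ, ContDiff ℝ ∞ χ ∧
    (∀ᶠ x in 𝓝ˢ Γ, χ x = 1) ∧ (∀ᶠ x in 𝓝ˢ (frontier U \ Γ), χ x = 0) ∧
    c = ∫ x in U, ∑ i, ∑ j, σ x i j * (χ x * Dv x i j + v x i * partialDeriv j χ x)

/-! Extend `u` by zero to `ũ` on `Ω`. Then `w = ũ - u₀` is a divergence free field in `H¹₀(Ω)^d`,
and testing the momentum equations for `u₀` and `u` with `w` and with cut-offs of `u₀` identifies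
both `W - W₀` and the pairing on `∂D` with the dissipation `2 ∫_Ω |e(w)|²`. Since `2 |e(w)|² =
|∇w|² + tr((∇w)²)`, it remains to see that `∫_Ω tr((∇w)²) ≥ 0`: the extension of `w` by zero is in
`H¹(ℝ^d)^d`, and there two integrations by parts give `∫ ∂_j w_i ∂_i w_j = ∫ ∂_i w_i ∂_j w_j`, so
that the integral equals `∫ (div w)²`. Hence `W - W₀` is at least `∫_Ω |∇w|²`, which is at least
`∫_D |∇u₀|²` because `w = -u₀` on `D`: the constant `C = 1` will do.

Traces enter through the divergence theorem on a Lipschitz domain with Hausdorff measure on the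
boundary. On an epigraph `{y_d > φ(y')}` it is Fubini's theorem along vertical lines together with
the area formula for the graph of `φ`, and partitions of unity reduce the general case to
epigraphs. -/

/-! ### The area formula for Lipschitz graphs -/

section Splitting

variable {n : ℕ}

/-- The identification of `ℝ^{d-1} × ℝ` with `ℝ^d`, inverse to `y ↦ (y', y_d)`. -/
noncomputable def snocEquiv (n : ℕ) : (EuclideanSpace ℝ (Fin n) × ℝ) ≃L[ℝ] Space n :=
  LinearEquiv.toContinuousLinearEquiv
    { toFun := fun z => WithLp.toLp 2 (Fin.snoc (α := fun _ => ℝ) (fun i => z.1 i) z.2)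
      invFun := fun y => (tangentialPart y, y (Fin.last n))
      map_add' := fun x y => by
        ext i
        refine Fin.lastCases ?_ (fun i => ?_) i <;> simp
      map_smul' := fun c x => by
        ext i
        refine Fin.lastCases ?_ (fun i => ?_) i <;> simp
      left_inv := fun z => by ext <;> simp [tangentialPart]
      right_inv := fun y => by
        ext i
        refine Fin.lastCases ?_ (fun i => ?_) i <;> simp [tangentialPart] }

@[simp] lemma tangentialPart_snocEquiv (z : EuclideanSpace ℝ (Fin n) × ℝ) :
    tangentialPart (snocEquiv n z) = z.1 :=
  congrArg Prod.fst ((snocEquiv n).symm_apply_apply z)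

@[simp] lemma snocEquiv_last (z : EuclideanSpace ℝ (Fin n) × ℝ) :
    snocEquiv n z (Fin.last n) = z.2 :=
  congrArg Prod.snd ((snocEquiv n).symm_apply_apply z)

@[simp] lemma snocEquiv_tangentialPart (y : Space n) :
    snocEquiv n (tangentialPart y, y (Fin.last n)) = y := (snocEquiv n).apply_symm_apply y

lemma continuous_tangentialPart : Continuous (tangentialPart (n := n)) :=
  continuous_fst.comp (snocEquiv n).symm.continuous

lemma tangentialPart_sub (x y : Space n) :
    tangentialPart (x - y) = tangentialPart x - tangentialPart y := rfl

lemma inner_eq_inner_tangentialPart_add (y z : Space n) :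
    inner ℝ y z = inner ℝ (tangentialPart y) (tangentialPart z)
      + y (Fin.last n) * z (Fin.last n) := by
  simp [PiLp.inner_apply, Fin.sum_univ_castSucc, tangentialPart, mul_comm]

lemma norm_sq_eq_norm_tangentialPart_sq_add (y : Space n) :
    ‖y‖ ^ 2 = ‖tangentialPart y‖ ^ 2 + y (Fin.last n) ^ 2 := by
  rw [← real_inner_self_eq_norm_sq, ← real_inner_self_eq_norm_sq,
    inner_eq_inner_tangentialPart_add, sq]

lemma norm_tangentialPart_le (y : Space n) : ‖tangentialPart y‖ ≤ ‖y‖ :=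
  le_of_sq_le_sq (by nlinarith [norm_sq_eq_norm_tangentialPart_sq_add y]) (norm_nonneg y)

lemma norm_snocEquiv_sq (z : EuclideanSpace ℝ (Fin n) × ℝ) :
    ‖snocEquiv n z‖ ^ 2 = ‖z.1‖ ^ 2 + z.2 ^ 2 := by
  simp [norm_sq_eq_norm_tangentialPart_sq_add]

lemma measurePreserving_snocEquiv (n : ℕ) : MeasurePreserving (snocEquiv n) := by
  let isometry : WithLp 2 (EuclideanSpace ℝ (Fin n) × ℝ) ≃ₗᵢ[ℝ] Space n :=
    { (WithLp.linearEquiv 2 ℝ _).trans (snocEquiv n).toLinearEquiv with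
      norm_map' := fun z => by
        rw [← sq_eq_sq₀ (norm_nonneg _) (norm_nonneg _), WithLp.prod_norm_sq_eq_of_L2,
          Real.norm_eq_abs, sq_abs]
        exact norm_snocEquiv_sq (WithLp.ofLp z) }
  exact isometry.measurePreserving.comp (WithLp.volume_preserving_toLp _ _)

end Splitting

section AreaDensity

variable {E : Type*} [NormedAddCommGroup E]

section Normed

variable [NormedSpace ℝ E]

/-- The Jacobian `√(1 + |A|²)` of the graph parametrisation `x ↦ (x, A x)`. -/
noncomputable def areaDensity (A : E →L[ℝ] ℝ) : ℝ := √(1 + ‖A‖ ^ 2)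

lemma areaDensity_sq (A : E →L[ℝ] ℝ) : areaDensity A ^ 2 = 1 + ‖A‖ ^ 2 :=
  Real.sq_sqrt (by positivity)

lemma one_le_areaDensity (A : E →L[ℝ] ℝ) : 1 ≤ areaDensity A :=
  Real.one_le_sqrt.2 (le_add_of_nonneg_right (sq_nonneg _))

lemma areaDensity_pos (A : E →L[ℝ] ℝ) : 0 < areaDensity A :=
  zero_lt_one.trans_le (one_le_areaDensity A)

lemma continuous_areaDensity : Continuous (areaDensity (E := E)) := by
  unfold areaDensity
  fun_prop

lemma areaDensity_le_add_norm_sub (A B : E →L[ℝ] ℝ) :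
    areaDensity A ≤ areaDensity B + ‖A - B‖ := by
  have hB := areaDensity_pos B
  have norm_le : ‖B‖ ≤ areaDensity B := Real.le_sqrt_of_sq_le (by linarith)
  refine Real.sqrt_le_iff.2 ⟨by positivity, ?_⟩
  calc 1 + ‖A‖ ^ 2 ≤ 1 + (‖B‖ + ‖A - B‖) ^ 2 := by gcongr; exact norm_le_norm_add_norm_sub' A B
    _ ≤ (areaDensity B + ‖A - B‖) ^ 2 := by
      nlinarith [areaDensity_sq B, mul_le_mul_of_nonneg_right norm_le (norm_nonneg (A - B))]

lemma areaDensity_le_one_add_mul {A B : E →L[ℝ] ℝ} {δ : ℝ} (h : ‖A - B‖ ≤ δ) :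
    areaDensity A ≤ (1 + δ) * areaDensity B := by
  have hδ : 0 ≤ δ := (norm_nonneg _).trans h
  nlinarith [areaDensity_le_add_norm_sub A B, mul_le_mul_of_nonneg_left (one_le_areaDensity B) hδ]

lemma ae_norm_sub_le_of_approximatesLinearOn [FiniteDimensional ℝ E] [MeasurableSpace E]
    [BorelSpace E] (μ : Measure E) [μ.IsAddHaarMeasure] {φ : E → ℝ} {A : E →L[ℝ] ℝ} {s : Set E}
    {δ : NNReal} (h : ApproximatesLinearOn φ A s δ) (hs : MeasurableSet s) {φ' : E → E →L[ℝ] ℝ}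
    (hφ' : ∀ x ∈ s, HasFDerivWithinAt φ (φ' x) s x) :
    ∀ᵐ x ∂μ.restrict s, ‖φ' x - A‖ ≤ δ := by
  rcases subsingleton_or_nontrivial E with _ | _
  · exact Eventually.of_forall fun x => by simp [Subsingleton.elim (φ' x) A]
  -- The corresponding lemma of Mathlib is about maps `E → E`; we apply it to `x ↦ φ x • e`.
  obtain ⟨e, he⟩ := exists_norm_eq E zero_le_one
  have approx : ApproximatesLinearOn (fun x => φ x • e) (A.smulRight e) s δ := by
    intro x hx y hy
    have : φ x • e - φ y • e - A.smulRight e (x - y) = (φ x - φ y - A (x - y)) • e := by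
      simp [sub_smul]
    rw [this, norm_smul, he, mul_one]
    exact h x hx y hy
  filter_upwards [approx.norm_fderiv_sub_le μ hs (fun x => (φ' x).smulRight e)
    (fun x hx => (hφ' x hx).smul_const e)] with x hx
  have : (φ' x).smulRight e - A.smulRight e = (φ' x - A).smulRight e := by
    ext1 y
    simp [sub_smul]
  rw [this, ← NNReal.coe_le_coe, coe_nnnorm, ContinuousLinearMap.norm_smulRight_apply, he,
    mul_one] at hx
  exact hx

end Normed

-- With `s = areaDensity A` and `a` the gradient of `A`, the map is `x ↦ x + (1 + s)⁻¹ (A x) a`,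
-- the square root of `1 + a ⊗ a`.
lemma exists_linearEquiv_norm_sq_eq [InnerProductSpace ℝ E] [FiniteDimensional ℝ E]
    (A : E →L[ℝ] ℝ) :
    ∃ M : E ≃ₗ[ℝ] E, LinearMap.det (M : E →ₗ[ℝ] E) = areaDensity A ∧
      ∀ x, ‖M x‖ ^ 2 = ‖x‖ ^ 2 + A x ^ 2 := by
  set a := (InnerProductSpace.toDual ℝ E).symm A with ha
  set s := areaDensity A
  have s_pos : 0 < s := areaDensity_pos A
  have inner_a : ∀ x, inner ℝ a x = A x := fun x => by
    rw [ha, InnerProductSpace.toDual_symm_apply]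
  have norm_a_sq : ‖a‖ ^ 2 = s ^ 2 - 1 := by
    rw [ha, LinearIsometryEquiv.norm_map, areaDensity_sq, add_sub_cancel_left]
  set M := LinearMap.transvection ((1 + s)⁻¹ • A.toLinearMap) a
  have det_M : LinearMap.det M = s := by
    rw [LinearMap.transvection.det]
    simp only [LinearMap.smul_apply, ContinuousLinearMap.coe_coe, smul_eq_mul, ← inner_a,
      real_inner_self_eq_norm_sq, norm_a_sq]
    field_simp
    ring
  refine ⟨LinearMap.equivOfDetNeZero M (det_M ▸ s_pos.ne'), det_M, fun x => ?_⟩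
  change ‖M x‖ ^ 2 = _
  rw [LinearMap.transvection.apply, norm_add_sq_real, norm_smul, inner_smul_right,
    real_inner_comm, inner_a, mul_pow, Real.norm_eq_abs, sq_abs, norm_a_sq]
  simp only [LinearMap.smul_apply, ContinuousLinearMap.coe_coe, smul_eq_mul]
  field_simp
  ring

end AreaDensity

section AreaFormula

open Measure

lemma euclideanHausdorffMeasure_image_le_mul_image {X Y Z : Type*} [EMetricSpace Y]
    [EMetricSpace Z] [MeasurableSpace Y] [BorelSpace Y] [MeasurableSpace Z] [BorelSpace Z]
    {f : X → Y} {g : X → Z} {s : Set X} {K : NNReal}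
    (h : ∀ x ∈ s, ∀ y ∈ s, edist (f x) (f y) ≤ K * edist (g x) (g y)) (d : ℕ) :
    μHE[d] (f '' s) ≤ (K : ENNReal) ^ d * μHE[d] (g '' s) := by
  rcases s.eq_empty_or_nonempty with rfl | ⟨x₀, -⟩
  · simp
  have : Nonempty X := ⟨x₀⟩
  have invFunOn_mem : ∀ x ∈ s, Function.invFunOn g s (g x) ∈ s := fun x hx =>
    Function.invFunOn_mem ⟨x, hx, rfl⟩
  have apply_invFunOn : ∀ x ∈ s, g (Function.invFunOn g s (g x)) = g x := fun x hx =>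
    Function.invFunOn_eq ⟨x, hx, rfl⟩
  have lipschitz : LipschitzOnWith K (f ∘ Function.invFunOn g s) (g '' s) := by
    rintro _ ⟨x, hx, rfl⟩ _ ⟨y, hy, rfl⟩
    simpa [apply_invFunOn x hx, apply_invFunOn y hy] using
      h _ (invFunOn_mem x hx) _ (invFunOn_mem y hy)
  have image_eq : (f ∘ Function.invFunOn g s) '' (g '' s) = f '' s := by
    rw [image_image]
    refine image_congr fun x hx => edist_le_zero.1 ?_
    simpa [apply_invFunOn x hx] using h _ (invFunOn_mem x hx) x hx
  have hausdorff_le := lipschitz.hausdorffMeasure_image_le (d := d) d.cast_nonneg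
  rw [image_eq, ENNReal.rpow_natCast] at hausdorff_le
  simp only [euclideanHausdorffMeasure_def, Measure.smul_apply, ENNReal.smul_def, smul_eq_mul]
  rw [mul_left_comm]
  exact mul_le_mul_right hausdorff_le _

variable {n : ℕ} {φ : EuclideanSpace ℝ (Fin n) → ℝ} {K : NNReal}
  {s : Set (EuclideanSpace ℝ (Fin n))}

/-- The graph parametrisation `x ↦ (x, φ x)`. -/
noncomputable def graphMap (φ : EuclideanSpace ℝ (Fin n) → ℝ) (x : EuclideanSpace ℝ (Fin n)) :
    Space n := snocEquiv n (x, φ x)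

lemma graphMap_injective (φ : EuclideanSpace ℝ (Fin n) → ℝ) : Function.Injective (graphMap φ) :=
  fun x y h => by simpa [graphMap] using congrArg tangentialPart h

lemma continuous_graphMap (h : Continuous φ) : Continuous (graphMap φ) :=
  (snocEquiv n).continuous.comp (continuous_id.prodMk h)

lemma measurableEmbedding_graphMap (h : Continuous φ) : MeasurableEmbedding (graphMap φ) :=
  (continuous_graphMap h).measurableEmbedding (graphMap_injective φ)

lemma lipschitzWith_graphMap (h : LipschitzWith K φ) : LipschitzWith (1 + K) (graphMap φ) := by
  rw [lipschitzWith_iff_norm_sub_le] at h ⊢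
  intro x y
  refine le_of_sq_le_sq ?_ (by positivity)
  rw [graphMap, graphMap, ← map_sub, norm_snocEquiv_sq]
  have : (φ x - φ y) ^ 2 ≤ (K * ‖x - y‖) ^ 2 := sq_le_sq.2 (by
    simpa [abs_of_nonneg (norm_nonneg (x - y))] using h x y)
  simp only [Prod.fst_sub, Prod.snd_sub]
  push_cast
  nlinarith [mul_nonneg K.coe_nonneg (sq_nonneg ‖x - y‖)]

lemma abs_norm_graphMap_sub_sub_norm_le {A : EuclideanSpace ℝ (Fin n) →L[ℝ] ℝ} {δ : NNReal}
    (h : ApproximatesLinearOn φ A s δ) {x y : EuclideanSpace ℝ (Fin n)} (hx : x ∈ s) (hy : y ∈ s) :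
    |‖graphMap φ x - graphMap φ y‖ - ‖graphMap A (x - y)‖| ≤ δ * ‖graphMap A (x - y)‖ := by
  have sub_eq : graphMap φ x - graphMap φ y - graphMap A (x - y)
      = snocEquiv n (0, φ x - φ y - A (x - y)) := by
    simp only [graphMap, ← map_sub, Prod.mk_sub_mk, sub_self]
  have norm_eq (t : ℝ) : ‖snocEquiv n (0, t)‖ = ‖t‖ := by
    rw [← sq_eq_sq₀ (norm_nonneg _) (norm_nonneg _), norm_snocEquiv_sq]
    simp
  calc |‖graphMap φ x - graphMap φ y‖ - ‖graphMap A (x - y)‖|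
      ≤ ‖φ x - φ y - A (x - y)‖ := by
        rw [← norm_eq, ← sub_eq]
        exact abs_norm_sub_norm_le _ _
    _ ≤ δ * ‖x - y‖ := h x hx y hy
    _ ≤ δ * ‖graphMap A (x - y)‖ := by
        gcongr
        simpa [graphMap] using norm_tangentialPart_le (graphMap A (x - y))

lemma graph_measure_bounds_of_approximatesLinearOn {A : EuclideanSpace ℝ (Fin n) →L[ℝ] ℝ}
    {δ : NNReal} (hδ : δ < 1) (h : ApproximatesLinearOn φ A s δ) :
    μHE[n] (graphMap φ '' s) ≤
        ((1 - δ)⁻¹ : NNReal) ^ n * (ENNReal.ofReal (areaDensity A) * volume s) ∧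
      ENNReal.ofReal (areaDensity A) * volume s ≤
        ((1 - δ)⁻¹ : NNReal) ^ n * μHE[n] (graphMap φ '' s) := by
  obtain ⟨M, det_M, norm_M⟩ := exists_linearEquiv_norm_sq_eq A
  have hδ' : (0 : ℝ) < 1 - δ := by simpa using hδ
  have norm_M_sub (x y) : ‖M x - M y‖ = ‖graphMap A (x - y)‖ := by
    rw [← map_sub, ← sq_eq_sq₀ (norm_nonneg _) (norm_nonneg _), norm_M, graphMap,
      norm_snocEquiv_sq]
  have volume_image : ENNReal.ofReal (areaDensity A) * volume s = μHE[n] (M '' s) := by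
    rw [EuclideanSpace.euclideanHausdorffMeasure_eq_volume, ← abs_of_pos (areaDensity_pos A),
      ← det_M]
    exact (addHaar_image_linearMap _ _ _).symm
  have coe_inv : (((1 - δ)⁻¹ : NNReal) : ℝ) = (1 - δ : ℝ)⁻¹ := by
    rw [NNReal.coe_inv, NNReal.coe_sub hδ.le, NNReal.coe_one]
  have edist_le {a b : ℝ} (hab : a * (1 - δ) ≤ b) :
      ENNReal.ofReal a ≤ ((1 - δ)⁻¹ : NNReal) * ENNReal.ofReal b := by
    rw [← ENNReal.ofReal_coe_nnreal, ← ENNReal.ofReal_mul (NNReal.coe_nonneg _), coe_inv]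
    exact ENNReal.ofReal_le_ofReal (by rwa [← div_eq_inv_mul, le_div_iff₀ hδ'])
  rw [volume_image]
  constructor <;> refine euclideanHausdorffMeasure_image_le_mul_image (fun x hx y hy => ?_) n <;>
    rw [edist_dist, edist_dist, dist_eq_norm, dist_eq_norm, norm_M_sub] <;> apply edist_le <;>
    have := abs_le.1 (abs_norm_graphMap_sub_sub_norm_le h hx hy)
  · nlinarith [δ.coe_nonneg, norm_nonneg (graphMap A (x - y))]
  · linarith

lemma graph_measure_bounds_integral_of_approximatesLinearOn
    {A : EuclideanSpace ℝ (Fin n) →L[ℝ] ℝ} {δ : NNReal} (hδ : δ < 1)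
    (h : ApproximatesLinearOn φ A s δ) (hs : MeasurableSet s)
    (hφ : ∀ x ∈ s, DifferentiableAt ℝ φ x) :
    μHE[n] (graphMap φ '' s) ≤ ((1 - δ)⁻¹ ^ n * (1 + δ) : NNReal) *
        ∫⁻ x in s, ENNReal.ofReal (areaDensity (fderiv ℝ φ x)) ∧
      ∫⁻ x in s, ENNReal.ofReal (areaDensity (fderiv ℝ φ x)) ≤
        ((1 - δ)⁻¹ ^ n * (1 + δ) : NNReal) * μHE[n] (graphMap φ '' s) := by
  have close : ∀ᵐ x ∂volume.restrict s, ‖fderiv ℝ φ x - A‖ ≤ δ :=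
    ae_norm_sub_le_of_approximatesLinearOn volume h hs
      fun x hx => (hφ x hx).hasFDerivAt.hasFDerivWithinAt
  have ofReal_le {B B' : EuclideanSpace ℝ (Fin n) →L[ℝ] ℝ} (hB : ‖B - B'‖ ≤ δ) :
      ENNReal.ofReal (areaDensity B) ≤
        ((1 + δ : NNReal) : ENNReal) * ENNReal.ofReal (areaDensity B') := by
    rw [← ENNReal.ofReal_coe_nnreal, ← ENNReal.ofReal_mul (NNReal.coe_nonneg _)]
    exact ENNReal.ofReal_le_ofReal (areaDensity_le_one_add_mul hB)
  obtain ⟨upper, lower⟩ := graph_measure_bounds_of_approximatesLinearOn hδ h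
  rw [← setLIntegral_const] at upper lower
  rw [ENNReal.coe_mul, ENNReal.coe_pow]
  constructor
  · rw [mul_assoc]
    refine upper.trans (mul_le_mul_right ?_ _)
    rw [← lintegral_const_mul' _ _ ENNReal.coe_ne_top]
    refine lintegral_mono_ae (close.mono fun x hx => ofReal_le ?_)
    rwa [norm_sub_rev]
  · rw [mul_right_comm, mul_comm]
    refine le_trans ?_ (mul_le_mul_right lower _)
    rw [← lintegral_const_mul' _ _ ENNReal.coe_ne_top]
    exact lintegral_mono_ae (close.mono fun x hx => ofReal_le hx)

lemma graph_measure_bounds_integral (hc : Continuous φ) (hs : MeasurableSet s)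
    (hφ : ∀ x ∈ s, DifferentiableAt ℝ φ x) {δ : NNReal} (h0 : 0 < δ) (hδ : δ < 1) :
    μHE[n] (graphMap φ '' s) ≤ ((1 - δ)⁻¹ ^ n * (1 + δ) : NNReal) *
        ∫⁻ x in s, ENNReal.ofReal (areaDensity (fderiv ℝ φ x)) ∧
      ∫⁻ x in s, ENNReal.ofReal (areaDensity (fderiv ℝ φ x)) ≤
        ((1 - δ)⁻¹ ^ n * (1 + δ) : NNReal) * μHE[n] (graphMap φ '' s) := by
  obtain ⟨t, A, t_disj, t_meas, s_subset, approx, -⟩ :=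
    exists_partition_approximatesLinearOn_of_hasFDerivWithinAt φ s (fderiv ℝ φ)
      (fun x hx => (hφ x hx).hasFDerivAt.hasFDerivWithinAt) (fun _ => δ) (fun _ => h0.ne')
  have s_eq : s = ⋃ k, s ∩ t k := by rw [← inter_iUnion, inter_eq_left.2 s_subset]
  have disj : Pairwise (Function.onFun Disjoint fun k => s ∩ t k) := fun i j hij =>
    (t_disj hij).mono inter_subset_right inter_subset_right
  have meas : ∀ k, MeasurableSet (s ∩ t k) := fun k => hs.inter (t_meas k)
  have measure_eq_tsum : μHE[n] (graphMap φ '' s) = ∑' k, μHE[n] (graphMap φ '' (s ∩ t k)) := by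
    conv_lhs => rw [s_eq, image_iUnion]
    exact measure_iUnion (fun i j hij => (disjoint_image_iff (graphMap_injective φ)).2 (disj hij))
      fun k => (measurableEmbedding_graphMap hc).measurableSet_image.2 (meas k)
  have integral_eq_tsum : ∫⁻ x in s, ENNReal.ofReal (areaDensity (fderiv ℝ φ x))
      = ∑' k, ∫⁻ x in s ∩ t k, ENNReal.ofReal (areaDensity (fderiv ℝ φ x)) := by
    conv_lhs => rw [s_eq]
    exact lintegral_iUnion meas disj _
  have bounds k := graph_measure_bounds_integral_of_approximatesLinearOn hδ (approx k) (meas k)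
    fun x hx => hφ x hx.1
  rw [measure_eq_tsum, integral_eq_tsum, ← ENNReal.tsum_mul_left, ← ENNReal.tsum_mul_left]
  exact ⟨ENNReal.tsum_le_tsum fun k => (bounds k).1, ENNReal.tsum_le_tsum fun k => (bounds k).2⟩

lemma graph_measure_eq_lintegral_of_differentiable (hc : Continuous φ) (hs : MeasurableSet s)
    (hφ : ∀ x ∈ s, DifferentiableAt ℝ φ x) :
    μHE[n] (graphMap φ '' s) = ∫⁻ x in s, ENNReal.ofReal (areaDensity (fderiv ℝ φ x)) := by
  have small : ∀ᶠ δ : NNReal in 𝓝[>] 0, 0 < δ ∧ δ < 1 :=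
    inter_mem self_mem_nhdsWithin (mem_nhdsWithin_of_mem_nhds (Iio_mem_nhds one_pos))
  have factor_tendsto (c : ENNReal) : Tendsto
      (fun δ : NNReal => ((1 - δ)⁻¹ ^ n * (1 + δ) : NNReal) * c) (𝓝[>] 0) (𝓝 c) := by
    have : ContinuousAt (fun δ : NNReal => (1 - δ)⁻¹ ^ n * (1 + δ)) 0 := by
      refine ContinuousAt.mul ((ContinuousAt.inv₀ (by fun_prop) (by simp)).pow n) (by fun_prop)
    have := ENNReal.Tendsto.mul_const (b := c) (ENNReal.tendsto_coe.2 this.tendsto) (by simp)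
    exact tendsto_nhdsWithin_of_tendsto_nhds (by simpa using this)
  exact le_antisymm
    (ge_of_tendsto (factor_tendsto _)
      (small.mono fun δ hδ => (graph_measure_bounds_integral hc hs hφ hδ.1 hδ.2).1))
    (ge_of_tendsto (factor_tendsto _)
      (small.mono fun δ hδ => (graph_measure_bounds_integral hc hs hφ hδ.1 hδ.2).2))

lemma graph_measure_eq_zero_of_volume_eq_zero (h : LipschitzWith K φ) (hs : volume s = 0) :
    μHE[n] (graphMap φ '' s) = 0 := by
  have := euclideanHausdorffMeasure_image_le_mul_image (g := id) (s := s)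
    (fun x _ y _ => lipschitzWith_graphMap h x y) n
  rw [image_id, EuclideanSpace.euclideanHausdorffMeasure_eq_volume, hs, mul_zero] at this
  exact le_antisymm this zero_le

lemma graph_measure_eq_lintegral (h : LipschitzWith K φ) (hs : MeasurableSet s) :
    μHE[n] (graphMap φ '' s) = ∫⁻ x in s, ENNReal.ofReal (areaDensity (fderiv ℝ φ x)) := by
  set N := {x | DifferentiableAt ℝ φ x}
  have N_meas : MeasurableSet N := measurableSet_of_differentiableAt ℝ φ
  have N_compl : volume (s \ N) = 0 :=
    measure_mono_null (fun x hx => hx.2) (h.ae_differentiableAt (μ := volume))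
  rw [← inter_union_sdiff s N, image_union, measure_congr (union_ae_eq_left_of_ae_eq_empty
      (ae_eq_empty.2 (graph_measure_eq_zero_of_volume_eq_zero h N_compl))),
    setLIntegral_congr (union_ae_eq_left_of_ae_eq_empty (ae_eq_empty.2 N_compl)),
    graph_measure_eq_lintegral_of_differentiable h.continuous (hs.inter N_meas) fun x hx => hx.2]

theorem map_graphMap_withDensity (h : LipschitzWith K φ) :
    (volume.withDensity fun x => ENNReal.ofReal (areaDensity (fderiv ℝ φ x))).map (graphMap φ)
      = μHE[n].restrict (range (graphMap φ)) := by
  have emb := measurableEmbedding_graphMap h.continuous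
  rw [← emb.map_comap]
  congr 1
  ext s hs
  rw [emb.comap_apply, withDensity_apply _ hs, graph_measure_eq_lintegral h hs]

end AreaFormula

/-! ### The divergence theorem on an epigraph -/

section Slices

variable {E : Type*} [NormedAddCommGroup E] [NormedSpace ℝ E]

lemma integral_lineDeriv_eq_zero_of_lipschitzWith [FiniteDimensional ℝ E] [MeasurableSpace E]
    [BorelSpace E] (μ : Measure E) [μ.IsAddHaarMeasure] {K : NNReal} {F : E → ℝ}
    (hF : LipschitzWith K F) (hc : HasCompactSupport F) (w : E) :
    ∫ x, lineDeriv ℝ F x w ∂μ = 0 := by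
  have := (LipschitzWith.const' (α := E) (1 : ℝ)).integral_lineDeriv_mul_eq (μ := μ) (C := 0)
    hF hc (-w)
  simpa [lineDeriv] using this.symm

lemma integral_Ioi_fderiv_add_smul {ψ : E → ℝ} (hψ : ContDiff ℝ 1 ψ) (hc : HasCompactSupport ψ)
    (y : E) {e : E} (he : e ≠ 0) : ∫ t in Ioi (0 : ℝ), fderiv ℝ ψ (y + t • e) e = -ψ y := by
  have deriv_eq (t : ℝ) : deriv (fun t => ψ (y + t • e)) t = fderiv ℝ ψ (y + t • e) e := by
    have line : HasDerivAt (fun t : ℝ => y + t • e) e t := by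
      simpa using ((hasDerivAt_id t).smul_const e).const_add y
    exact ((hψ.differentiable one_ne_zero _).hasFDerivAt.comp_hasDerivAt t line).deriv
  have contDiff : ContDiff ℝ 1 fun t : ℝ => ψ (y + t • e) := hψ.comp (by fun_prop)
  have compactSupport : HasCompactSupport fun t : ℝ => ψ (y + t • e) :=
    hc.comp_isClosedEmbedding
      ((Homeomorph.addLeft y).isClosedEmbedding.comp (isClosedEmbedding_smul_left he))
  simpa [deriv_eq] using compactSupport.integral_Ioi_deriv_eq contDiff 0

end Slices

section Epigraph

variable {n : ℕ} {φ : EuclideanSpace ℝ (Fin n) → ℝ} {K : NNReal}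

/-- The region `{y_d > φ(y')}` above a graph. -/
def epigraph (φ : EuclideanSpace ℝ (Fin n) → ℝ) : Set (Space n) :=
  {y | φ (tangentialPart y) < y (Fin.last n)}

@[simp] lemma mem_epigraph {y : Space n} :
    y ∈ epigraph φ ↔ φ (tangentialPart y) < y (Fin.last n) := Iff.rfl

@[simp] lemma tangentialPart_graphMap (x : EuclideanSpace ℝ (Fin n)) :
    tangentialPart (graphMap φ x) = x := tangentialPart_snocEquiv _

@[simp] lemma graphMap_last (x : EuclideanSpace ℝ (Fin n)) :
    graphMap φ x (Fin.last n) = φ x := snocEquiv_last _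

/-- The unit vector `e_d`, which points into every epigraph. -/
noncomputable def upward (n : ℕ) : Space n := snocEquiv n (0, 1)

lemma upward_ne_zero : upward n ≠ 0 := by simp [upward]

lemma graphMap_add_smul_upward (x : EuclideanSpace ℝ (Fin n)) (t : ℝ) :
    graphMap φ x + t • upward n = snocEquiv n (x, φ x + t) := by
  simp [graphMap, upward, ← map_smul, ← map_add]

lemma graphMap_add_const (x : EuclideanSpace ℝ (Fin n)) (t : ℝ) :
    graphMap (fun x => φ x + t) x = graphMap φ x + t • upward n :=
  (graphMap_add_smul_upward x t).symm

lemma isOpen_epigraph (hφ : Continuous φ) : IsOpen (epigraph φ) :=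
  isOpen_lt (hφ.comp continuous_tangentialPart) (by fun_prop)

lemma tendsto_graphMap_add_smul_upward (x : EuclideanSpace ℝ (Fin n)) (l : Filter ℝ)
    (hl : l ≤ 𝓝 0) : Tendsto (fun t => graphMap φ x + t • upward n) l (𝓝 (graphMap φ x)) := by
  have : Continuous fun t : ℝ => graphMap φ x + t • upward n := by fun_prop
  simpa using (this.tendsto 0).mono_left hl

lemma frontier_epigraph (hφ : Continuous φ) : frontier (epigraph φ) = range (graphMap φ) := by
  refine Subset.antisymm (fun y hy => ?_) ?_
  · have : φ (tangentialPart y) = y (Fin.last n) :=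
      frontier_lt_subset_eq (hφ.comp continuous_tangentialPart) (by fun_prop) hy
    exact ⟨tangentialPart y, by simp [graphMap, this]⟩
  · rintro _ ⟨x, rfl⟩
    refine (isOpen_epigraph hφ).frontier_eq ▸ ⟨?_, by simp⟩
    refine mem_closure_of_tendsto
      (tendsto_graphMap_add_smul_upward x (𝓝[>] 0) nhdsWithin_le_nhds) ?_
    filter_upwards [self_mem_nhdsWithin] with t (ht : 0 < t)
    simpa [graphMap_add_smul_upward] using ht

lemma frontier_closure_epigraph (hφ : Continuous φ) :
    frontier (closure (epigraph φ)) = frontier (epigraph φ) := by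
  refine Subset.antisymm frontier_closure_subset fun y hy => ?_
  rw [frontier, closure_closure, Set.mem_sdiff, mem_interior_iff_mem_nhds]
  refine ⟨frontier_subset_closure hy, fun closure_mem => ?_⟩
  obtain ⟨x, rfl⟩ := frontier_epigraph hφ ▸ hy
  have tendsto := tendsto_graphMap_add_smul_upward (φ := φ) x (𝓝[<] 0) nhdsWithin_le_nhds
  obtain ⟨t, mem, ht⟩ := ((tendsto.eventually closure_mem).and self_mem_nhdsWithin).exists
  have closure_subset : closure (epigraph φ) ⊆ {y | φ (tangentialPart y) ≤ y (Fin.last n)} :=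
    closure_lt_subset_le (hφ.comp continuous_tangentialPart) (by fun_prop)
  have : φ x ≤ φ x + t := by simpa [graphMap_add_smul_upward] using closure_subset mem
  linarith

lemma integral_fderiv_graphMap_eq_zero (h : LipschitzWith K φ) {ψ : Space n → ℝ}
    (hψ : ContDiff ℝ 1 ψ) (hc : HasCompactSupport ψ) (w : EuclideanSpace ℝ (Fin n)) :
    ∫ x, fderiv ℝ ψ (graphMap φ x) (graphMap (fderiv ℝ φ x) w) = 0 := by
  obtain ⟨C, hC⟩ := hψ.lipschitzWith_of_hasCompactSupport hc one_ne_zero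
  have compactSupport : HasCompactSupport (ψ ∘ graphMap φ) := by
    refine HasCompactSupport.intro (hc.isCompact.image continuous_tangentialPart) fun x hx => ?_
    by_contra h0
    exact hx ⟨_, subset_tsupport _ h0, tangentialPart_graphMap x⟩
  rw [← integral_lineDeriv_eq_zero_of_lipschitzWith volume (hC.comp (lipschitzWith_graphMap h))
    compactSupport w]
  refine integral_congr_ae ?_
  filter_upwards [h.ae_differentiableAt (μ := volume)] with x hx
  have graph : HasFDerivAt (graphMap φ) _ x :=
    (snocEquiv n).hasFDerivAt.comp x ((hasFDerivAt_id x).prodMk hx.hasFDerivAt)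
  exact ((hψ.differentiable one_ne_zero _).hasFDerivAt.comp x graph).hasLineDerivAt w
    |>.lineDeriv.symm

lemma measurePreserving_graphMap_add_smul_upward (hφ : Continuous φ) :
    MeasurePreserving (fun z : EuclideanSpace ℝ (Fin n) × ℝ => graphMap φ z.1 + z.2 • upward n)
      (volume.prod volume) volume := by
  simp only [graphMap_add_smul_upward]
  exact (measurePreserving_snocEquiv n).comp
    ((MeasurePreserving.id volume).skew_product (g := fun x t => φ x + t) (by fun_prop)
      (Eventually.of_forall fun x => map_add_left_eq_self volume (φ x)))

lemma measurableEmbedding_graphMap_add_smul_upward (hφ : Continuous φ) :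
    MeasurableEmbedding
      fun z : EuclideanSpace ℝ (Fin n) × ℝ => graphMap φ z.1 + z.2 • upward n := by
  refine Continuous.measurableEmbedding ?_ fun z z' hz => ?_
  · have := continuous_graphMap hφ
    fun_prop
  · simp only [graphMap_add_smul_upward, (snocEquiv n).injective.eq_iff, Prod.mk.injEq] at hz
    refine Prod.ext hz.1 (add_left_cancel (a := φ z.1) ?_)
    rw [hz.2, hz.1]

lemma setIntegral_epigraph (hφ : Continuous φ) (f : Space n → ℝ) :
    ∫ y in epigraph φ, f y = ∫ z, f (graphMap φ z.1 + z.2 • upward n)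
      ∂(volume : Measure (EuclideanSpace ℝ (Fin n))).prod (volume.restrict (Ioi (0 : ℝ))) := by
  have preimage : (fun z : EuclideanSpace ℝ (Fin n) × ℝ => graphMap φ z.1 + z.2 • upward n) ⁻¹'
      epigraph φ = univ ×ˢ Ioi 0 := by
    ext z
    simp [graphMap_add_smul_upward]
  rw [← (measurePreserving_graphMap_add_smul_upward hφ).setIntegral_preimage_emb
    (measurableEmbedding_graphMap_add_smul_upward hφ), preimage, ← Measure.prod_restrict,
    Measure.restrict_univ]

lemma integrable_comp_graphMap_add_smul_upward (hφ : Continuous φ) {f : Space n → ℝ}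
    (hf : Integrable f) : Integrable (fun z => f (graphMap φ z.1 + z.2 • upward n))
      ((volume : Measure (EuclideanSpace ℝ (Fin n))).prod (volume.restrict (Ioi (0 : ℝ)))) := by
  have := (((measurePreserving_graphMap_add_smul_upward hφ).integrable_comp_emb
    (measurableEmbedding_graphMap_add_smul_upward hφ)).2 hf).restrict (s := univ ×ˢ Ioi 0)
  rwa [← Measure.prod_restrict, Measure.restrict_univ] at this

lemma integral_fderiv_graphMap_add_smul_upward_eq_zero (h : LipschitzWith K φ) {ψ : Space n → ℝ}
    (hψ : ContDiff ℝ 1 ψ) (hc : HasCompactSupport ψ) (w : EuclideanSpace ℝ (Fin n)) (t : ℝ) :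
    ∫ x, fderiv ℝ ψ (graphMap φ x + t • upward n) (graphMap (fderiv ℝ φ x) w) = 0 := by
  have lip : LipschitzWith K fun x => φ x + t := fun x y => by simpa using h x y
  simpa only [graphMap_add_const, fderiv_add_const] using
    integral_fderiv_graphMap_eq_zero lip hψ hc w

-- Only the component of `v` along `e_d` that is left after subtracting a tangent vector of the
-- graph contributes to the integral.
lemma integral_epigraph_fderiv (h : LipschitzWith K φ) {ψ : Space n → ℝ} (hψ : ContDiff ℝ 1 ψ)
    (hc : HasCompactSupport ψ) (v : Space n) :
    ∫ y in epigraph φ, fderiv ℝ ψ y v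
      = ∫ x, ψ (graphMap φ x) * (fderiv ℝ φ x (tangentialPart v) - v (Fin.last n)) := by
  set slope := fun x => v (Fin.last n) - fderiv ℝ φ x (tangentialPart v)
  set total := fun z : EuclideanSpace ℝ (Fin n) × ℝ =>
    fderiv ℝ ψ (graphMap φ z.1 + z.2 • upward n) v
  set tangential := fun z : EuclideanSpace ℝ (Fin n) × ℝ =>
    fderiv ℝ ψ (graphMap φ z.1 + z.2 • upward n) (graphMap (fderiv ℝ φ z.1) (tangentialPart v))
  set vertical := fun z : EuclideanSpace ℝ (Fin n) × ℝ =>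
    slope z.1 * fderiv ℝ ψ (graphMap φ z.1 + z.2 • upward n) (upward n)
  have split : total = tangential + vertical := funext fun z => by
    have : v = graphMap (fderiv ℝ φ z.1) (tangentialPart v) + slope z.1 • upward n := by
      simp [graphMap_add_smul_upward, slope]
    simp only [total, tangential, vertical, Pi.add_apply]
    conv_lhs => rw [this, map_add, map_smul, smul_eq_mul]
  have integrable_dir (w : Space n) :=
    integrable_comp_graphMap_add_smul_upward h.continuous (f := fun y => fderiv ℝ ψ y w)
      (((hψ.continuous_fderiv one_ne_zero).clm_apply
        continuous_const).integrable_of_hasCompactSupport (hc.fderiv_apply ℝ w))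
  have integrable_vertical : Integrable vertical (volume.prod (volume.restrict (Ioi 0))) := by
    refine (integrable_dir _).bdd_mul (c := |v (Fin.last n)| + K * ‖tangentialPart v‖) ?_
      (Eventually.of_forall fun z => ?_)
    · exact ((measurable_const.sub (measurable_fderiv_apply_const ℝ φ _)).comp
        measurable_fst).aestronglyMeasurable
    · exact (norm_sub_le _ _).trans (add_le_add le_rfl
        (ContinuousLinearMap.le_of_opNorm_le _ (norm_fderiv_le_of_lipschitz ℝ h) _))
  have integrable_tangential : Integrable tangential (volume.prod (volume.restrict (Ioi 0))) := by
    rw [eq_sub_of_add_eq split.symm]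
    exact (integrable_dir v).sub integrable_vertical
  rw [setIntegral_epigraph h.continuous]
  change ∫ z, total z ∂_ = _
  rw [split, integral_add' integrable_tangential integrable_vertical,
    integral_prod_symm _ integrable_tangential, integral_prod _ integrable_vertical]
  simp only [tangential, vertical, slope, integral_const_mul, integral_zero, zero_add,
    integral_fderiv_graphMap_add_smul_upward_eq_zero h hψ hc,
    integral_Ioi_fderiv_add_smul hψ hc _ upward_ne_zero]
  exact integral_congr_ae (Eventually.of_forall fun x => by ring)

end Epigraph

/-! ### Outer normals -/

section OuterNormal

variable {n : ℕ} {A B : Set (Space n)} {x ν ν' : Space n}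

lemma IsOuterNormal.unique (h : IsOuterNormal A x ν) (h' : IsOuterNormal A x ν') : ν = ν' := by
  by_contra hne
  set d := ν - ν'
  have hd : 0 < ‖d‖ := norm_pos_iff.2 (sub_ne_zero.2 hne)
  have inner_left : inner ℝ d ν = ‖d‖ ^ 2 / 2 := by
    rw [norm_sub_sq_real, inner_sub_left, real_inner_self_eq_norm_sq, h.1, h'.1,
      real_inner_comm ν' ν]
    ring
  have inner_right : inner ℝ d ν' = -(‖d‖ ^ 2 / 2) := by
    rw [norm_sub_sq_real, inner_sub_left, real_inner_self_eq_norm_sq, h.1, h'.1]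
    ring
  -- Close to `x`, the points `x + s • d` would be outside `A` by `h` and inside `A` by `h'`.
  have tendsto : Tendsto (fun s : ℝ => x + s • d) (𝓝[>] 0) (𝓝 x) := by
    have : Continuous fun s : ℝ => x + s • d := by fun_prop
    simpa using (this.tendsto 0).mono_left nhdsWithin_le_nhds
  have quarter_pos : 0 < ‖d‖ / 4 := by positivity
  obtain ⟨s, ⟨out, inside⟩, hs : 0 < s⟩ := ((tendsto.eventually (h.2 _ quarter_pos)).and
    (tendsto.eventually (h'.2 _ quarter_pos)) |>.and self_mem_nhdsWithin).exists
  simp only [add_sub_cancel_left, norm_smul, Real.norm_of_nonneg hs.le, inner_smul_left,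
    conj_trivial, inner_left, inner_right] at out inside
  have : 0 < s * ‖d‖ ^ 2 := by positivity
  exact out.2 (by nlinarith) (inside.1 (by nlinarith))

lemma IsOuterNormal.outerNormal_eq (h : IsOuterNormal A x ν) : outerNormal A x = ν := by
  have exists_normal : ∃ ν, IsOuterNormal A x ν := ⟨ν, h⟩
  rw [outerNormal, dif_pos exists_normal]
  exact exists_normal.choose_spec.unique h

lemma outerNormal_eq_zero (h : ∀ ν, ¬IsOuterNormal A x ν) : outerNormal A x = 0 :=
  dif_neg (not_exists.2 h)

lemma norm_outerNormal_le (A : Set (Space n)) (x : Space n) : ‖outerNormal A x‖ ≤ 1 := by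
  by_cases h : ∃ ν, IsOuterNormal A x ν
  · obtain ⟨ν, hν⟩ := h
    rw [hν.outerNormal_eq, hν.1]
  · rw [outerNormal_eq_zero (not_exists.1 h), norm_zero]
    exact zero_le_one

lemma isOuterNormal_congr (h : A =ᶠ[𝓝 x] B) : IsOuterNormal A x ν ↔ IsOuterNormal B x ν := by
  refine and_congr_right fun _ => forall₂_congr fun ε _ => eventually_congr ?_
  filter_upwards [h] with y hy
  have : y ∈ A ↔ y ∈ B := iff_of_eq hy
  rw [this]

lemma outerNormal_congr (h : A =ᶠ[𝓝 x] B) : outerNormal A x = outerNormal B x := by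
  have : IsOuterNormal A x = IsOuterNormal B x := funext fun _ => propext (isOuterNormal_congr h)
  unfold outerNormal
  rw [this]

lemma isOuterNormal_preimage (T : Space n ≃ᵃⁱ[ℝ] Space n) :
    IsOuterNormal (T ⁻¹' A) x ν ↔ IsOuterNormal A (T x) (T.linearIsometryEquiv ν) := by
  have sub_eq (y) : T y - T x = T.linearIsometryEquiv (y - x) := (T.map_vsub y x).symm
  have nhds_eq : 𝓝 (T x) = map T (𝓝 x) := (T.toHomeomorph.map_nhds_eq x).symm
  simp only [IsOuterNormal, nhds_eq, eventually_map, sub_eq, LinearIsometryEquiv.norm_map,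
    LinearIsometryEquiv.inner_map_map, mem_preimage]

lemma outerNormal_preimage (T : Space n ≃ᵃⁱ[ℝ] Space n) :
    T.linearIsometryEquiv (outerNormal (T ⁻¹' A) x) = outerNormal A (T x) := by
  by_cases h : ∃ ν, IsOuterNormal (T ⁻¹' A) x ν
  · obtain ⟨ν, hν⟩ := h
    rw [hν.outerNormal_eq, ((isOuterNormal_preimage T).1 hν).outerNormal_eq]
  · rw [outerNormal_eq_zero (not_exists.1 h), map_zero, outerNormal_eq_zero fun ν hν => h
      ⟨T.linearIsometryEquiv.symm ν, (isOuterNormal_preimage T).2 (by simpa using hν)⟩]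

end OuterNormal

section EpigraphNormal

variable {n : ℕ} {φ : EuclideanSpace ℝ (Fin n) → ℝ} {K : NNReal}

/-- The unit normal `(∇φ, -1) / √(1 + |∇φ|²)` to the graph of `φ`, exterior to the epigraph. -/
noncomputable def graphNormal (φ : EuclideanSpace ℝ (Fin n) → ℝ) (x : EuclideanSpace ℝ (Fin n)) :
    Space n :=
  (areaDensity (fderiv ℝ φ x))⁻¹ •
    snocEquiv n ((InnerProductSpace.toDual ℝ _).symm (fderiv ℝ φ x), -1)

lemma areaDensity_mul_inner_graphNormal (x : EuclideanSpace ℝ (Fin n)) (v : Space n) :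
    areaDensity (fderiv ℝ φ x) * inner ℝ v (graphNormal φ x)
      = fderiv ℝ φ x (tangentialPart v) - v (Fin.last n) := by
  rw [graphNormal, inner_smul_right, mul_inv_cancel_left₀ (areaDensity_pos _).ne',
    inner_eq_inner_tangentialPart_add, tangentialPart_snocEquiv, snocEquiv_last, real_inner_comm,
    InnerProductSpace.toDual_symm_apply]
  ring

lemma norm_graphNormal (x : EuclideanSpace ℝ (Fin n)) : ‖graphNormal φ x‖ = 1 := by
  have pos := areaDensity_pos (fderiv ℝ φ x)
  rw [graphNormal, norm_smul, norm_inv, Real.norm_of_nonneg pos.le, inv_mul_eq_one₀ pos.ne',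
    ← sq_eq_sq₀ pos.le (norm_nonneg _), norm_snocEquiv_sq, areaDensity_sq,
    LinearIsometryEquiv.norm_map]
  ring

lemma measurable_graphNormal (φ : EuclideanSpace ℝ (Fin n) → ℝ) : Measurable (graphNormal φ) := by
  have := measurable_fderiv ℝ φ
  refine (continuous_areaDensity.measurable.comp this).inv.smul
    ((snocEquiv n).continuous.measurable.comp (Measurable.prodMk ?_ measurable_const))
  exact (InnerProductSpace.toDual ℝ _).symm.continuous.measurable.comp this

lemma isOuterNormal_epigraph {x : EuclideanSpace ℝ (Fin n)} (hx : DifferentiableAt ℝ φ x) :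
    IsOuterNormal (epigraph φ) (graphMap φ x) (graphNormal φ x) := by
  refine ⟨norm_graphNormal x, fun ε hε => ?_⟩
  have small : ∀ᶠ x' in 𝓝 x, ‖φ x' - φ x - fderiv ℝ φ x (x' - x)‖ ≤ ε * ‖x' - x‖ :=
    (hasFDerivAt_iff_isLittleO.1 hx.hasFDerivAt).def hε
  have tendsto : Tendsto (tangentialPart (n := n)) (𝓝 (graphMap φ x)) (𝓝 x) := by
    simpa using (continuous_tangentialPart (n := n)).tendsto (graphMap φ x)
  filter_upwards [tendsto.eventually small] with y hy
  set J := areaDensity (fderiv ℝ φ x)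
  set N := ‖y - graphMap φ x‖
  set c := inner ℝ (y - graphMap φ x) (graphNormal φ x)
  have hJ : 1 ≤ J := one_le_areaDensity _
  have c_eq : J * c = fderiv ℝ φ x (tangentialPart y - x) - (y (Fin.last n) - φ x) := by
    simpa [tangentialPart_sub] using
      areaDensity_mul_inner_graphNormal (φ := φ) x (y - graphMap φ x)
  have norm_le : ‖tangentialPart y - x‖ ≤ N := by
    simpa [tangentialPart_sub] using norm_tangentialPart_le (y - graphMap φ x)
  have error_le : |φ (tangentialPart y) - φ x - fderiv ℝ φ x (tangentialPart y - x)|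
      ≤ J * (ε * N) :=
    calc _ ≤ ε * N := hy.trans (by gcongr)
      _ ≤ J * (ε * N) := le_mul_of_one_le_left (by positivity) hJ
  rw [abs_le] at error_le
  rw [mem_epigraph]
  constructor <;> intro hc <;> nlinarith

lemma surfaceMeasure_frontier_epigraph (h : LipschitzWith K φ) :
    surfaceMeasure (frontier (epigraph φ)) = (volume.withDensity fun x =>
      ENNReal.ofReal (areaDensity (fderiv ℝ φ x))).map (graphMap φ) := by
  rw [map_graphMap_withDensity h, surfaceMeasure, frontier_epigraph h.continuous]

lemma ae_outerNormal_epigraph_eq (h : LipschitzWith K φ) :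
    ∀ᵐ x, outerNormal (epigraph φ) (graphMap φ x) = graphNormal φ x := by
  filter_upwards [h.ae_differentiableAt (μ := volume)] with x hx
  exact (isOuterNormal_epigraph hx).outerNormal_eq

lemma aestronglyMeasurable_outerNormal_epigraph (h : LipschitzWith K φ) :
    AEStronglyMeasurable (outerNormal (epigraph φ)) (surfaceMeasure (frontier (epigraph φ))) := by
  refine ⟨graphNormal φ ∘ tangentialPart, ((measurable_graphNormal φ).comp
    continuous_tangentialPart.measurable).stronglyMeasurable, ?_⟩
  rw [surfaceMeasure_frontier_epigraph h, EventuallyEq,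
    (measurableEmbedding_graphMap h.continuous).ae_map_iff]
  filter_upwards [(withDensity_absolutelyContinuous _ _).ae_le (ae_outerNormal_epigraph_eq h)]
    with x hx
  rw [hx, Function.comp_apply, tangentialPart_graphMap]

lemma surfaceMeasure_frontier_epigraph_lt_top (h : LipschitzWith K φ) {S : Set (Space n)}
    (hS : Bornology.IsBounded S) : surfaceMeasure (frontier (epigraph φ)) S < ⊤ := by
  obtain ⟨r, S_subset⟩ := hS.subset_ball 0
  have bound := euclideanHausdorffMeasure_image_le_mul_image (g := id) (s := Metric.ball 0 r)
    (fun x _ y _ => lipschitzWith_graphMap h x y) n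
  rw [image_id, EuclideanSpace.euclideanHausdorffMeasure_eq_volume] at bound
  calc surfaceMeasure (frontier (epigraph φ)) S
      ≤ surfaceMeasure (frontier (epigraph φ)) (Metric.ball 0 r) := measure_mono S_subset
    _ ≤ Measure.euclideanHausdorffMeasure n (graphMap φ '' Metric.ball 0 r) := by
      rw [surfaceMeasure, Measure.restrict_apply measurableSet_ball,
        frontier_epigraph h.continuous]
      refine measure_mono ?_
      rintro _ ⟨hx, x, rfl⟩
      refine ⟨x, ?_, rfl⟩
      rw [mem_ball_zero_iff] at hx ⊢
      simpa using (norm_tangentialPart_le (graphMap φ x)).trans_lt hx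
    _ < ⊤ := bound.trans_lt
      (ENNReal.mul_lt_top (ENNReal.pow_lt_top ENNReal.coe_lt_top) measure_ball_lt_top)

lemma setIntegral_epigraph_fderiv_eq (h : LipschitzWith K φ) {ψ : Space n → ℝ}
    (hψ : ContDiff ℝ 1 ψ) (hc : HasCompactSupport ψ) (v : Space n) :
    ∫ y in epigraph φ, fderiv ℝ ψ y v
      = ∫ y, ψ y * inner ℝ v (outerNormal (epigraph φ) y)
        ∂surfaceMeasure (frontier (epigraph φ)) := by
  rw [integral_epigraph_fderiv h hψ hc, surfaceMeasure_frontier_epigraph h,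
    (measurableEmbedding_graphMap h.continuous).integral_map,
    integral_withDensity_eq_integral_toReal_smul
      (f := fun x => ENNReal.ofReal (areaDensity (fderiv ℝ φ x)))
      (continuous_areaDensity.measurable.comp (measurable_fderiv ℝ φ)).ennreal_ofReal
      (Eventually.of_forall fun x => ENNReal.ofReal_lt_top)]
  refine integral_congr_ae ?_
  filter_upwards [ae_outerNormal_epigraph_eq h] with x hx
  rw [hx, ← areaDensity_mul_inner_graphNormal,
    ENNReal.toReal_ofReal (areaDensity_pos _).le, smul_eq_mul, mul_left_comm]

end EpigraphNormal

/-! ### The divergence theorem on Lipschitz domains -/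

lemma integrable_fderiv_apply {E : Type*} [NormedAddCommGroup E] [NormedSpace ℝ E]
    [MeasurableSpace E] [BorelSpace E] {μ : Measure E} [IsFiniteMeasureOnCompacts μ]
    {f : E → ℝ} (hf : ContDiff ℝ 1 f) (hc : HasCompactSupport f) (v : E) :
    Integrable (fun x => fderiv ℝ f x v) μ :=
  ((hf.continuous_fderiv one_ne_zero).clm_apply continuous_const).integrable_of_hasCompactSupport
    (hc.fderiv_apply ℝ v)

section Localization

variable {E : Type*} [NormedAddCommGroup E] [NormedSpace ℝ E] [FiniteDimensional ℝ E]

lemma exists_cutoff {K W : Set E} (hK : IsCompact K) (hW : IsOpen W) (hKW : K ⊆ W) :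
    ∃ χ : E → ℝ, ContDiff ℝ ∞ χ ∧ HasCompactSupport χ ∧ tsupport χ ⊆ W ∧ ∀ᶠ x in 𝓝ˢ K, χ x = 1 := by
  obtain ⟨L, hL, hKL, hLW⟩ := exists_compact_between hK hW hKW
  obtain ⟨χ, one, zero, -⟩ := exists_contMDiffMap_one_nhds_of_subset_interior (n := ⊤)
    (modelWithCornersSelf ℝ E) hK.isClosed hKL
  have tsupport_subset : tsupport χ ⊆ L :=
    closure_minimal (fun x hx => by_contra fun h => hx (zero x h)) hL.isClosed
  exact ⟨χ, χ.contMDiff.contDiff, hL.of_isClosed_subset (isClosed_tsupport χ) tsupport_subset,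
    tsupport_subset.trans hLW, one⟩

lemma exists_eq_add_of_tsupport_subset_union {f : E → ℝ} (hf : ContDiff ℝ 1 f)
    (hc : HasCompactSupport f) {V W : Set E} (hV : IsOpen V) (hW : IsOpen W)
    (h : tsupport f ⊆ V ∪ W) :
    ∃ g₁ g₂ : E → ℝ, f = g₁ + g₂ ∧ (ContDiff ℝ 1 g₁ ∧ HasCompactSupport g₁ ∧ tsupport g₁ ⊆ V) ∧
      ContDiff ℝ 1 g₂ ∧ HasCompactSupport g₂ ∧ tsupport g₂ ⊆ W := by
  obtain ⟨χ, hχ, -, hχV, one⟩ := exists_cutoff (K := tsupport f \ W) (hc.isCompact.diff hW) hV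
    fun x hx => (h hx.1).resolve_right hx.2
  have hχ : ContDiff ℝ 1 χ := hχ.of_le (by simp)
  refine ⟨χ * f, (1 - χ) * f, by ring,
    ⟨hχ.mul hf, hc.mul_left, (tsupport_mul_subset_left (f := χ) (g := f)).trans hχV⟩,
    (contDiff_const.sub hχ).mul hf, hc.mul_left, fun x hx => by_contra fun hxW => ?_⟩
  have near_one : ∀ᶠ y in 𝓝 x, χ y = 1 :=
    one.filter_mono (nhds_le_nhdsSet (s := tsupport f \ W) ⟨tsupport_mul_subset_right hx, hxW⟩)
  refine notMem_tsupport_iff_eventuallyEq.2 ?_ hx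
  filter_upwards [near_one] with y hy
  simp [hy]

lemma contDiff_one_induction_of_locally {p : (E → ℝ) → Prop}
    (add : ∀ f g, ContDiff ℝ 1 f → HasCompactSupport f → ContDiff ℝ 1 g → HasCompactSupport g →
      p f → p g → p (f + g))
    (locally : ∀ x, ∃ W ∈ 𝓝 x, ∀ f, ContDiff ℝ 1 f → HasCompactSupport f → tsupport f ⊆ W → p f)
    {f : E → ℝ} (hf : ContDiff ℝ 1 f) (hc : HasCompactSupport f) : p f := by
  suffices h : ∃ W : Set E, IsOpen W ∧ tsupport f ⊆ W ∧
      ∀ g, ContDiff ℝ 1 g → HasCompactSupport g → tsupport g ⊆ W → p g by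
    obtain ⟨W, -, f_subset, hW⟩ := h
    exact hW f hf hc f_subset
  refine hc.isCompact.induction_on (p := fun s => ∃ W : Set E, IsOpen W ∧ s ⊆ W ∧
    ∀ g, ContDiff ℝ 1 g → HasCompactSupport g → tsupport g ⊆ W → p g) ?_ ?_ ?_ ?_
  · obtain ⟨W, -, hW⟩ := locally 0
    exact ⟨∅, isOpen_empty, Subset.rfl, fun g hg hgc hgs =>
      hW g hg hgc (hgs.trans (empty_subset W))⟩
  · rintro s t hst ⟨W, hW, htW, h⟩
    exact ⟨W, hW, hst.trans htW, h⟩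
  · rintro s t ⟨V, hV, hsV, pV⟩ ⟨W, hW, htW, pW⟩
    refine ⟨V ∪ W, hV.union hW, union_subset_union hsV htW, fun g hg hgc hgs => ?_⟩
    obtain ⟨g₁, g₂, rfl, ⟨hg₁, hc₁, hs₁⟩, hg₂, hc₂, hs₂⟩ :=
      exists_eq_add_of_tsupport_subset_union hg hgc hV hW hgs
    exact add g₁ g₂ hg₁ hc₁ hg₂ hc₂ (pV g₁ hg₁ hc₁ hs₁) (pW g₂ hg₂ hc₂ hs₂)
  · intro x _
    obtain ⟨W, hW, h⟩ := locally x
    exact ⟨interior W, mem_nhdsWithin_of_mem_nhds (interior_mem_nhds.2 hW), interior W,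
      isOpen_interior, Subset.rfl, fun g hg hgc hgs => h g hg hgc (hgs.trans interior_subset)⟩

lemma integral_fderiv_apply_eq_zero [MeasurableSpace E] [BorelSpace E] (μ : Measure E)
    [μ.IsAddHaarMeasure] {f : E → ℝ} (hf : ContDiff ℝ 1 f) (hc : HasCompactSupport f) (v : E) :
    ∫ x, fderiv ℝ f x v ∂μ = 0 := by
  obtain ⟨K, hK⟩ := hf.lipschitzWith_of_hasCompactSupport hc one_ne_zero
  rw [← integral_lineDeriv_eq_zero_of_lipschitzWith μ hK hc v]
  congr with x
  exact ((hf.differentiable one_ne_zero x).lineDeriv_eq_fderiv).symm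

end Localization

lemma restrict_restrict_eq_of_inter_eq {α : Type*} [MeasurableSpace α] {μ : Measure α}
    {A B W : Set α} (hW : MeasurableSet W) (h : A ∩ W = B ∩ W) :
    (μ.restrict A).restrict W = (μ.restrict B).restrict W := by
  rw [Measure.restrict_restrict hW, Measure.restrict_restrict hW, inter_comm W, h, inter_comm]

lemma exists_isOpen_inter_eq {X : Type*} [TopologicalSpace X] {A B : Set X} {x : X}
    (h : A =ᶠ[𝓝 x] B) : ∃ W, IsOpen W ∧ x ∈ W ∧ A ∩ W = B ∩ W := by
  obtain ⟨W, hW, W_open, hx⟩ := eventually_nhds_iff.1 (eventuallyEq_set.1 h)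
  exact ⟨W, W_open, hx, Set.ext fun y => and_congr_left (hW y)⟩

lemma frontier_inter_eq_of_inter_eq {X : Type*} [TopologicalSpace X] {A B W : Set X}
    (hW : IsOpen W) (h : A ∩ W = B ∩ W) : frontier A ∩ W = frontier B ∩ W := by
  rw [← frontier_inter_open_inter hW, h, frontier_inter_open_inter hW]

lemma outerNormal_eq_of_inter_eq {n : ℕ} {A B W : Set (Space n)} (hW : IsOpen W)
    (h : A ∩ W = B ∩ W) {x : Space n} (hx : x ∈ W) : outerNormal A x = outerNormal B x := by
  refine outerNormal_congr (eventuallyEq_set.2 ?_)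
  filter_upwards [hW.mem_nhds hx] with y hy
  simpa only [mem_inter_iff, hy, and_true] using Set.ext_iff.1 h y

lemma integrable_mul_inner_outerNormal {n : ℕ} {A : Set (Space n)}
    [IsLocallyFiniteMeasure (surfaceMeasure (frontier A))]
    (hA : AEStronglyMeasurable (outerNormal A) (surfaceMeasure (frontier A)))
    {ψ : Space n → ℝ} (hψ : Continuous ψ) (hc : HasCompactSupport ψ) (v : Space n) :
    Integrable (fun x => ψ x * inner ℝ v (outerNormal A x)) (surfaceMeasure (frontier A)) := by
  refine (hψ.integrable_of_hasCompactSupport hc).mul_bdd (c := ‖v‖)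
    (aestronglyMeasurable_const.inner hA) (Eventually.of_forall fun x => ?_)
  exact (norm_inner_le_norm v _).trans
    (mul_le_of_le_one_right (norm_nonneg v) (norm_outerNormal_le A x))

/-- The divergence theorem holds on `A` for compactly supported functions, the surface measure of
`∂A` being locally finite and the exterior normal measurable. This property is local and
invariant under rigid motions. -/
structure HasDivergenceTheorem {n : ℕ} (A : Set (Space n)) : Prop where
  isLocallyFiniteMeasure : IsLocallyFiniteMeasure (surfaceMeasure (frontier A))
  aestronglyMeasurable : AEStronglyMeasurable (outerNormal A) (surfaceMeasure (frontier A))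
  integral_fderiv : ∀ ψ, ContDiff ℝ 1 ψ → HasCompactSupport ψ → ∀ v,
    ∫ x in A, fderiv ℝ ψ x v
      = ∫ x, ψ x * inner ℝ v (outerNormal A x) ∂surfaceMeasure (frontier A)

namespace HasDivergenceTheorem

variable {n : ℕ} {A : Set (Space n)}

lemma empty : HasDivergenceTheorem (∅ : Set (Space n)) := by
  constructor
  · rw [surfaceMeasure, frontier_empty, Measure.restrict_empty]
    infer_instance
  all_goals simp [surfaceMeasure]

lemma univ : HasDivergenceTheorem (univ : Set (Space n)) := by
  constructor
  · rw [surfaceMeasure, frontier_univ, Measure.restrict_empty]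
    infer_instance
  · simp [surfaceMeasure]
  · intro ψ hψ hc v
    simp [surfaceMeasure, integral_fderiv_apply_eq_zero volume hψ hc v]

lemma epigraph {φ : EuclideanSpace ℝ (Fin n) → ℝ} {K : NNReal} (h : LipschitzWith K φ) :
    HasDivergenceTheorem (epigraph φ) where
  isLocallyFiniteMeasure := ⟨fun x => ⟨_, Metric.ball_mem_nhds x one_pos,
    surfaceMeasure_frontier_epigraph_lt_top h Metric.isBounded_ball⟩⟩
  aestronglyMeasurable := aestronglyMeasurable_outerNormal_epigraph h
  integral_fderiv _ hψ hc := setIntegral_epigraph_fderiv_eq h hψ hc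

lemma preimage (h : HasDivergenceTheorem A) (T : Space n ≃ᵃⁱ[ℝ] Space n) :
    HasDivergenceTheorem (T ⁻¹' A) := by
  have embedding : MeasurableEmbedding T := T.toHomeomorph.measurableEmbedding
  have surface : MeasurePreserving T (surfaceMeasure (frontier (T ⁻¹' A)))
      (surfaceMeasure (frontier A)) := by
    have := (T.toIsometryEquiv.measurePreserving_euclideanHausdorffMeasure n).restrict_preimage_emb
      embedding (frontier A)
    rwa [show frontier (T ⁻¹' A) = T ⁻¹' frontier A from (T.toHomeomorph.preimage_frontier A).symm]
  have volume_preserving : MeasurePreserving T volume volume := by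
    have := T.toIsometryEquiv.measurePreserving_euclideanHausdorffMeasure (n + 1)
    rw [EuclideanSpace.euclideanHausdorffMeasure_eq_volume] at this
    exact this
  have normal : outerNormal (T ⁻¹' A) = T.linearIsometryEquiv.symm ∘ outerNormal A ∘ T :=
    funext fun x => (T.linearIsometryEquiv.symm_apply_eq.2 (outerNormal_preimage T).symm).symm
  refine ⟨⟨fun x => ?_⟩, ?_, fun ψ hψ hc v => ?_⟩
  · have := h.isLocallyFiniteMeasure
    obtain ⟨s, hs, hs_top⟩ := (surfaceMeasure (frontier A)).finiteAt_nhds (T x)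
    exact ⟨T ⁻¹' s, T.continuous.continuousAt hs, by
      rwa [surface.measure_preimage_emb embedding]⟩
  · rw [normal]
    exact T.linearIsometryEquiv.symm.continuous.comp_aestronglyMeasurable
      (h.aestronglyMeasurable.comp_measurePreserving surface)
  · have deriv_eq (x) : fderiv ℝ ψ x v
        = fderiv ℝ (ψ ∘ T.symm) (T x) (T.linearIsometryEquiv v) := by
      have hψ' : DifferentiableAt ℝ ψ (T.symm (T x)) := hψ.differentiable one_ne_zero _
      have hT : HasFDerivAt T.symm _ (T x) :=
        T.symm.toContinuousAffineEquiv.toContinuousAffineMap.hasFDerivAt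
      rw [(hψ'.hasFDerivAt.comp (T x) hT).fderiv, T.symm_apply_apply]
      exact congrArg _ (T.linearIsometryEquiv.symm_apply_apply v).symm
    have hψT : ContDiff ℝ 1 (ψ ∘ T.symm) :=
      hψ.comp T.symm.toContinuousAffineEquiv.toContinuousAffineMap.contDiff
    simp only [deriv_eq]
    rw [volume_preserving.setIntegral_preimage_emb embedding
      (fun y => fderiv ℝ (ψ ∘ T.symm) y (T.linearIsometryEquiv v)),
      h.integral_fderiv _ hψT (hc.comp_homeomorph T.symm.toHomeomorph),
      ← surface.integral_comp embedding]
    simp only [← outerNormal_preimage, LinearIsometryEquiv.inner_map_map, Function.comp_apply,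
      T.symm_apply_apply]

lemma integral_fderiv_of_inter_eq {B W : Set (Space n)} (h : HasDivergenceTheorem B)
    (hW : IsOpen W) (hAB : A ∩ W = B ∩ W) {ψ : Space n → ℝ} (hψ : ContDiff ℝ 1 ψ)
    (hc : HasCompactSupport ψ) (hs : tsupport ψ ⊆ W) (v : Space n) :
    ∫ x in A, fderiv ℝ ψ x v
      = ∫ x, ψ x * inner ℝ v (outerNormal A x) ∂surfaceMeasure (frontier A) := by
  have zero : ∀ x ∉ W, ψ x = 0 := fun x hx => image_eq_zero_of_notMem_tsupport fun h => hx (hs h)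
  have fderiv_zero : ∀ x ∉ W, fderiv ℝ ψ x v = 0 := fun x hx => by
    rw [fderiv_of_notMem_tsupport ℝ fun h => hx (hs h), zero_apply]
  rw [← setIntegral_eq_integral_of_forall_compl_eq_zero fderiv_zero,
    restrict_restrict_eq_of_inter_eq hW.measurableSet hAB,
    setIntegral_eq_integral_of_forall_compl_eq_zero fderiv_zero, h.integral_fderiv ψ hψ hc v,
    ← setIntegral_eq_integral_of_forall_compl_eq_zero (s := W) fun x hx => by simp [zero x hx],
    ← setIntegral_eq_integral_of_forall_compl_eq_zero (s := W) (μ := surfaceMeasure (frontier A))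
      fun x hx => by simp [zero x hx], surfaceMeasure, surfaceMeasure,
    restrict_restrict_eq_of_inter_eq hW.measurableSet (frontier_inter_eq_of_inter_eq hW hAB)]
  exact setIntegral_congr_fun hW.measurableSet fun x hx => by
    simp only [outerNormal_eq_of_inter_eq hW hAB hx]

theorem of_locally (h : ∀ x, ∃ B, HasDivergenceTheorem B ∧ A =ᶠ[𝓝 x] B) :
    HasDivergenceTheorem A := by
  choose B hB germ using h
  choose W W_open mem_W inter_eq using fun x => exists_isOpen_inter_eq (germ x)
  have restrict_eq (x) : (surfaceMeasure (frontier A)).restrict (W x)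
      = (surfaceMeasure (frontier (B x))).restrict (W x) :=
    restrict_restrict_eq_of_inter_eq (W_open x).measurableSet
      (frontier_inter_eq_of_inter_eq (W_open x) (inter_eq x))
  have finite : IsLocallyFiniteMeasure (surfaceMeasure (frontier A)) := ⟨fun x => by
    have := (hB x).isLocallyFiniteMeasure
    obtain ⟨s, hs, hs_top⟩ := (surfaceMeasure (frontier (B x))).finiteAt_nhds x
    refine ⟨s ∩ W x, inter_mem hs ((W_open x).mem_nhds (mem_W x)), ?_⟩
    rw [← Measure.restrict_apply' (W_open x).measurableSet, restrict_eq,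
      Measure.restrict_apply' (W_open x).measurableSet]
    exact (measure_mono inter_subset_left).trans_lt hs_top⟩
  have measurable : AEStronglyMeasurable (outerNormal A) (surfaceMeasure (frontier A)) := by
    obtain ⟨s, hs, cover⟩ := TopologicalSpace.countable_cover_nhds fun x =>
      (W_open x).mem_nhds (mem_W x)
    rw [← Measure.restrict_univ (μ := surfaceMeasure (frontier A)), ← cover,
      biUnion_eq_iUnion]
    have := hs.to_subtype
    refine aestronglyMeasurable_iUnion_iff.2 fun x => ?_
    rw [restrict_eq]
    refine ((hB x).aestronglyMeasurable.restrict).congr ?_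
    filter_upwards [ae_restrict_mem (W_open x).measurableSet] with y hy
    exact outerNormal_eq_of_inter_eq (W_open x) (inter_eq x).symm hy
  have integrable {f : Space n → ℝ} (hf : ContDiff ℝ 1 f) (hc : HasCompactSupport f) (v) :=
    integrable_mul_inner_outerNormal measurable hf.continuous hc v
  refine ⟨finite, measurable, fun ψ hψ hc => contDiff_one_induction_of_locally (p := fun f => ∀ v,
    ∫ x in A, fderiv ℝ f x v
      = ∫ x, f x * inner ℝ v (outerNormal A x) ∂surfaceMeasure (frontier A)) ?_ ?_ hψ hc⟩
  · intro f g hf hfc hg hgc hfA hgA v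
    have fderiv_add (x) : fderiv ℝ (f + g) x v = fderiv ℝ f x v + fderiv ℝ g x v := by
      rw [fderiv_add (hf.differentiable one_ne_zero x) (hg.differentiable one_ne_zero x), add_apply]
    simp only [fderiv_add, Pi.add_apply, add_mul]
    rw [integral_add (integrable hf hfc v) (integrable hg hgc v), ← hfA, ← hgA]
    exact integral_add (integrable_fderiv_apply hf hfc v).integrableOn
      (integrable_fderiv_apply hg hgc v).integrableOn
  · exact fun x => ⟨W x, (W_open x).mem_nhds (mem_W x), fun f hf hfc hfs =>
      (hB x).integral_fderiv_of_inter_eq (W_open x) (inter_eq x) hf hfc hfs⟩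

end HasDivergenceTheorem

lemma eventuallyEq_closure {X : Type*} [TopologicalSpace X] {A B : Set X} {x : X}
    (h : A =ᶠ[𝓝 x] B) : closure A =ᶠ[𝓝 x] closure B := by
  refine eventuallyEq_set.2 (h.eventuallyEq_nhds.mono fun y hy => ?_)
  rw [mem_closure_iff_frequently, mem_closure_iff_frequently]
  exact frequently_congr (eventuallyEq_set.1 hy)

lemma mem_frontier_iff_of_eventuallyEq {X : Type*} [TopologicalSpace X] {A B : Set X} {x : X}
    (h : A =ᶠ[𝓝 x] B) : x ∈ frontier A ↔ x ∈ frontier B := by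
  rw [frontier_eq_closure_inter_closure, frontier_eq_closure_inter_closure, mem_inter_iff,
    mem_inter_iff, (eventuallyEq_set.1 (eventuallyEq_closure h)).self_of_nhds,
    (eventuallyEq_set.1 (eventuallyEq_closure h.compl)).self_of_nhds]

/-- Near each of its boundary points, `A` is, in suitable rigid coordinates `T`, the epigraph of a
globally Lipschitz function. -/
def HasLipschitzBoundary {n : ℕ} (A : Set (Space n)) : Prop :=
  ∀ x ∈ frontier A, ∃ (T : Space n ≃ᵃⁱ[ℝ] Space n) (φ : EuclideanSpace ℝ (Fin n) → ℝ) (K : NNReal),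
    LipschitzWith K φ ∧ A =ᶠ[𝓝 x] T ⁻¹' epigraph φ

lemma IsBoundaryGraph.exists_lipschitzOnWith {n k : ℕ} {α ρ M : ℝ}
    {φ : EuclideanSpace ℝ (Fin n) → ℝ} (h : IsBoundaryGraph k α ρ M φ)
    (hk : (k = 0 ∧ α = 1) ∨ 1 ≤ k) : ∃ K, LipschitzOnWith K φ (Metric.ball 0 ρ) := by
  obtain ⟨b, c, norm_deriv_le, hoelder, -⟩ := h.norm_le
  rcases hk with ⟨rfl, rfl⟩ | hk
  · refine ⟨c.toNNReal, lipschitzOnWith_iff_norm_sub_le.2 fun x hx y hy => ?_⟩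
    have le : ‖φ x - φ y‖ ≤ c * ‖x - y‖ := by
      simpa only [Real.rpow_one, iteratedFDeriv_zero_eq_comp, Function.comp_apply, ← map_sub,
        LinearIsometryEquiv.norm_map] using hoelder x hx y hy
    exact le.trans (by gcongr; exact Real.le_coe_toNNReal c)
  · refine ⟨(b 1).toNNReal, (convex_ball 0 ρ).lipschitzOnWith_of_nnnorm_fderivWithin_le (𝕜 := ℝ)
      (h.contDiffOn.differentiableOn (by exact_mod_cast (by omega : k ≠ 0))) fun x hx => ?_⟩
    rw [fderivWithin_of_isOpen Metric.isOpen_ball hx, ← NNReal.coe_le_coe, coe_nnnorm,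
      ← norm_iteratedFDeriv_one]
    exact (norm_deriv_le 1 hk x hx).trans (Real.le_coe_toNNReal _)

lemma IsDomainOfClass.hasLipschitzBoundary {n k : ℕ} {α ρ M : ℝ} {A : Set (Space n)}
    (h : IsDomainOfClass k α ρ M A) (hk : (k = 0 ∧ α = 1) ∨ 1 ≤ k) : HasLipschitzBoundary A := by
  intro x₀ hx₀
  obtain ⟨R, φ, hφ, mem_iff⟩ := h.graph x₀ hx₀
  obtain ⟨K, hK⟩ := hφ.exists_lipschitzOnWith hk
  obtain ⟨g, hg, φ_eq⟩ := hK.extend_real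
  set T : Space n ≃ᵃⁱ[ℝ] Space n :=
    (R.toAffineIsometryEquiv.trans (AffineIsometryEquiv.constVAdd ℝ (Space n) x₀)).symm
  refine ⟨T, g, K, hg, eventuallyEq_set.2 ?_⟩
  filter_upwards [Metric.ball_mem_nhds x₀ h.rho_pos] with x hx
  have norm_lt : ‖T x‖ < ρ := by
    have symm_zero : T.symm 0 = x₀ := by simp [T]
    have map_center : T x₀ = 0 := (T.symm_apply_eq.1 symm_zero).symm
    rwa [← dist_zero_right, ← map_center, T.dist_map]
  have x_eq : x₀ + R (T x) = x := T.symm_apply_apply x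
  rw [mem_preimage, mem_epigraph, ← φ_eq, ← mem_iff _ norm_lt, x_eq]
  exact mem_ball_zero_iff.2 ((norm_tangentialPart_le _).trans_lt norm_lt)

namespace HasLipschitzBoundary

variable {n : ℕ} {A : Set (Space n)}

theorem hasDivergenceTheorem (h : HasLipschitzBoundary A) : HasDivergenceTheorem A := by
  refine .of_locally fun x => ?_
  by_cases hx : x ∈ frontier A
  · obtain ⟨T, φ, K, hφ, germ⟩ := h x hx
    exact ⟨_, (HasDivergenceTheorem.epigraph hφ).preimage T, germ⟩
  · rw [frontier_eq_closure_inter_closure, mem_inter_iff, not_and_or] at hx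
    rcases hx with hx | hx
    · exact ⟨∅, .empty, eventuallyEq_empty.2 (by simpa using! mem_closure_iff_frequently.not.1 hx)⟩
    · rw [closure_compl, notMem_compl_iff, mem_interior_iff_mem_nhds] at hx
      exact ⟨univ, .univ, eventuallyEq_univ.2 hx⟩

lemma isFiniteMeasure_surfaceMeasure (h : HasLipschitzBoundary A) (hb : Bornology.IsBounded A) :
    IsFiniteMeasure (surfaceMeasure (frontier A)) := by
  have := h.hasDivergenceTheorem.isLocallyFiniteMeasure
  have frontier_compact : IsCompact (frontier A) :=
    hb.isCompact_closure.of_isClosed_subset isClosed_frontier frontier_subset_closure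
  refine ⟨?_⟩
  rw [surfaceMeasure, Measure.restrict_apply_univ]
  have := frontier_compact.measure_lt_top (μ := surfaceMeasure (frontier A))
  rwa [surfaceMeasure, Measure.restrict_apply_self] at this

lemma volume_frontier (h : HasLipschitzBoundary A) (hb : Bornology.IsBounded A) :
    volume (frontier A) = 0 := by
  have finite := (h.isFiniteMeasure_surfaceMeasure hb).measure_univ_lt_top
  rw [surfaceMeasure, Measure.restrict_apply_univ] at finite
  rw [← EuclideanSpace.euclideanHausdorffMeasure_eq_volume]
  exact (Measure.euclideanHausdorffMeasure_zero_or_top n.lt_succ_self _).resolve_right finite.ne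

lemma frontier_closure (h : HasLipschitzBoundary A) : frontier (closure A) = frontier A := by
  refine frontier_closure_subset.antisymm fun x hx => ?_
  obtain ⟨T, φ, K, hφ, germ⟩ := h x hx
  rw [mem_frontier_iff_of_eventuallyEq germ, ← AffineIsometryEquiv.coe_toHomeomorph,
    ← T.toHomeomorph.preimage_frontier] at hx
  rw [mem_frontier_iff_of_eventuallyEq (eventuallyEq_closure germ),
    ← AffineIsometryEquiv.coe_toHomeomorph, ← T.toHomeomorph.preimage_closure,
    ← T.toHomeomorph.preimage_frontier, frontier_closure_epigraph hφ.continuous]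
  rwa [frontier_epigraph hφ.continuous] at hx ⊢

end HasLipschitzBoundary

section PartialDeriv

variable {n : ℕ} {f g : Space n → ℝ} {x : Space n} (j : Fin (n + 1))

lemma contDiff_partialDeriv (hf : ContDiff ℝ ∞ f) : ContDiff ℝ ∞ (partialDeriv j f) :=
  (hf.fderiv_right (by simp)).clm_apply contDiff_const

lemma partialDeriv_mul (hf : DifferentiableAt ℝ f x) (hg : DifferentiableAt ℝ g x) :
    partialDeriv j (fun y => f y * g y) x
      = partialDeriv j f x * g x + f x * partialDeriv j g x := by
  simp only [partialDeriv, fderiv_fun_mul hf hg, add_apply, smul_apply, smul_eq_mul]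
  ring

lemma partialDeriv_congr (h : f =ᶠ[𝓝 x] g) : partialDeriv j f x = partialDeriv j g x := by
  rw [partialDeriv, partialDeriv, h.fderiv_eq]

end PartialDeriv

namespace HasLipschitzBoundary

variable {n : ℕ} {A : Set (Space n)}

theorem integral_partialDeriv (h : HasLipschitzBoundary A) (hb : Bornology.IsBounded A)
    {ψ : Space n → ℝ} (hψ : ContDiff ℝ 1 ψ) (j : Fin (n + 1)) :
    ∫ x in A, partialDeriv j ψ x = ∫ x, ψ x * outerNormal A x j ∂surfaceMeasure (frontier A) := by
  obtain ⟨χ, hχ, hχc, -, χ_one⟩ :=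
    exists_cutoff hb.isCompact_closure isOpen_univ (subset_univ _)
  have germ (x) (hx : x ∈ closure A) : (fun y => χ y * ψ y) =ᶠ[𝓝 x] ψ := by
    filter_upwards [χ_one.filter_mono (nhds_le_nhdsSet hx)] with y hy
    rw [hy, one_mul]
  have ae_eq : partialDeriv j (fun y => χ y * ψ y) =ᵐ[volume.restrict A] partialDeriv j ψ :=
    (ae_restrict_of_forall_mem isClosed_closure.measurableSet fun x hx =>
      partialDeriv_congr j (germ x hx)).filter_mono
        (ae_mono (Measure.restrict_mono subset_closure le_rfl))
  rw [← integral_congr_ae ae_eq]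
  refine (h.hasDivergenceTheorem.integral_fderiv _ ((hχ.of_le (by simp)).mul hψ)
    hχc.mul_right (EuclideanSpace.single j 1)).trans ?_
  refine setIntegral_congr_fun isClosed_frontier.measurableSet fun x hx => ?_
  simp [(germ x (frontier_subset_closure hx)).self_of_nhds, EuclideanSpace.inner_single_left]

end HasLipschitzBoundary

/-- The divergence theorem on `U`, localised by the cut-off `χ` to the part `Γ` of the boundary,
on which `ν` is the exterior normal to `U`. -/
structure IsGreenPair {n : ℕ} (U Γ : Set (Space n)) (ν : Space n → Space n) (χ : Space n → ℝ) :
    Prop where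
  isOpen : IsOpen U
  isBounded : Bornology.IsBounded U
  isBounded_boundary : Bornology.IsBounded Γ
  isFiniteMeasure : IsFiniteMeasure (surfaceMeasure Γ)
  aestronglyMeasurable : AEStronglyMeasurable ν (surfaceMeasure Γ)
  norm_le : ∀ x, ‖ν x‖ ≤ 1
  contDiff : ContDiff ℝ ∞ χ
  integral_partialDeriv : ∀ ψ, ContDiff ℝ ∞ ψ → ∀ j,
    ∫ x in U, partialDeriv j (fun x => χ x * ψ x) x = ∫ x, ψ x * ν x j ∂surfaceMeasure Γ

lemma HasLipschitzBoundary.isGreenPair {n : ℕ} {A : Set (Space n)} (h : HasLipschitzBoundary A)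
    (ho : IsOpen A) (hb : Bornology.IsBounded A) :
    IsGreenPair A (frontier A) (outerNormal A) (fun _ => 1) where
  isOpen := ho
  isBounded := hb
  isBounded_boundary := hb.closure.subset frontier_subset_closure
  isFiniteMeasure := h.isFiniteMeasure_surfaceMeasure hb
  aestronglyMeasurable := h.hasDivergenceTheorem.aestronglyMeasurable
  norm_le := norm_outerNormal_le A
  contDiff := contDiff_const
  integral_partialDeriv ψ hψ j := by
    simpa only [one_mul] using h.integral_partialDeriv hb (hψ.of_le (by simp)) j

lemma disjoint_frontier_of_isOpen {X : Type*} [TopologicalSpace X] {A : Set X} (hA : IsOpen A) :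
    Disjoint A (frontier A) := by
  rw [hA.frontier_eq]
  exact disjoint_sdiff_right

lemma frontier_sdiff_of_closure_subset {X : Type*} [TopologicalSpace X] {A B : Set X}
    (hA : IsOpen A) (hB : IsClosed B) (hBA : B ⊆ A) :
    frontier (A \ B) = frontier A ∪ frontier B := by
  have disj : Disjoint B (frontier A) := (disjoint_frontier_of_isOpen hA).mono_left hBA
  rw [sdiff_eq]
  refine Subset.antisymm ?_ (union_subset (fun x hx => ?_) fun x hx => ?_)
  · refine (frontier_inter_subset _ _).trans (union_subset_union inter_subset_left ?_)
    rw [frontier_compl]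
    exact inter_subset_right
  · refine (inter_subset_left : frontier (A ∩ Bᶜ) ∩ Bᶜ ⊆ _) ?_
    rw [frontier_inter_open_inter hB.isOpen_compl]
    exact ⟨hx, fun hxB => disjoint_left.1 disj hxB hx⟩
  · refine (inter_subset_left : frontier (A ∩ Bᶜ) ∩ A ⊆ _) ?_
    rw [inter_comm A, frontier_inter_open_inter hA, frontier_compl]
    exact ⟨hx, hBA (hB.frontier_subset hx)⟩

/-- `Ω` is a bounded open set with Lipschitz boundary and `D` an open set with Lipschitz boundary
whose closure is contained in `Ω`. -/
structure IsLipschitzHole {n : ℕ} (Ω D : Set (Space n)) : Prop where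
  isOpen : IsOpen Ω
  isBounded : Bornology.IsBounded Ω
  hasLipschitzBoundary : HasLipschitzBoundary Ω
  isOpen_hole : IsOpen D
  hasLipschitzBoundary_hole : HasLipschitzBoundary D
  closure_subset : closure D ⊆ Ω

lemma IsCavity.isLipschitzHole {n : ℕ} {Ω D : Set (Space n)} {ρ M : ℝ}
    (hΩ : IsDomainOfClass 0 1 ρ M Ω) (h : IsCavity Ω D) : IsLipschitzHole Ω D := by
  obtain ⟨α, ρ', L, -, -, hD⟩ := h.smooth
  refine ⟨hΩ.isOpen, hΩ.isBounded, hΩ.hasLipschitzBoundary (Or.inl ⟨rfl, rfl⟩), hD.isOpen,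
    hD.hasLipschitzBoundary (Or.inr one_le_two), fun x hx => by_contra fun hxΩ => ?_⟩
  have mem_frontier : x ∈ frontier Ω := by
    rw [hΩ.isOpen.frontier_eq]
    exact ⟨closure_mono h.subset hx, hxΩ⟩
  obtain ⟨d, hd, le_dist⟩ := h.dist_pos
  obtain ⟨y, hy, dist_lt⟩ := Metric.mem_closure_iff.1 hx d hd
  exact (le_dist y hy x mem_frontier).not_gt (dist_comm x y ▸ dist_lt)

namespace IsLipschitzHole

variable {n : ℕ} {Ω D : Set (Space n)}

lemma isBounded_hole (h : IsLipschitzHole Ω D) : Bornology.IsBounded D :=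
  h.isBounded.subset (subset_closure.trans h.closure_subset)

lemma isOpen_sdiff (h : IsLipschitzHole Ω D) : IsOpen (Ω \ closure D) :=
  h.isOpen.sdiff isClosed_closure

lemma isBounded_sdiff (h : IsLipschitzHole Ω D) : Bornology.IsBounded (Ω \ closure D) :=
  h.isBounded.subset sdiff_subset

lemma disjoint_frontier (h : IsLipschitzHole Ω D) : Disjoint (frontier D) (frontier Ω) :=
  (disjoint_frontier_of_isOpen h.isOpen).mono_left (frontier_subset_closure.trans h.closure_subset)

lemma frontier_sdiff (h : IsLipschitzHole Ω D) :
    frontier (Ω \ closure D) = frontier Ω ∪ frontier D := by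
  rw [frontier_sdiff_of_closure_subset h.isOpen isClosed_closure h.closure_subset,
    h.hasLipschitzBoundary_hole.frontier_closure]

lemma frontier_sdiff_sdiff_outer (h : IsLipschitzHole Ω D) :
    frontier (Ω \ closure D) \ frontier Ω = frontier D := by
  rw [h.frontier_sdiff, union_sdiff_left, h.disjoint_frontier.sdiff_eq_left]

lemma frontier_sdiff_sdiff_inner (h : IsLipschitzHole Ω D) :
    frontier (Ω \ closure D) \ frontier D = frontier Ω := by
  rw [h.frontier_sdiff, union_sdiff_right, h.disjoint_frontier.symm.sdiff_eq_left]

lemma exists_cutoff (h : IsLipschitzHole Ω D) :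
    ∃ χ : Space n → ℝ, ContDiff ℝ ∞ χ ∧ HasCompactSupport χ ∧ tsupport χ ⊆ Ω ∧
      (∀ᶠ x in 𝓝ˢ (closure D), χ x = 1) ∧ ∀ᶠ x in 𝓝ˢ (frontier Ω), χ x = 0 := by
  obtain ⟨χ, hχ, hχc, tsupport_subset, χ_one⟩ :=
    _root_.exists_cutoff h.isBounded_hole.isCompact_closure h.isOpen h.closure_subset
  refine ⟨χ, hχ, hχc, tsupport_subset, χ_one, eventually_nhdsSet_iff_forall.2 fun x hx => ?_⟩
  exact notMem_tsupport_iff_eventuallyEq.1 fun hxs =>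
    disjoint_left.1 (disjoint_frontier_of_isOpen h.isOpen) (tsupport_subset hxs) hx

lemma closure_ae_eq (h : IsLipschitzHole Ω D) : closure D =ᵐ[volume] D := by
  rw [closure_eq_self_union_frontier]
  exact union_ae_eq_left_of_ae_eq_empty
    (ae_eq_empty.2 (h.hasLipschitzBoundary_hole.volume_frontier h.isBounded_hole))

lemma integral_sdiff_partialDeriv (h : IsLipschitzHole Ω D) {ψ : Space n → ℝ}
    (hψ : ContDiff ℝ 1 ψ) (j : Fin (n + 1)) :
    ∫ x in Ω \ closure D, partialDeriv j ψ x
      = ∫ x, ψ x * outerNormal Ω x j ∂surfaceMeasure (frontier Ω)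
        - ∫ x, ψ x * outerNormal D x j ∂surfaceMeasure (frontier D) := by
  have continuous_deriv : Continuous (partialDeriv j ψ) :=
    (hψ.continuous_fderiv one_ne_zero).clm_apply continuous_const
  have integrable : IntegrableOn (partialDeriv j ψ) Ω :=
    (continuous_deriv.continuousOn.integrableOn_compact h.isBounded.isCompact_closure).mono_set
      subset_closure
  rw [setIntegral_sdiff isClosed_closure.measurableSet integrable h.closure_subset,
    setIntegral_congr_set h.closure_ae_eq,
    h.hasLipschitzBoundary.integral_partialDeriv h.isBounded hψ,
    h.hasLipschitzBoundary_hole.integral_partialDeriv h.isBounded_hole hψ]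

section GreenPair

variable {χ : Space n → ℝ} (hχ : ContDiff ℝ ∞ χ)
include hχ

lemma isGreenPair_outer (h : IsLipschitzHole Ω D) (χ_one : ∀ᶠ x in 𝓝ˢ (frontier Ω), χ x = 1)
    (χ_zero : ∀ᶠ x in 𝓝ˢ (frontier D), χ x = 0) :
    IsGreenPair (Ω \ closure D) (frontier Ω) (outerNormal Ω) χ where
  isOpen := h.isOpen_sdiff
  isBounded := h.isBounded_sdiff
  isBounded_boundary := h.isBounded.closure.subset frontier_subset_closure
  isFiniteMeasure := h.hasLipschitzBoundary.isFiniteMeasure_surfaceMeasure h.isBounded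
  aestronglyMeasurable := h.hasLipschitzBoundary.hasDivergenceTheorem.aestronglyMeasurable
  norm_le := norm_outerNormal_le Ω
  contDiff := hχ
  integral_partialDeriv ψ hψ j := by
    rw [h.integral_sdiff_partialDeriv ((hχ.mul hψ).of_le (by simp)) j, surfaceMeasure,
      surfaceMeasure, setIntegral_congr_fun (g := fun x => ψ x * outerNormal Ω x j)
        isClosed_frontier.measurableSet fun x hx => by simp [χ_one.self_of_nhdsSet x hx],
      setIntegral_congr_fun (s := frontier D) (g := fun x => 0)
        isClosed_frontier.measurableSet fun x hx => by simp [χ_zero.self_of_nhdsSet x hx],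
      integral_zero, sub_zero]

lemma isGreenPair_inner (h : IsLipschitzHole Ω D) (χ_one : ∀ᶠ x in 𝓝ˢ (frontier D), χ x = 1)
    (χ_zero : ∀ᶠ x in 𝓝ˢ (frontier Ω), χ x = 0) :
    IsGreenPair (Ω \ closure D) (frontier D) (fun x => -outerNormal D x) χ where
  isOpen := h.isOpen_sdiff
  isBounded := h.isBounded_sdiff
  isBounded_boundary := h.isBounded_hole.closure.subset frontier_subset_closure
  isFiniteMeasure := h.hasLipschitzBoundary_hole.isFiniteMeasure_surfaceMeasure h.isBounded_hole
  aestronglyMeasurable := h.hasLipschitzBoundary_hole.hasDivergenceTheorem.aestronglyMeasurable.neg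
  norm_le x := (norm_neg _).trans_le (norm_outerNormal_le D x)
  contDiff := hχ
  integral_partialDeriv ψ hψ j := by
    rw [h.integral_sdiff_partialDeriv ((hχ.mul hψ).of_le (by simp)) j, surfaceMeasure,
      surfaceMeasure, setIntegral_congr_fun (s := frontier D)
        (g := fun x => ψ x * outerNormal D x j)
        isClosed_frontier.measurableSet fun x hx => by simp [χ_one.self_of_nhdsSet x hx],
      setIntegral_congr_fun (s := frontier Ω) (g := fun x => 0)
        isClosed_frontier.measurableSet fun x hx => by simp [χ_zero.self_of_nhdsSet x hx],
      integral_zero, zero_sub, ← integral_neg]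
    simp only [PiLp.neg_apply, mul_neg]

end GreenPair

end IsLipschitzHole

/-! ### Convergence in `L²` -/

/-- Convergence `φ k → f` in `L²(μ)`. -/
structure L2Tendsto {X : Type*} [MeasurableSpace X] (μ : Measure X) (φ : ℕ → X → ℝ) (f : X → ℝ) :
    Prop where
  memLp : ∀ k, MemLp (φ k) 2 μ
  memLp_limit : MemLp f 2 μ
  tendsto : Tendsto (fun k => eLpNorm (fun x => φ k x - f x) 2 μ) atTop (𝓝 0)

namespace L2Tendsto

variable {X : Type*} [MeasurableSpace X] {μ ν : Measure X} {φ ψ : ℕ → X → ℝ} {f g : X → ℝ}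

lemma tendsto_toLp (h : L2Tendsto μ φ f) :
    Tendsto (fun k => (h.memLp k).toLp (φ k)) atTop (𝓝 (h.memLp_limit.toLp f)) :=
  (Lp.tendsto_Lp_iff_tendsto_eLpNorm'' φ h.memLp f h.memLp_limit).2 h.tendsto

lemma const (hf : MemLp f 2 μ) : L2Tendsto μ (fun _ => f) f :=
  ⟨fun _ => hf, hf, by simp⟩

lemma mono_measure (h : L2Tendsto μ φ f) (hν : ν ≤ μ) : L2Tendsto ν φ f where
  memLp k := (h.memLp k).mono_measure hν
  memLp_limit := h.memLp_limit.mono_measure hν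
  tendsto := tendsto_of_tendsto_of_tendsto_of_le_of_le tendsto_const_nhds h.tendsto
    (fun _ => zero_le) fun _ => eLpNorm_mono_measure _ hν

lemma congr' (h : L2Tendsto μ φ f) (hφ : ∀ k, φ k =ᵐ[μ] ψ k) (hf : f =ᵐ[μ] g) :
    L2Tendsto μ ψ g where
  memLp k := (memLp_congr_ae (hφ k)).1 (h.memLp k)
  memLp_limit := (memLp_congr_ae hf).1 h.memLp_limit
  tendsto := h.tendsto.congr fun k => eLpNorm_congr_ae ((hφ k).sub hf)

lemma add (hφ : L2Tendsto μ φ f) (hψ : L2Tendsto μ ψ g) :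
    L2Tendsto μ (fun k x => φ k x + ψ k x) (fun x => f x + g x) where
  memLp k := (hφ.memLp k).add (hψ.memLp k)
  memLp_limit := hφ.memLp_limit.add hψ.memLp_limit
  tendsto := (Lp.tendsto_Lp_iff_tendsto_eLpNorm'' _ (fun k => (hφ.memLp k).add (hψ.memLp k)) _
    (hφ.memLp_limit.add hψ.memLp_limit)).1 (hφ.tendsto_toLp.add hψ.tendsto_toLp)

lemma sub (hφ : L2Tendsto μ φ f) (hψ : L2Tendsto μ ψ g) :
    L2Tendsto μ (fun k x => φ k x - ψ k x) (fun x => f x - g x) where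
  memLp k := (hφ.memLp k).sub (hψ.memLp k)
  memLp_limit := hφ.memLp_limit.sub hψ.memLp_limit
  tendsto := (Lp.tendsto_Lp_iff_tendsto_eLpNorm'' _ (fun k => (hφ.memLp k).sub (hψ.memLp k)) _
    (hφ.memLp_limit.sub hψ.memLp_limit)).1 (hφ.tendsto_toLp.sub hψ.tendsto_toLp)

lemma mul_left {c : X → ℝ} {C : ℝ} (h : L2Tendsto μ φ f) (hc : AEStronglyMeasurable c μ)
    (hC : ∀ᵐ x ∂μ, ‖c x‖ ≤ C) : L2Tendsto μ (fun k x => c x * φ k x) (fun x => c x * f x) := by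
  have bound (u : X → ℝ) : ∀ᵐ x ∂μ, ‖c x * u x‖ ≤ C * ‖u x‖ := by
    filter_upwards [hC] with x hx
    rw [norm_mul]
    gcongr
  refine ⟨fun k => (h.memLp k).of_le_mul (hc.mul (h.memLp k).1) (bound _),
    h.memLp_limit.of_le_mul (hc.mul h.memLp_limit.1) (bound _), ?_⟩
  have mul_tendsto : Tendsto (fun k => ENNReal.ofReal C * eLpNorm (fun x => φ k x - f x) 2 μ)
      atTop (𝓝 0) := by
    simpa only [mul_zero] using ENNReal.Tendsto.const_mul h.tendsto (Or.inr ENNReal.ofReal_ne_top)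
  refine tendsto_of_tendsto_of_tendsto_of_le_of_le tendsto_const_nhds mul_tendsto
    (fun _ => zero_le) fun k => eLpNorm_le_mul_eLpNorm_of_ae_le_mul ?_ 2
  simpa only [mul_sub] using bound fun x => φ k x - f x

lemma indicator {s t : Set X} (h : L2Tendsto (μ.restrict s) φ f) (hs : MeasurableSet s)
    (hst : s ⊆ t) (hφ : ∀ k, ∀ x ∈ t \ s, φ k x = 0) (ht : MeasurableSet t) :
    L2Tendsto (μ.restrict t) φ (s.indicator f) := by
  have restrict_restrict : (μ.restrict t).restrict s = μ.restrict s :=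
    Measure.restrict_restrict_of_subset hst
  have indicator_ae_eq (k : ℕ) : s.indicator (φ k) =ᵐ[μ.restrict t] φ k :=
    ae_restrict_of_forall_mem ht fun x hx => by
      by_cases hxs : x ∈ s
      · exact indicator_of_mem hxs _
      · rw [indicator_of_notMem hxs, hφ k x ⟨hx, hxs⟩]
  have memLp_indicator {u : X → ℝ} (hu : MemLp u 2 (μ.restrict s)) :
      MemLp (s.indicator u) 2 (μ.restrict t) := by
    rwa [memLp_indicator_iff_restrict hs, restrict_restrict]
  refine ⟨fun k => (memLp_congr_ae (indicator_ae_eq k)).1 (memLp_indicator (h.memLp k)),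
    memLp_indicator h.memLp_limit, h.tendsto.congr fun k => ?_⟩
  rw [← restrict_restrict, ← eLpNorm_indicator_eq_eLpNorm_restrict hs]
  refine eLpNorm_congr_ae ((indicator_sub' s (φ k) f).eventuallyEq.trans ?_)
  exact (indicator_ae_eq k).sub .rfl

lemma integral_mul (hφ : L2Tendsto μ φ f) (hψ : L2Tendsto μ ψ g) :
    Tendsto (fun k => ∫ x, φ k x * ψ k x ∂μ) atTop (𝓝 (∫ x, f x * g x ∂μ)) := by
  have inner_toLp {a b : X → ℝ} (ha : MemLp a 2 μ) (hb : MemLp b 2 μ) :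
      inner ℝ (ha.toLp a) (hb.toLp b) = ∫ x, a x * b x ∂μ := by
    rw [L2.inner_def]
    refine integral_congr_ae ?_
    filter_upwards [ha.coeFn_toLp, hb.coeFn_toLp] with x hax hbx
    simp [hax, hbx, mul_comm]
  simpa only [inner_toLp] using hφ.tendsto_toLp.inner (𝕜 := ℝ) hψ.tendsto_toLp

end L2Tendsto

/-! ### Mollification in `L²` -/

section Averaging

lemma sq_eLpNorm_two {X : Type*} [MeasurableSpace X] {μ : Measure X} (f : X → ℝ) :
    eLpNorm f 2 μ ^ 2 = ∫⁻ x, ‖f x‖ₑ ^ 2 ∂μ := by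
  rw [eLpNorm_eq_lintegral_rpow_enorm_toReal two_ne_zero ENNReal.ofNat_ne_top,
    ← ENNReal.rpow_natCast, ← ENNReal.rpow_mul]
  simp

lemma enorm_integral_sub_le_eLpNorm {X : Type*} [MeasurableSpace X] {P : Measure X}
    [IsProbabilityMeasure P] {f : X → ℝ} (hf : AEStronglyMeasurable f P) (c : ℝ) :
    ‖∫ x, f x ∂P - c‖ₑ ≤ eLpNorm (fun x => f x - c) 2 P := by
  have sub_meas : AEStronglyMeasurable (fun x => f x - c) P := hf.sub aestronglyMeasurable_const
  rcases eq_or_ne (eLpNorm (fun x => f x - c) 2 P) ⊤ with h_top | h_top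
  · exact le_top.trans_eq h_top.symm
  have integrable_sub : Integrable (fun x => f x - c) P :=
    MemLp.integrable one_le_two ⟨sub_meas, h_top.lt_top⟩
  have integrable : Integrable f P :=
    (integrable_sub.add (integrable_const c)).congr (.of_forall fun x => sub_add_cancel (f x) c)
  have integral_sub_const : ∫ x, f x ∂P - c = ∫ x, (f x - c) ∂P := by
    rw [integral_sub integrable (integrable_const c)]
    simp
  calc ‖∫ x, f x ∂P - c‖ₑ ≤ ∫⁻ x, ‖f x - c‖ₑ ∂P := by
        rw [integral_sub_const]
        exact enorm_integral_le_lintegral_enorm _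
    _ = eLpNorm (fun x => f x - c) 1 P := eLpNorm_one_eq_lintegral_enorm.symm
    _ ≤ eLpNorm (fun x => f x - c) 2 P := eLpNorm_le_eLpNorm_of_exponent_le one_le_two sub_meas

variable {G : Type*} [AddCommGroup G] [MeasurableSpace G] [MeasurableAdd₂ G] [MeasurableNeg G]
  {μ : Measure G} [SFinite μ] [μ.IsAddLeftInvariant]

lemma eLpNorm_average_translate_sub_le {P : Measure G} [IsProbabilityMeasure P] (hP : P ≪ μ)
    {f : G → ℝ} (hf : AEStronglyMeasurable f μ) {c : ENNReal}
    (hc : ∀ᵐ y ∂P, eLpNorm (fun x => f (x - y) - f x) 2 μ ≤ c) :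
    eLpNorm (fun x => ∫ y, f (x - y) ∂P - f x) 2 μ ≤ c := by
  have joint_meas : AEStronglyMeasurable (fun z : G × G => f (z.1 - z.2) - f z.1) (μ.prod P) :=
    (hf.comp_quasiMeasurePreserving ((quasiMeasurePreserving_sub μ μ).mono_left
      (Measure.AbsolutelyContinuous.rfl.prod hP))).sub
      (hf.comp_quasiMeasurePreserving Measure.quasiMeasurePreserving_fst)
  have translate_meas (x : G) : AEStronglyMeasurable (fun y => f (x - y)) P :=
    hf.comp_quasiMeasurePreserving ((quasiMeasurePreserving_sub_left μ x).mono_left hP)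
  refine (ENNReal.pow_le_pow_left_iff two_ne_zero).1 ?_
  calc eLpNorm (fun x => ∫ y, f (x - y) ∂P - f x) 2 μ ^ 2
      = ∫⁻ x, ‖∫ y, f (x - y) ∂P - f x‖ₑ ^ 2 ∂μ := sq_eLpNorm_two _
    _ ≤ ∫⁻ x, ∫⁻ y, ‖f (x - y) - f x‖ₑ ^ 2 ∂P ∂μ := by
        gcongr with x
        rw [← sq_eLpNorm_two]
        gcongr
        exact enorm_integral_sub_le_eLpNorm (translate_meas x) (f x)
    _ = ∫⁻ y, eLpNorm (fun x => f (x - y) - f x) 2 μ ^ 2 ∂P := by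
        rw [lintegral_lintegral_swap (joint_meas.enorm.pow_const 2)]
        simp only [sq_eLpNorm_two]
    _ ≤ ∫⁻ _, c ^ 2 ∂P := by
        refine lintegral_mono_ae ?_
        filter_upwards [hc] with y hy
        gcongr
    _ = c ^ 2 := by simp

end Averaging

section Mollification

variable {E : Type*} [NormedAddCommGroup E] [NormedSpace ℝ E] [FiniteDimensional ℝ E]
  [MeasurableSpace E] [BorelSpace E] {μ : Measure E} [μ.IsAddHaarMeasure]

lemma tendsto_eLpNorm_translate_sub {f : E → ℝ} (hf : MemLp f 2 μ) :
    Tendsto (fun y => eLpNorm (fun x => f (x - y) - f x) 2 μ) (𝓝 0) (𝓝 0) := by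
  let translate : C(E, C(E, E)) :=
    ContinuousMap.curry ⟨fun z : E × E => z.2 - z.1, by fun_prop⟩
  have measurePreserving (y : E) : MeasurePreserving (translate y) μ μ :=
    measurePreserving_sub_right μ y
  have tendsto_comp := Filter.Tendsto.compMeasurePreservingLp (f := fun _ : E => hf.toLp f)
    (tendsto_const_nhds (f := 𝓝 (0 : E))) (translate.continuous.tendsto 0) measurePreserving
    (measurePreserving 0) ENNReal.ofNat_ne_top
  rw [tendsto_iff_edist_tendsto_0] at tendsto_comp
  refine tendsto_comp.congr fun y => ?_
  rw [Lp.toLp_compMeasurePreserving, Lp.toLp_compMeasurePreserving, Lp.edist_toLp_toLp]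
  congr 1
  funext x
  simp [translate]

lemma eLpNorm_convolution_sub_le {η f : E → ℝ} (hη : Continuous η) (hηc : HasCompactSupport η)
    (η_nonneg : ∀ x, 0 ≤ η x) (integral_η : ∫ x, η x ∂μ = 1) (hf : AEStronglyMeasurable f μ)
    {c : ENNReal} (hc : ∀ y, η y ≠ 0 → eLpNorm (fun x => f (x - y) - f x) 2 μ ≤ c) :
    eLpNorm (fun x => convolution η f (.lsmul ℝ ℝ) μ x - f x) 2 μ ≤ c := by
  have density_meas : Measurable fun y => ENNReal.ofReal (η y) := hη.measurable.ennreal_ofReal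
  have isProbability : IsProbabilityMeasure (μ.withDensity fun y => ENNReal.ofReal (η y)) := by
    refine ⟨?_⟩
    rw [withDensity_apply _ MeasurableSet.univ, Measure.restrict_univ,
      ← ofReal_integral_eq_lintegral_ofReal (hη.integrable_of_hasCompactSupport hηc)
      (Eventually.of_forall η_nonneg), integral_η, ENNReal.ofReal_one]
  have convolution_eq (x : E) : convolution η f (.lsmul ℝ ℝ) μ x
      = ∫ y, f (x - y) ∂(μ.withDensity fun y => ENNReal.ofReal (η y)) := by
    rw [integral_withDensity_eq_integral_toReal_smul density_meas
      (Eventually.of_forall fun _ => ENNReal.ofReal_lt_top), convolution_lsmul]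
    simp only [ENNReal.toReal_ofReal (η_nonneg _)]
  simp only [convolution_eq]
  refine eLpNorm_average_translate_sub_le (withDensity_absolutelyContinuous _ _) hf
    ((ae_withDensity_iff density_meas).2 (Eventually.of_forall fun y hy => hc y fun h => hy ?_))
  rw [h, ENNReal.ofReal_zero]

theorem tendsto_eLpNorm_convolution_sub {ι : Type*} {l : Filter ι} {η : ι → ContDiffBump (0 : E)}
    (hη : Tendsto (fun i => (η i).rOut) l (𝓝 0)) {f : E → ℝ} (hf : MemLp f 2 μ) :
    Tendsto (fun i => eLpNorm
      (fun x => convolution ((η i).normed μ) f (.lsmul ℝ ℝ) μ x - f x) 2 μ) l (𝓝 0) := by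
  refine ENNReal.tendsto_nhds_zero.2 fun ε hε => ?_
  obtain ⟨δ, hδ, translate_le⟩ := Metric.eventually_nhds_iff_ball.1
    (ENNReal.tendsto_nhds_zero.1 (tendsto_eLpNorm_translate_sub hf) ε hε)
  filter_upwards [hη.eventually (gt_mem_nhds hδ)] with i hi
  refine eLpNorm_convolution_sub_le (η i).continuous_normed (η i).hasCompactSupport_normed
    (η i).nonneg_normed (η i).integral_normed hf.1 fun y hy => translate_le y ?_
  rw [← Function.mem_support, (η i).support_normed_eq] at hy
  exact Metric.ball_subset_ball hi.le hy

lemma convolution_normed_eq_zero (η : ContDiffBump (0 : E)) {f : E → ℝ} {K : Set E} {x : E}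
    (hf : Function.support f ⊆ K) (hx : x ∉ Metric.thickening η.rOut K) :
    convolution (η.normed μ) f (.lsmul ℝ ℝ) μ x = 0 := by
  by_contra hne
  obtain ⟨y, hy, z, hz, rfl⟩ := support_convolution_subset _ (Function.mem_support.2 hne)
  rw [η.support_normed_eq] at hy
  refine hx (Metric.mem_thickening_iff.2 ⟨z, hf hz, ?_⟩)
  simpa only [dist_add_self_left] using mem_ball_zero_iff.1 hy

end Mollification

section WeakDerivative

variable {n : ℕ} {η f : Space n → ℝ}

lemma partialDeriv_comp_sub_left (hη : Differentiable ℝ η) (j : Fin (n + 1)) (x t : Space n) :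
    partialDeriv j (fun t => η (x - t)) t = -partialDeriv j η (x - t) := by
  have hasFDerivAt : HasFDerivAt (fun t => η (x - t)) _ t :=
    (hη (x - t)).hasFDerivAt.comp t ((hasFDerivAt_id t).const_sub x)
  rw [partialDeriv, hasFDerivAt.fderiv]
  simp [partialDeriv]

lemma partialDeriv_convolution (hη : ContDiff ℝ ∞ η) (hηc : HasCompactSupport η)
    (hf : LocallyIntegrable f) (j : Fin (n + 1)) (x : Space n) :
    partialDeriv j (convolution η f (.lsmul ℝ ℝ) volume) x
      = convolution (partialDeriv j η) f (.lsmul ℝ ℝ) volume x := by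
  have exists_deriv := (hηc.fderiv ℝ).convolutionExists_left
    (ContinuousLinearMap.precompL (Space n) (.lsmul ℝ ℝ)) (μ := volume)
    (hη.continuous_fderiv (by simp)) hf x
  have hasFDerivAt := hηc.hasFDerivAt_convolution_left (.lsmul ℝ ℝ) (hη.of_le (by simp)) hf x
  rw [partialDeriv, hasFDerivAt.fderiv, convolution_def,
    ContinuousLinearMap.integral_apply exists_deriv]
  rfl

lemma MemH1.partialDeriv_convolution {Df : Fin (n + 1) → Space n → ℝ} (hf : MemH1 univ f Df)
    (hη : ContDiff ℝ ∞ η) (hηc : HasCompactSupport η) (j : Fin (n + 1)) :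
    partialDeriv j (convolution η f (.lsmul ℝ ℝ) volume)
      = convolution η (Df j) (.lsmul ℝ ℝ) volume := by
  have memLp : MemLp f 2 volume := by simpa using hf.memLp
  funext x
  rw [_root_.partialDeriv_convolution hη hηc (memLp.locallyIntegrable one_le_two)]
  have weak_deriv := hf.weak_deriv (fun t => η (x - t)) (hη.comp (contDiff_const.sub contDiff_id))
    (hηc.comp_homeomorph (Homeomorph.subLeft x)) (subset_univ _) j
  simp only [partialDeriv_comp_sub_left (hη.differentiable (by simp)), Measure.restrict_univ,
    mul_neg, integral_neg, neg_inj] at weak_deriv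
  simpa only [convolution_lsmul_swap, smul_eq_mul, mul_comm] using weak_deriv

end WeakDerivative

/-! ### Sobolev functions with traces -/

section BoundedContinuous

variable {X : Type*} [PseudoMetricSpace X] [ProperSpace X] [MeasurableSpace X]
  [OpensMeasurableSpace X] {μ : Measure X} {s : Set X} {f : X → ℝ}

lemma exists_ae_restrict_norm_le (hf : Continuous f) (hs : Bornology.IsBounded s) :
    ∃ C, ∀ᵐ x ∂μ.restrict s, ‖f x‖ ≤ C := by
  obtain ⟨C, hC⟩ := hs.isCompact_closure.exists_bound_of_continuousOn hf.continuousOn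
  exact ⟨C, ae_restrict_of_ae_restrict_of_subset subset_closure
    (ae_restrict_of_forall_mem isClosed_closure.measurableSet hC)⟩

lemma memLp_restrict_of_isBounded [IsFiniteMeasure (μ.restrict s)] (hf : Continuous f)
    (hs : Bornology.IsBounded s) (p : ENNReal) : MemLp f p (μ.restrict s) := by
  obtain ⟨C, hC⟩ := exists_ae_restrict_norm_le (μ := μ) hf hs
  exact MemLp.of_bound hf.aestronglyMeasurable C hC

lemma L2Tendsto.mul_continuous {φ : ℕ → X → ℝ} {g : X → ℝ} (h : L2Tendsto (μ.restrict s) φ g)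
    (hf : Continuous f) (hs : Bornology.IsBounded s) :
    L2Tendsto (μ.restrict s) (fun k x => f x * φ k x) (fun x => f x * g x) := by
  obtain ⟨C, hC⟩ := exists_ae_restrict_norm_le (μ := μ) hf hs
  exact h.mul_left hf.aestronglyMeasurable hC

end BoundedContinuous

section TestFunctions

variable {n : ℕ} {U V : Set (Space n)} {f τ : Space n → ℝ} {x : Space n}
  {Df Df' : Fin (n + 1) → Space n → ℝ}

lemma partialDeriv_eq_zero_of_notMem_tsupport (hx : x ∉ tsupport f) (j : Fin (n + 1)) :
    partialDeriv j f x = 0 := by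
  rw [partialDeriv, fderiv_of_notMem_tsupport ℝ hx, zero_apply]

lemma setIntegral_mul_eq_integral_of_tsupport_subset (hτ : tsupport τ ⊆ U) :
    ∫ x in U, f x * τ x = ∫ x, f x * τ x :=
  setIntegral_eq_integral_of_forall_compl_eq_zero fun x hx => by
    rw [image_eq_zero_of_notMem_tsupport fun h => hx (hτ h), mul_zero]

lemma tsupport_partialDeriv_subset (τ : Space n → ℝ) (j : Fin (n + 1)) :
    tsupport (partialDeriv j τ) ⊆ tsupport τ :=
  tsupport_fderiv_apply_subset ℝ _

lemma memLp_of_test (hτ : ContDiff ℝ ∞ τ) (hτc : HasCompactSupport τ) : MemLp τ 2 volume :=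
  hτ.continuous.memLp_of_hasCompactSupport hτc

lemma integral_mul_partialDeriv (hf : ContDiff ℝ ∞ f) (hτ : ContDiff ℝ ∞ τ)
    (hτc : HasCompactSupport τ) (j : Fin (n + 1)) :
    ∫ x, f x * partialDeriv j τ x = -∫ x, partialDeriv j f x * τ x :=
  integral_mul_fderiv_eq_neg_fderiv_mul_of_integrable
    (((contDiff_partialDeriv j hf).continuous.mul hτ.continuous).integrable_of_hasCompactSupport
      hτc.mul_left)
    ((hf.continuous.mul (contDiff_partialDeriv j hτ).continuous).integrable_of_hasCompactSupport
      (hτc.fderiv_apply ℝ _).mul_left)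
    ((hf.continuous.mul hτ.continuous).integrable_of_hasCompactSupport hτc.mul_left)
    (fun x _ => hf.differentiable (by simp) x) fun x _ => hτ.differentiable (by simp) x

lemma ae_eq_zero_of_forall_test (hU : IsOpen U) (hf : MemLp f 2 (volume.restrict U))
    (h : ∀ τ : Space n → ℝ, ContDiff ℝ ∞ τ → HasCompactSupport τ → tsupport τ ⊆ U →
      ∫ x in U, f x * τ x = 0) : f =ᵐ[volume.restrict U] 0 := by
  refine (ae_restrict_iff' hU.measurableSet).2
    (hU.ae_eq_zero_of_integral_contDiff_smul_eq_zero
      (locallyIntegrableOn_of_locallyIntegrable_restrict (hf.locallyIntegrable one_le_two))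
      fun τ hτ hτc hτU => ?_)
  rw [← h τ hτ hτc hτU, setIntegral_mul_eq_integral_of_tsupport_subset hτU]
  simp only [smul_eq_mul, mul_comm]

namespace MemH1

lemma deriv_ae_eq (hU : IsOpen U) (h : MemH1 U f Df) (h' : MemH1 U f Df') (j : Fin (n + 1)) :
    Df j =ᵐ[volume.restrict U] Df' j := by
  rw [← sub_ae_eq_zero]
  refine ae_eq_zero_of_forall_test hU ((h.memLp_deriv j).sub (h'.memLp_deriv j))
    fun τ hτ hτc hτU => ?_
  have memLp_test : MemLp τ 2 (volume.restrict U) := (memLp_of_test hτ hτc).restrict U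
  have integrable {g : Space n → ℝ} (hg : MemLp g 2 (volume.restrict U)) :
      Integrable (fun x => g x * τ x) (volume.restrict U) := hg.integrable_mul memLp_test
  simp only [Pi.sub_apply, sub_mul]
  rw [integral_sub (integrable (h.memLp_deriv j)) (integrable (h'.memLp_deriv j)), sub_eq_zero,
    ← neg_inj, ← h.weak_deriv τ hτ hτc hτU j, ← h'.weak_deriv τ hτ hτc hτU j]

end MemH1

end TestFunctions

section Approximation

variable {n : ℕ}

/-- The smooth functions `φ k` converge to `f` in `H¹(U)`, where `Df` is the gradient of `f`, and
to `a` in `L²(Γ)`. -/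
structure IsH1Approx (U Γ : Set (Space n)) (φ : ℕ → Space n → ℝ) (f : Space n → ℝ)
    (Df : Fin (n + 1) → Space n → ℝ) (a : Space n → ℝ) : Prop where
  contDiff : ∀ k, ContDiff ℝ ∞ (φ k)
  tendsto : L2Tendsto (volume.restrict U) φ f
  tendsto_deriv : ∀ j, L2Tendsto (volume.restrict U) (fun k => partialDeriv j (φ k)) (Df j)
  tendsto_trace : L2Tendsto (surfaceMeasure Γ) φ a

/-- `f ∈ H¹(U)` has the trace `a` on `Γ`, as in `HasTrace`, where `Df` is the gradient of `f`. -/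
def HasH1Trace (U Γ : Set (Space n)) (f : Space n → ℝ) (Df : Fin (n + 1) → Space n → ℝ)
    (a : Space n → ℝ) : Prop :=
  ∃ φ, IsH1Approx U Γ φ f Df a

variable {U V Γ Γ' : Set (Space n)} {φ ψ : ℕ → Space n → ℝ} {f g a b c : Space n → ℝ}
  {Df Dg : Fin (n + 1) → Space n → ℝ}

namespace IsH1Approx

lemma mul_smooth (h : IsH1Approx U Γ φ f Df a) (hU : Bornology.IsBounded U)
    (hΓ : Bornology.IsBounded Γ) (hc : ContDiff ℝ ∞ c) :
    IsH1Approx U Γ (fun k x => c x * φ k x) (fun x => c x * f x)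
      (fun j x => c x * Df j x + partialDeriv j c x * f x) (fun x => c x * a x) where
  contDiff k := hc.mul (h.contDiff k)
  tendsto := h.tendsto.mul_continuous hc.continuous hU
  tendsto_deriv j := by
    refine (((h.tendsto_deriv j).mul_continuous hc.continuous hU).add
      (h.tendsto.mul_continuous (contDiff_partialDeriv j hc).continuous hU)).congr'
      (fun k => Eventually.of_forall fun x => ?_) .rfl
    rw [partialDeriv_mul j (hc.differentiable (by simp) x)
      ((h.contDiff k).differentiable (by simp) x), add_comm]
  tendsto_trace := h.tendsto_trace.mul_continuous hc.continuous hΓ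

end IsH1Approx

lemma eventually_memLp_of_tendsto {X : Type*} [MeasurableSpace X] {μ : Measure X}
    {φ : ℕ → X → ℝ} {f : X → ℝ} (hφ : ∀ k, AEStronglyMeasurable (φ k) μ) (hf : MemLp f 2 μ)
    (h : Tendsto (fun k => eLpNorm (fun x => φ k x - f x) 2 μ) atTop (𝓝 0)) :
    ∀ᶠ k in atTop, MemLp (φ k) 2 μ := by
  filter_upwards [h.eventually (gt_mem_nhds ENNReal.zero_lt_top)] with k hk
  have memLp_sub : MemLp (fun x => φ k x - f x) 2 μ := ⟨(hφ k).sub hf.1, hk⟩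
  exact (memLp_congr_ae (.of_forall fun x => sub_add_cancel (φ k x) (f x))).1 (memLp_sub.add hf)

lemma HasTrace.hasH1Trace (hU : IsOpen U) (h : HasTrace U Γ f a) (hf : MemH1 U f Df) :
    HasH1Trace U Γ f Df a := by
  obtain ⟨Df', hf', ha, φ, hφ, tendsto, tendsto_deriv', tendsto_trace⟩ := h
  have tendsto_deriv (j : Fin (n + 1)) : Tendsto
      (fun k => eLpNorm (fun x => partialDeriv j (φ k) x - Df j x) 2 (volume.restrict U))
      atTop (𝓝 0) :=
    (tendsto_deriv' j).congr fun k => eLpNorm_congr_ae (.sub .rfl (hf'.deriv_ae_eq hU hf j))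
  obtain ⟨N, hN⟩ := eventually_atTop.1
    (((eventually_memLp_of_tendsto (fun k => (hφ k).continuous.aestronglyMeasurable) hf.memLp
      tendsto).and (eventually_memLp_of_tendsto
        (fun k => (hφ k).continuous.aestronglyMeasurable) ha tendsto_trace)).and
      (eventually_all.2 fun j => eventually_memLp_of_tendsto
        (fun k => (contDiff_partialDeriv j (hφ k)).continuous.aestronglyMeasurable)
        (hf.memLp_deriv j) (tendsto_deriv j)))
  have tail (k : ℕ) := hN (k + N) (Nat.le_add_left N k)
  have tendsto_tail := tendsto_add_atTop_nat N
  exact ⟨fun k => φ (k + N), fun k => hφ _,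
    ⟨fun k => (tail k).1.1, hf.memLp, tendsto.comp tendsto_tail⟩,
    fun j => ⟨fun k => (tail k).2 j, hf.memLp_deriv j, (tendsto_deriv j).comp tendsto_tail⟩,
    ⟨fun k => (tail k).1.2, ha, tendsto_trace.comp tendsto_tail⟩⟩

lemma hasH1Trace_of_contDiff [IsFiniteMeasure (surfaceMeasure Γ)] (hf : ContDiff ℝ ∞ f)
    (hU : Bornology.IsBounded U) (hΓ : Bornology.IsBounded Γ) :
    HasH1Trace U Γ f (fun j => partialDeriv j f) f := by
  have : IsFiniteMeasure (volume.restrict U) :=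
    isFiniteMeasure_restrict.2 hU.measure_lt_top.ne
  have : IsFiniteMeasure ((Measure.euclideanHausdorffMeasure n).restrict Γ) :=
    inferInstanceAs (IsFiniteMeasure (surfaceMeasure Γ))
  exact ⟨fun _ => f, fun _ => hf, .const (memLp_restrict_of_isBounded hf.continuous hU 2),
    fun j => .const (memLp_restrict_of_isBounded (contDiff_partialDeriv j hf).continuous hU 2),
    .const (memLp_restrict_of_isBounded hf.continuous hΓ 2)⟩

namespace HasH1Trace

lemma memH1 (h : HasH1Trace U Γ f Df a) : MemH1 U f Df := by
  obtain ⟨φ, hφ⟩ := h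
  refine ⟨hφ.tendsto.memLp_limit, fun j => (hφ.tendsto_deriv j).memLp_limit,
    fun τ hτ hτc hτU j => ?_⟩
  have tendsto_left := hφ.tendsto.integral_mul (.const
    ((memLp_of_test (contDiff_partialDeriv j hτ) (hτc.fderiv_apply ℝ _)).restrict U))
  have tendsto_right := (hφ.tendsto_deriv j).integral_mul
    (.const ((memLp_of_test hτ hτc).restrict U))
  refine tendsto_nhds_unique tendsto_left (tendsto_right.neg.congr fun k => ?_)
  rw [setIntegral_mul_eq_integral_of_tsupport_subset hτU,
    setIntegral_mul_eq_integral_of_tsupport_subset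
      ((tsupport_partialDeriv_subset τ j).trans hτU),
    integral_mul_partialDeriv (hφ.contDiff k) hτ hτc]

lemma hasTrace (h : HasH1Trace U Γ f Df a) : HasTrace U Γ f a := by
  obtain ⟨φ, hφ⟩ := id h
  exact ⟨Df, h.memH1, hφ.tendsto_trace.memLp_limit, φ, hφ.contDiff, hφ.tendsto.tendsto,
    fun j => (hφ.tendsto_deriv j).tendsto, hφ.tendsto_trace.tendsto⟩

lemma mono (h : HasH1Trace U Γ f Df a) (hV : V ⊆ U) (hΓ : Γ' ⊆ Γ) : HasH1Trace V Γ' f Df a := by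
  obtain ⟨φ, hφ⟩ := h
  exact ⟨φ, hφ.contDiff, hφ.tendsto.mono_measure (Measure.restrict_mono_set _ hV),
    fun j => (hφ.tendsto_deriv j).mono_measure (Measure.restrict_mono_set _ hV),
    hφ.tendsto_trace.mono_measure (Measure.restrict_mono_set _ hΓ)⟩

lemma congr (h : HasH1Trace U Γ f Df a) (hf : f =ᵐ[volume.restrict U] g)
    (hD : ∀ j, Df j =ᵐ[volume.restrict U] Dg j) (ha : a =ᵐ[surfaceMeasure Γ] b) :
    HasH1Trace U Γ g Dg b := by
  obtain ⟨φ, hφ⟩ := h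
  exact ⟨φ, hφ.contDiff, hφ.tendsto.congr' (fun _ => .rfl) hf,
    fun j => (hφ.tendsto_deriv j).congr' (fun _ => .rfl) (hD j),
    hφ.tendsto_trace.congr' (fun _ => .rfl) ha⟩

lemma add (hf : HasH1Trace U Γ f Df a) (hg : HasH1Trace U Γ g Dg b) :
    HasH1Trace U Γ (fun x => f x + g x) (fun j x => Df j x + Dg j x) (fun x => a x + b x) := by
  obtain ⟨φ, hφ⟩ := hf
  obtain ⟨ψ, hψ⟩ := hg
  refine ⟨fun k x => φ k x + ψ k x, fun k => (hφ.contDiff k).add (hψ.contDiff k),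
    hφ.tendsto.add hψ.tendsto, fun j => ((hφ.tendsto_deriv j).add (hψ.tendsto_deriv j)).congr'
      (fun k => Eventually.of_forall fun x => ?_) .rfl, hφ.tendsto_trace.add hψ.tendsto_trace⟩
  simp only [partialDeriv]
  rw [fderiv_fun_add ((hφ.contDiff k).differentiable (by simp) x)
    ((hψ.contDiff k).differentiable (by simp) x), add_apply]

lemma sub (hf : HasH1Trace U Γ f Df a) (hg : HasH1Trace U Γ g Dg b) :
    HasH1Trace U Γ (fun x => f x - g x) (fun j x => Df j x - Dg j x) (fun x => a x - b x) := by
  obtain ⟨φ, hφ⟩ := hf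
  obtain ⟨ψ, hψ⟩ := hg
  refine ⟨fun k x => φ k x - ψ k x, fun k => (hφ.contDiff k).sub (hψ.contDiff k),
    hφ.tendsto.sub hψ.tendsto, fun j => ((hφ.tendsto_deriv j).sub (hψ.tendsto_deriv j)).congr'
      (fun k => Eventually.of_forall fun x => ?_) .rfl, hφ.tendsto_trace.sub hψ.tendsto_trace⟩
  simp only [partialDeriv]
  rw [fderiv_fun_sub ((hφ.contDiff k).differentiable (by simp) x)
    ((hψ.contDiff k).differentiable (by simp) x), sub_apply]

lemma mul_smooth (h : HasH1Trace U Γ f Df a) (hU : Bornology.IsBounded U)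
    (hΓ : Bornology.IsBounded Γ) (hc : ContDiff ℝ ∞ c) :
    HasH1Trace U Γ (fun x => c x * f x) (fun j x => c x * Df j x + partialDeriv j c x * f x)
      (fun x => c x * a x) :=
  let ⟨_, hφ⟩ := h
  ⟨_, hφ.mul_smooth hU hΓ hc⟩

lemma mul_cutoff (h : HasH1Trace U Γ f Df (fun _ => 0)) (hU : Bornology.IsBounded U)
    (hΓ : IsClosed Γ) (hΓU : Γ ⊆ frontier U) (hc : ContDiff ℝ ∞ c)
    (c_zero : ∀ x ∈ frontier U \ Γ, c x = 0) :
    HasH1Trace U (frontier U) (fun x => c x * f x)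
      (fun j x => c x * Df j x + partialDeriv j c x * f x) (fun _ => 0) := by
  obtain ⟨φ, hφ⟩ := h
  have hcφ := hφ.mul_smooth hU
    (hU.closure.subset (hΓU.trans frontier_subset_closure)) hc
  refine ⟨_, hcφ.contDiff, hcφ.tendsto, hcφ.tendsto_deriv,
    (hcφ.tendsto_trace.indicator hΓ.measurableSet hΓU (fun k x hx => ?_)
      isClosed_frontier.measurableSet).congr' (fun _ => .rfl) ?_⟩
  · rw [c_zero x hx, zero_mul]
  · simp

lemma indicator_mul (h : HasH1Trace U Γ f Df a) (hU : MeasurableSet U)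
    (hb : Bornology.IsBounded U) (hΓ : Bornology.IsBounded Γ) (hV : MeasurableSet V) (hUV : U ⊆ V)
    (hc : ContDiff ℝ ∞ c) (c_zero : ∀ᶠ x in 𝓝ˢ (V \ U), c x = 0) :
    HasH1Trace V Γ (U.indicator fun x => c x * f x)
      (fun j => U.indicator fun x => c x * Df j x + partialDeriv j c x * f x)
      (fun x => c x * a x) := by
  obtain ⟨φ, hφ⟩ := h
  have hcφ := hφ.mul_smooth hb hΓ hc
  have germ_zero (k : ℕ) (x) (hx : x ∈ V \ U) : (fun y => c y * φ k y) =ᶠ[𝓝 x] 0 := by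
    filter_upwards [c_zero.filter_mono (nhds_le_nhdsSet hx)] with y hy
    rw [hy, zero_mul, Pi.zero_apply]
  refine ⟨_, hcφ.contDiff, hcφ.tendsto.indicator hU hUV (fun k x hx => ?_) hV,
    fun j => (hcφ.tendsto_deriv j).indicator hU hUV (fun k x hx => ?_) hV, hcφ.tendsto_trace⟩
  · exact (germ_zero k x hx).self_of_nhds
  · exact partialDeriv_eq_zero_of_notMem_tsupport
      (notMem_tsupport_iff_eventuallyEq.2 (germ_zero k x hx)) j

end HasH1Trace

end Approximation

/-! ### Green's formula and extension by zero -/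

namespace IsGreenPair

variable {n : ℕ} {U Γ : Set (Space n)} {ν : Space n → Space n} {χ : Space n → ℝ}
  {f g a b : Space n → ℝ} {Df Dg : Fin (n + 1) → Space n → ℝ}

lemma l2Tendsto_normal_mul (h : IsGreenPair U Γ ν χ) {φ : ℕ → Space n → ℝ}
    (hφ : L2Tendsto (surfaceMeasure Γ) φ a) (j : Fin (n + 1)) :
    L2Tendsto (surfaceMeasure Γ) (fun k x => ν x j * φ k x) (fun x => ν x j * a x) :=
  hφ.mul_left ((EuclideanSpace.proj (𝕜 := ℝ) j).continuous.comp_aestronglyMeasurable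
    h.aestronglyMeasurable)
    (Eventually.of_forall fun x => (PiLp.norm_apply_le (ν x) j).trans (h.norm_le x))

theorem integral_add_integral (h : IsGreenPair U Γ ν χ) (hf : HasH1Trace U Γ f Df a)
    (hg : HasH1Trace U Γ g Dg b) (j : Fin (n + 1)) :
    (∫ x in U, f x * (χ x * Dg j x + partialDeriv j χ x * g x))
      + ∫ x in U, Df j x * (χ x * g x) = ∫ x, a x * (ν x j * b x) ∂surfaceMeasure Γ := by
  obtain ⟨φ, hφ⟩ := hf
  obtain ⟨ψ, hψ⟩ := hg
  have hχψ := hψ.mul_smooth h.isBounded h.isBounded_boundary h.contDiff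
  refine tendsto_nhds_unique ((hφ.tendsto.integral_mul (hχψ.tendsto_deriv j)).add
    ((hφ.tendsto_deriv j).integral_mul hχψ.tendsto)) ?_
  refine (hφ.tendsto_trace.integral_mul (h.l2Tendsto_normal_mul hψ.tendsto_trace j)).congr
    fun k => ?_
  have product_rule (x : Space n) : partialDeriv j (fun x => χ x * (φ k x * ψ k x)) x
      = φ k x * partialDeriv j (fun x => χ x * ψ k x) x
        + partialDeriv j (φ k) x * (χ x * ψ k x) := by
    simp only [mul_left_comm (χ _) (φ k _)]
    rw [partialDeriv_mul j ((hφ.contDiff k).differentiable (by simp) x)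
      ((hχψ.contDiff k).differentiable (by simp) x), add_comm]
  have divergence_theorem := h.integral_partialDeriv (fun x => φ k x * ψ k x)
    ((hφ.contDiff k).mul (hψ.contDiff k)) j
  simp only [product_rule] at divergence_theorem
  refine Eq.trans ?_ (divergence_theorem.symm.trans (integral_add
    ((hφ.tendsto.memLp k).integrable_mul ((hχψ.tendsto_deriv j).memLp k))
    (((hφ.tendsto_deriv j).memLp k).integrable_mul (hχψ.tendsto.memLp k))))
  simp only [mul_assoc, mul_comm (ν _ j)]

lemma memH1_indicator (h : IsGreenPair U Γ ν χ) (hf : HasH1Trace U Γ f Df (fun _ => 0)) :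
    MemH1 univ (U.indicator fun x => χ x * f x)
      (fun j => U.indicator fun x => χ x * Df j x + partialDeriv j χ x * f x) := by
  have measurable := h.isOpen.measurableSet
  obtain ⟨φ, hφ⟩ := id hf
  have hχφ := hφ.mul_smooth h.isBounded h.isBounded_boundary h.contDiff
  have memLp_indicator {u : Space n → ℝ} (hu : MemLp u 2 (volume.restrict U)) :
      MemLp (U.indicator u) 2 (volume.restrict univ) := by
    rwa [Measure.restrict_univ, memLp_indicator_iff_restrict measurable]
  refine ⟨memLp_indicator hχφ.tendsto.memLp_limit,
    fun j => memLp_indicator (hχφ.tendsto_deriv j).memLp_limit, fun τ hτ _ _ j => ?_⟩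
  have := h.isFiniteMeasure
  have green := h.integral_add_integral
    (hasH1Trace_of_contDiff hτ h.isBounded h.isBounded_boundary) hf j
  simp only [mul_zero, integral_zero, add_comm (∫ x in U, τ x * _)] at green
  simp only [Measure.restrict_univ, ← indicator_mul_left, integral_indicator measurable]
  rw [eq_neg_iff_add_eq_zero, ← green]
  simp only [mul_comm]

end IsGreenPair

section CompactSupport

variable {n : ℕ} {f g : Space n → ℝ} {Df Dg : Fin (n + 1) → Space n → ℝ} {K W : Set (Space n)}

lemma exists_contDiffBump_seq {δ : ℝ} (hδ : 0 < δ) :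
    ∃ η : ℕ → ContDiffBump (0 : Space n),
      (∀ k, (η k).rOut ≤ δ) ∧ Tendsto (fun k => (η k).rOut) atTop (𝓝 0) := by
  refine ⟨fun k => ⟨δ / (k + 1) / 2, δ / (k + 1), by positivity, half_lt_self (by positivity)⟩,
    fun k => div_le_self hδ.le (by simp), ?_⟩
  simpa only [mul_one_div, mul_zero] using tendsto_one_div_add_atTop_nhds_zero_nat.const_mul δ

theorem MemH1.exists_isH1Approx (h : MemH1 univ f Df) (hK : IsCompact K) (hW : IsOpen W)
    (hKW : K ⊆ W) (hf : ∀ x ∉ K, f x = 0) :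
    ∃ φ, IsH1Approx univ Wᶜ φ f Df (fun _ => 0) ∧ ∀ k, HasCompactSupport (φ k) := by
  obtain ⟨δ, hδ, thickening_subset⟩ := hK.exists_thickening_subset_open hW hKW
  obtain ⟨η, rOut_le, tendsto_rOut⟩ := exists_contDiffBump_seq (n := n) hδ
  let φ (k : ℕ) := convolution ((η k).normed volume) f (.lsmul ℝ ℝ) volume
  have memLp : MemLp f 2 volume := by simpa using h.memLp
  have memLp_deriv (j : Fin (n + 1)) : MemLp (Df j) 2 volume := by simpa using h.memLp_deriv j
  have partialDeriv_φ (k : ℕ) (j : Fin (n + 1)) : partialDeriv j (φ k)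
      = convolution ((η k).normed volume) (Df j) (.lsmul ℝ ℝ) volume :=
    h.partialDeriv_convolution (η k).contDiff_normed (η k).hasCompactSupport_normed j
  have support_f : Function.support f ⊆ K := fun x hx => by
    by_contra hxK
    exact hx (hf x hxK)
  have contDiff (k : ℕ) : ContDiff ℝ ∞ (φ k) :=
    (η k).hasCompactSupport_normed.contDiff_convolution_left _ (η k).contDiff_normed
      (memLp.locallyIntegrable one_le_two)
  have compactSupport (k : ℕ) : HasCompactSupport (φ k) :=
    (η k).hasCompactSupport_normed.convolution _ (.of_support_subset_isCompact hK support_f)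
  have eq_zero (k : ℕ) (x) (hx : x ∈ Wᶜ) : φ k x = 0 :=
    convolution_normed_eq_zero (η k) support_f fun h_near =>
      hx (thickening_subset (Metric.thickening_mono (rOut_le k) K h_near))
  refine ⟨φ, ⟨contDiff, ⟨fun k => ?_, h.memLp, ?_⟩, fun j => ⟨fun k => ?_, h.memLp_deriv j, ?_⟩,
    (L2Tendsto.const MemLp.zero').congr' (fun k => ?_) .rfl⟩, compactSupport⟩
  · exact ((contDiff k).continuous.memLp_of_hasCompactSupport (compactSupport k)).restrict univ
  · simpa only [Measure.restrict_univ] using tendsto_eLpNorm_convolution_sub tendsto_rOut memLp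
  · exact ((contDiff_partialDeriv j (contDiff k)).continuous.memLp_of_hasCompactSupport
      ((compactSupport k).fderiv_apply ℝ _)).restrict univ
  · simpa only [Measure.restrict_univ, partialDeriv_φ] using
      tendsto_eLpNorm_convolution_sub tendsto_rOut (memLp_deriv j)
  · exact ae_restrict_of_forall_mem hW.isClosed_compl.measurableSet
      fun x hx => (eq_zero k x hx).symm

end CompactSupport

/-! ### Positivity of `∫ tr((∇w)²)` -/

section Positivity

variable {n : ℕ} {U : Set (Space n)} {f g τ : Space n → ℝ} {Df Dg : Fin (n + 1) → Space n → ℝ}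

lemma partialDeriv_comm (hf : ContDiff ℝ ∞ f) (i j : Fin (n + 1)) :
    partialDeriv i (partialDeriv j f) = partialDeriv j (partialDeriv i f) := by
  funext x
  have differentiableAt : DifferentiableAt ℝ (fderiv ℝ f) x :=
    (hf.fderiv_right (m := ∞) (by simp)).differentiable (by simp) x
  have eq_second_fderiv (i j : Fin (n + 1)) : partialDeriv i (partialDeriv j f) x
      = fderiv ℝ (fderiv ℝ f) x (EuclideanSpace.single i 1) (EuclideanSpace.single j 1) := by
    unfold partialDeriv
    rw [fderiv_clm_apply differentiableAt (differentiableAt_const _)]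
    simp
  rw [eq_second_fderiv, eq_second_fderiv]
  exact (hf.contDiffAt.isSymmSndFDerivAt
    (by simpa using (WithTop.coe_le_coe.2 le_top : ((2 : ℕ∞) : WithTop ℕ∞) ≤ ∞))).eq _ _

namespace MemH1

lemma integral_deriv_mul_partialDeriv_comm (h : MemH1 U f Df) (hτ : ContDiff ℝ ∞ τ)
    (hτc : HasCompactSupport τ) (hτU : tsupport τ ⊆ U) (i j : Fin (n + 1)) :
    ∫ x in U, Df j x * partialDeriv i τ x = ∫ x in U, Df i x * partialDeriv j τ x := by
  have weak_deriv (i j : Fin (n + 1)) := h.weak_deriv (partialDeriv i τ)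
    (contDiff_partialDeriv i hτ) (hτc.fderiv_apply ℝ _)
    ((tsupport_partialDeriv_subset τ i).trans hτU) j
  rw [← neg_inj, ← weak_deriv, ← weak_deriv, partialDeriv_comm hτ]

lemma integral_deriv_mul_deriv_comm (hf : MemH1 univ f Df) (hg : MemH1 univ g Dg)
    {K : Set (Space n)} (hK : IsCompact K) (g_zero : ∀ x ∉ K, g x = 0) (i j : Fin (n + 1)) :
    ∫ x, Df j x * Dg i x = ∫ x, Df i x * Dg j x := by
  obtain ⟨φ, hφ, hφc⟩ := hg.exists_isH1Approx hK isOpen_univ (subset_univ K) g_zero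
  have tendsto (i j : Fin (n + 1)) :=
    (L2Tendsto.const (hf.memLp_deriv j)).integral_mul (hφ.tendsto_deriv i)
  simpa only [Measure.restrict_univ] using tendsto_nhds_unique (tendsto i j)
    ((tendsto j i).congr fun k => hf.integral_deriv_mul_partialDeriv_comm (hφ.contDiff k) (hφc k)
      (subset_univ _) j i)

lemma sum_integral_deriv_mul_deriv_nonneg {w : Fin (n + 1) → Space n → ℝ}
    {Dw : Fin (n + 1) → Fin (n + 1) → Space n → ℝ} (h : ∀ i, MemH1 univ (w i) (Dw i))
    {K : Set (Space n)} (hK : IsCompact K) (w_zero : ∀ i, ∀ x ∉ K, w i x = 0) :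
    0 ≤ ∑ i, ∑ j, ∫ x, Dw i j x * Dw j i x := by
  have memLp (i j : Fin (n + 1)) : MemLp (Dw i j) 2 volume := by
    simpa using (h i).memLp_deriv j
  have integrable (i j : Fin (n + 1)) : Integrable (fun x => Dw i i x * Dw j j x) :=
    (memLp i i).integrable_mul (memLp j j)
  calc 0 ≤ ∫ x, (∑ i, Dw i i x) * ∑ j, Dw j j x :=
        integral_nonneg fun x => mul_self_nonneg _
    _ = ∑ i, ∑ j, ∫ x, Dw i i x * Dw j j x := by
        simp only [Finset.sum_mul_sum]
        rw [integral_finsetSum _ fun i _ => integrable_finsetSum _ fun j _ => integrable i j]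
        exact Finset.sum_congr rfl fun i _ => integral_finsetSum _ fun j _ => integrable i j
    _ = ∑ i, ∑ j, ∫ x, Dw i j x * Dw j i x :=
        Finset.sum_congr rfl fun i _ => Finset.sum_congr rfl fun j _ =>
          (h i).integral_deriv_mul_deriv_comm (h j) hK (w_zero j) j i

end MemH1

theorem HasLipschitzBoundary.sum_integral_deriv_mul_deriv_nonneg (h : HasLipschitzBoundary U)
    (ho : IsOpen U) (hb : Bornology.IsBounded U) {w : Fin (n + 1) → Space n → ℝ}
    {Dw : Fin (n + 1) → Fin (n + 1) → Space n → ℝ}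
    (hw : ∀ i, HasH1Trace U (frontier U) (w i) (Dw i) (fun _ => 0)) :
    0 ≤ ∑ i, ∑ j, ∫ x in U, Dw i j x * Dw j i x := by
  have nonneg := MemH1.sum_integral_deriv_mul_deriv_nonneg
    (fun i => (h.isGreenPair ho hb).memH1_indicator (hw i)) hb.isCompact_closure
    fun i x hx => indicator_of_notMem (fun hxU => hx (subset_closure hxU)) _
  refine nonneg.trans_eq (Finset.sum_congr rfl fun i _ => Finset.sum_congr rfl fun j _ => ?_)
  rw [← integral_indicator ho.measurableSet]
  refine integral_congr_ae (Eventually.of_forall fun x => ?_)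
  by_cases hx : x ∈ U <;> simp [hx, partialDeriv]

end Positivity

/-! ### The dissipation -/

lemma integral_sum_sum {X ι κ : Type*} [MeasurableSpace X] {μ : Measure X} [Fintype ι] [Fintype κ]
    {F : ι → κ → X → ℝ} (hF : ∀ i j, Integrable (F i j) μ) :
    ∫ x, ∑ i, ∑ j, F i j x ∂μ = ∑ i, ∑ j, ∫ x, F i j x ∂μ := by
  rw [integral_finsetSum _ fun i _ => integrable_finsetSum _ fun j _ => hF i j]
  simp only [integral_finsetSum _ fun j _ => hF _ j]

section Dissipation

/-- The product `2 e(A) : e(B)` of the symmetric parts `e(A)` and `e(B)` of two matrices. -/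
def strainProd {m : ℕ} (A B : Matrix (Fin m) (Fin m) ℝ) : ℝ :=
  ∑ i, ∑ j, (A i j + A j i) * B i j

variable {m : ℕ} (A B C : Matrix (Fin m) (Fin m) ℝ)

lemma strainProd_comm : strainProd A B = strainProd B A := by
  simp only [strainProd, add_mul, Finset.sum_add_distrib]
  rw [Finset.sum_comm (f := fun i j => A j i * B i j)]
  simp only [mul_comm]

lemma strainProd_sub_right : strainProd A (B - C) = strainProd A B - strainProd A C := by
  simp only [strainProd, Matrix.sub_apply, mul_sub, Finset.sum_sub_distrib]

lemma strainProd_zero_left : strainProd 0 B = 0 := by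
  simp [strainProd]

lemma strainProd_self : strainProd A A = ∑ i, ∑ j, A i j ^ 2 + ∑ i, ∑ j, A i j * A j i := by
  simp only [strainProd, ← Finset.sum_add_distrib]
  exact Finset.sum_congr rfl fun i _ => Finset.sum_congr rfl fun j _ => by ring

end Dissipation

lemma sum_stress_mul {n : ℕ} (Du : Space n → Matrix (Fin (n + 1)) (Fin (n + 1)) ℝ)
    (p : Space n → ℝ) (x : Space n) {B : Matrix (Fin (n + 1)) (Fin (n + 1)) ℝ}
    (hB : B.trace = 0) :
    ∑ i, ∑ j, stress Du p x i j * B i j = strainProd (Du x) B := by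
  have pressure_term : ∑ i, ∑ j, p x * (1 : Matrix (Fin (n + 1)) (Fin (n + 1)) ℝ) i j * B i j
      = p x * B.trace := by
    simp [Matrix.one_apply, Matrix.trace, Finset.mul_sum]
  simp only [stress, Matrix.sub_apply, Matrix.add_apply, Matrix.transpose_apply,
    Matrix.smul_apply, smul_eq_mul, sub_mul, Finset.sum_sub_distrib]
  rw [pressure_term, hB, mul_zero, sub_zero, strainProd]

/-- All entries of the matrix field `A` are in `L²(U)`. -/
def MatrixMemL2 {n : ℕ} (U : Set (Space n))
    (A : Space n → Matrix (Fin (n + 1)) (Fin (n + 1)) ℝ) : Prop :=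
  ∀ i j, MemLp (fun x => A x i j) 2 (volume.restrict U)

/-- The bilinear form `∫_U 2 e(A) : e(B)`; for `A = B = ∇u` this is the energy dissipated in `U` by
the flow `u`. -/
noncomputable def dissipation {n : ℕ} (U : Set (Space n))
    (A B : Space n → Matrix (Fin (n + 1)) (Fin (n + 1)) ℝ) : ℝ :=
  ∫ x in U, strainProd (A x) (B x)

section MatrixFields

variable {n : ℕ} {U V : Set (Space n)} {A B C : Space n → Matrix (Fin (n + 1)) (Fin (n + 1)) ℝ}

namespace MatrixMemL2

lemma integrable_sum_mul (hA : MatrixMemL2 U A) (hB : MatrixMemL2 U B) :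
    IntegrableOn (fun x => ∑ i, ∑ j, A x i j * B x i j) U :=
  integrable_finsetSum _ fun i _ => integrable_finsetSum _ fun j _ =>
    (hA i j).integrable_mul (hB i j)

lemma integrable_strainProd (hA : MatrixMemL2 U A) (hB : MatrixMemL2 U B) :
    IntegrableOn (fun x => strainProd (A x) (B x)) U :=
  integrable_sum_mul (A := fun x => Matrix.of fun i j => A x i j + A x j i)
    (fun i j => (hA i j).add (hA j i)) hB

lemma indicator (hA : MatrixMemL2 U A) (hU : MeasurableSet U) :
    MatrixMemL2 V (U.indicator A) := fun i j => by
  have entry_indicator :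
      (fun x => U.indicator A x i j) = U.indicator fun x => A x i j := by
    funext x
    by_cases hx : x ∈ U <;> simp [hx]
  rw [entry_indicator]
  exact ((memLp_indicator_iff_restrict hU).2 (hA i j)).restrict V

end MatrixMemL2

lemma dissipation_comm (U : Set (Space n))
    (A B : Space n → Matrix (Fin (n + 1)) (Fin (n + 1)) ℝ) :
    dissipation U A B = dissipation U B A := by
  simp only [dissipation, strainProd_comm (A _)]

lemma dissipation_sub_right (hA : MatrixMemL2 U A) (hB : MatrixMemL2 U B)
    (hC : MatrixMemL2 U C) :
    dissipation U A (fun x => B x - C x) = dissipation U A B - dissipation U A C := by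
  simp only [dissipation, strainProd_sub_right]
  exact integral_sub (hA.integrable_strainProd hB) (hA.integrable_strainProd hC)

lemma dissipation_indicator_left (hU : MeasurableSet U) (hUV : U ⊆ V)
    (A B : Space n → Matrix (Fin (n + 1)) (Fin (n + 1)) ℝ) :
    dissipation V (U.indicator A) B = dissipation U A B := by
  have strainProd_indicator : (fun x => strainProd (U.indicator A x) (B x))
      = U.indicator fun x => strainProd (A x) (B x) := by
    funext x
    by_cases hx : x ∈ U <;> simp [hx, strainProd_zero_left]
  rw [dissipation, strainProd_indicator, setIntegral_indicator hU, inter_eq_right.2 hUV,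
    dissipation]

lemma dissipation_indicator_self (hU : MeasurableSet U) (hUV : U ⊆ V)
    (A : Space n → Matrix (Fin (n + 1)) (Fin (n + 1)) ℝ) :
    dissipation V (U.indicator A) (U.indicator A) = dissipation U A A := by
  rw [dissipation_indicator_left hU hUV]
  refine setIntegral_congr_fun hU fun x hx => ?_
  simp only [indicator_of_mem hx]

lemma dissipation_self (hA : MatrixMemL2 U A) :
    dissipation U A A
      = (∫ x in U, ∑ i, ∑ j, A x i j ^ 2) + ∑ i, ∑ j, ∫ x in U, A x i j * A x j i := by
  have integrable_sq : IntegrableOn (fun x => ∑ i, ∑ j, A x i j ^ 2) U := by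
    simpa only [sq] using hA.integrable_sum_mul hA
  have integrable_entry (i j) : IntegrableOn (fun x => A x i j * A x j i) U :=
    (hA i j).integrable_mul (hA j i)
  simp only [dissipation, strainProd_self]
  rw [integral_add integrable_sq (integrable_finsetSum _ fun i _ =>
    integrable_finsetSum _ fun j _ => integrable_entry i j), integral_sum_sum integrable_entry]

end MatrixFields

/-! ### Vector fields with boundary values -/

/-- The vector field `v ∈ H¹(U)^d` with gradient `Dv` has the boundary values `a` on `Γ`. -/
def HasH1BoundaryValues {n : ℕ} (U Γ : Set (Space n)) (v : Space n → Space n)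
    (Dv : Space n → Matrix (Fin (n + 1)) (Fin (n + 1)) ℝ) (a : Space n → Space n) : Prop :=
  ∀ i, HasH1Trace U Γ (fun x => v x i) (fun j x => Dv x i j) (fun x => a x i)

section VectorFields

variable {n : ℕ} {U V Γ Γ' : Set (Space n)} {u v y a b : Space n → Space n}
  {Du Dv Dy : Space n → Matrix (Fin (n + 1)) (Fin (n + 1)) ℝ} {p : Space n → ℝ} {χ : Space n → ℝ}

lemma HasBoundaryValues.hasH1BoundaryValues (h : HasBoundaryValues U Γ v a) (hU : IsOpen U)
    (hv : ∀ i, MemH1 U (fun x => v x i) (fun j x => Dv x i j)) : HasH1BoundaryValues U Γ v Dv a :=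
  fun i => (h i).hasH1Trace hU (hv i)

namespace HasH1BoundaryValues

lemma matrixMemL2 (h : HasH1BoundaryValues U Γ v Dv a) : MatrixMemL2 U Dv :=
  fun i j => (h i).memH1.memLp_deriv j

lemma mono (h : HasH1BoundaryValues U Γ v Dv a) (hV : V ⊆ U) (hΓ : Γ' ⊆ Γ) :
    HasH1BoundaryValues V Γ' v Dv a :=
  fun i => (h i).mono hV hΓ

lemma empty (h : HasH1BoundaryValues U Γ v Dv a) : HasH1BoundaryValues U ∅ v Dv b :=
  fun i => ((h i).mono .rfl (empty_subset Γ)).congr .rfl (fun _ => .rfl)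
    (by simp [surfaceMeasure, EventuallyEq])

lemma sub (hu : HasH1BoundaryValues U Γ u Du a) (hv : HasH1BoundaryValues U Γ v Dv b) :
    HasH1BoundaryValues U Γ (fun x => u x - v x) (fun x => Du x - Dv x) (fun x => a x - b x) :=
  fun i => (hu i).sub (hv i)

lemma sub_self (h : HasH1BoundaryValues U Γ v Dv a) :
    HasH1BoundaryValues U Γ (fun x => v x - v x) (fun x => Dv x - Dv x) (fun _ => 0) := by
  simpa only [_root_.sub_self] using h.sub h

end HasH1BoundaryValues

lemma partialDeriv_one_sub (χ : Space n → ℝ) (j : Fin (n + 1)) (x : Space n) :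
    partialDeriv j (fun x => 1 - χ x) x = -partialDeriv j χ x := by
  rw [partialDeriv, fderiv_const_sub, neg_apply, partialDeriv]

/-- Here `χ v - y = χ (v - y) - (1 - χ) y`, where both terms vanish on the whole boundary. -/
lemma hasH1BoundaryValues_cutoff_sub (hU : Bornology.IsBounded U) (hΓ : IsClosed Γ)
    (hΓ' : IsClosed Γ') (hUΓ : frontier U = Γ ∪ Γ') (hχ : ContDiff ℝ ∞ χ)
    (χ_one : ∀ x ∈ Γ, χ x = 1) (χ_zero : ∀ x ∈ frontier U \ Γ, χ x = 0)
    (hvy : HasH1BoundaryValues U Γ (fun x => v x - y x) (fun x => Dv x - Dy x) (fun _ => 0))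
    (hy : HasH1BoundaryValues U Γ' y Dy (fun _ => 0)) :
    HasH1BoundaryValues U (frontier U) (fun x => χ x • v x - y x)
      (fun x => Matrix.of fun i j => χ x * Dv x i j + v x i * partialDeriv j χ x - Dy x i j)
      (fun _ => 0) := fun i => by
  have one_sub_zero (x) (hx : x ∈ frontier U \ Γ') : 1 - χ x = 0 := by
    rw [χ_one x ((hUΓ.subset hx.1).resolve_right hx.2), sub_self]
  refine (((hvy i).mul_cutoff hU hΓ (hUΓ ▸ subset_union_left) hχ χ_zero).sub
    ((hy i).mul_cutoff hU hΓ' (hUΓ ▸ subset_union_right) (contDiff_const.sub hχ)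
      one_sub_zero)).congr (.of_forall fun x => ?_) (fun j => .of_forall fun x => ?_)
    (.of_forall fun x => ?_)
  · simp only [PiLp.sub_apply, PiLp.smul_apply, smul_eq_mul]
    ring
  · simp only [PiLp.sub_apply, Matrix.sub_apply, Matrix.of_apply, partialDeriv_one_sub]
    ring
  · simp

end VectorFields

/-! ### Energy identities for the Stokes system -/

namespace IsStokesSolution

variable {n : ℕ} {U Γ Γ' : Set (Space n)} {u v y : Space n → Space n}
  {Du Dv Dy : Space n → Matrix (Fin (n + 1)) (Fin (n + 1)) ℝ} {p : Space n → ℝ} {c : ℝ}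

lemma matrixMemL2 (h : IsStokesSolution U u Du p) : MatrixMemL2 U Du :=
  fun i j => (h.memH1 i).memLp_deriv j

lemma matrixMemL2_stress (h : IsStokesSolution U u Du p) : MatrixMemL2 U (stress Du p) :=
  fun i j => ((h.matrixMemL2 i j).add (h.matrixMemL2 j i)).sub
    (h.memLp_pressure.mul_const ((1 : Matrix (Fin (n + 1)) (Fin (n + 1)) ℝ) i j))

lemma integral_stress_mul_eq_zero (h : IsStokesSolution U u Du p)
    (hv : HasH1BoundaryValues U (frontier U) v Dv (fun _ => 0)) :
    ∫ x in U, ∑ i, ∑ j, stress Du p x i j * Dv x i j = 0 :=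
  h.momentum v Dv (fun i => (hv i).memH1) fun i => (hv i).hasTrace

lemma integral_stress_mul (Du : Space n → Matrix (Fin (n + 1)) (Fin (n + 1)) ℝ) (p : Space n → ℝ)
    (hDv : ∀ᵐ x ∂volume.restrict U, (Dv x).trace = 0) :
    ∫ x in U, ∑ i, ∑ j, stress Du p x i j * Dv x i j = dissipation U Du Dv :=
  integral_congr_ae (hDv.mono fun x hx => sum_stress_mul Du p x hx)

lemma dissipation_eq_zero (h : IsStokesSolution U u Du p)
    (hv : HasH1BoundaryValues U (frontier U) v Dv (fun _ => 0))
    (hDv : ∀ᵐ x ∂volume.restrict U, (Dv x).trace = 0) : dissipation U Du Dv = 0 := by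
  rw [← integral_stress_mul Du p hDv, h.integral_stress_mul_eq_zero hv]

/-- The field `χ v` that defines the pairing differs from `y` by an element of `H¹₀(U)^d`. -/
theorem tractionPairing_eq_dissipation (h : IsStokesSolution U u Du p)
    (hU : Bornology.IsBounded U) (hΓ : IsClosed Γ) (hΓ' : IsClosed Γ')
    (hUΓ : frontier U = Γ ∪ Γ') (hc : IsTractionPairing U Γ (stress Du p) v Dv c)
    (hvy : HasH1BoundaryValues U Γ (fun x => v x - y x) (fun x => Dv x - Dy x) (fun _ => 0))
    (hy : HasH1BoundaryValues U Γ' y Dy (fun _ => 0))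
    (hDy : ∀ᵐ x ∂volume.restrict U, (Dy x).trace = 0) : c = dissipation U Du Dy := by
  obtain ⟨χ, hχ, χ_one, χ_zero, rfl⟩ := hc
  have zero_values := hasH1BoundaryValues_cutoff_sub hU hΓ hΓ' hUΓ hχ
    χ_one.self_of_nhdsSet χ_zero.self_of_nhdsSet hvy hy
  have integrable_zero := h.matrixMemL2_stress.integrable_sum_mul zero_values.matrixMemL2
  have integrable_y := h.matrixMemL2_stress.integrable_sum_mul hy.matrixMemL2
  calc ∫ x in U, ∑ i, ∑ j, stress Du p x i j * (χ x * Dv x i j + v x i * partialDeriv j χ x)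
      = ∫ x in U, (∑ i, ∑ j, stress Du p x i j *
          (χ x * Dv x i j + v x i * partialDeriv j χ x - Dy x i j))
          + ∑ i, ∑ j, stress Du p x i j * Dy x i j := by
        simp only [← Finset.sum_add_distrib, ← mul_add, sub_add_cancel]
    _ = ∫ x in U, ∑ i, ∑ j, stress Du p x i j * Dy x i j :=
        (integral_add integrable_zero integrable_y).trans
          (add_eq_right.2 (h.integral_stress_mul_eq_zero zero_values))
    _ = dissipation U Du Dy := integral_stress_mul Du p hDy

end IsStokesSolution

namespace IsLipschitzHole

variable {n : ℕ} {Ω D : Set (Space n)} {f a : Space n → ℝ} {Df : Fin (n + 1) → Space n → ℝ}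
  {v b : Space n → Space n} {Dv : Space n → Matrix (Fin (n + 1)) (Fin (n + 1)) ℝ}

theorem hasH1Trace_indicator (h : IsLipschitzHole Ω D)
    (hf : HasH1Trace (Ω \ closure D) (frontier Ω) f Df a)
    (hf₀ : HasH1Trace (Ω \ closure D) (frontier D) f Df (fun _ => 0)) :
    HasH1Trace Ω (frontier Ω) ((Ω \ closure D).indicator f)
      (fun j => (Ω \ closure D).indicator (Df j)) a := by
  obtain ⟨χ, hχ, hχc, tsupport_subset, χ_one, χ_zero⟩ := h.exists_cutoff
  have one_sub_zero : ∀ᶠ x in 𝓝ˢ (Ω \ (Ω \ closure D)), 1 - χ x = 0 := by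
    filter_upwards [χ_one.filter_mono (nhdsSet_mono (sdiff_sdiff_right_self.trans_subset
      inter_subset_right))] with x hx using sub_eq_zero.2 hx.symm
  have outer := hf.indicator_mul h.isOpen_sdiff.measurableSet h.isBounded_sdiff
    (h.isBounded.closure.subset frontier_subset_closure) h.isOpen.measurableSet sdiff_subset
    (contDiff_const.sub hχ) one_sub_zero
  have memH1 := (h.isGreenPair_inner hχ
    (χ_one.filter_mono (nhdsSet_mono frontier_subset_closure)) χ_zero).memH1_indicator hf₀
  obtain ⟨φ, hφ, -⟩ := memH1.exists_isH1Approx hχc h.isOpen tsupport_subset fun x hx =>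
    indicator_apply_eq_zero.2 fun _ => by rw [image_eq_zero_of_notMem_tsupport hx, zero_mul]
  have inner := HasH1Trace.mono ⟨φ, hφ⟩ (subset_univ Ω)
    (disjoint_right.1 (disjoint_frontier_of_isOpen h.isOpen) : frontier Ω ⊆ Ωᶜ)
  refine (outer.add inner).congr (.of_forall fun x => ?_) (fun j => .of_forall fun x => ?_)
    ((ae_restrict_mem isClosed_frontier.measurableSet).mono fun x hx => ?_)
  · by_cases hx : x ∈ Ω \ closure D
    · simp only [indicator_of_mem hx]
      ring
    · simp only [indicator_of_notMem hx, add_zero]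
  · by_cases hx : x ∈ Ω \ closure D
    · simp only [indicator_of_mem hx, partialDeriv_one_sub]
      ring
    · simp only [indicator_of_notMem hx, add_zero]
  · simp only [χ_zero.self_of_nhdsSet x hx, sub_zero, one_mul, add_zero]

lemma hasH1BoundaryValues_indicator (h : IsLipschitzHole Ω D)
    (hv : HasH1BoundaryValues (Ω \ closure D) (frontier Ω) v Dv b)
    (hv₀ : HasH1BoundaryValues (Ω \ closure D) (frontier D) v Dv (fun _ => 0)) :
    HasH1BoundaryValues Ω (frontier Ω) ((Ω \ closure D).indicator v)
      ((Ω \ closure D).indicator Dv) b := fun i => by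
  refine (h.hasH1Trace_indicator (hv i) (hv₀ i)).congr (.of_forall fun x => ?_)
    (fun j => .of_forall fun x => ?_) .rfl <;>
  by_cases hx : x ∈ Ω \ closure D <;> simp [hx]

end IsLipschitzHole

/-- The data of the obstacle problem: the Stokes flow `u₀` in `Ω` and the Stokes flow `u` around the
obstacle `D`, with the common boundary velocity `g` on `∂Ω`. -/
structure IsHolePair {n : ℕ} (Ω D : Set (Space n)) (g u₀ u : Space n → Space n)
    (Du₀ Du : Space n → Matrix (Fin (n + 1)) (Fin (n + 1)) ℝ) (p₀ p : Space n → ℝ) : Prop where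
  hole : IsLipschitzHole Ω D
  stokes₀ : IsStokesSolution Ω u₀ Du₀ p₀
  values₀ : HasBoundaryValues Ω (frontier Ω) u₀ g
  stokes : IsStokesSolution (Ω \ closure D) u Du p
  values : HasBoundaryValues (Ω \ closure D) (frontier Ω) u g
  values_hole : HasBoundaryValues (Ω \ closure D) (frontier D) u (fun _ => 0)

/-- The gradient of `ũ - u₀`, where `ũ` extends `u` by zero to `Ω`. -/
noncomputable def gradDiff {n : ℕ} (Ω D : Set (Space n))
    (Du₀ Du : Space n → Matrix (Fin (n + 1)) (Fin (n + 1)) ℝ) (x : Space n) :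
    Matrix (Fin (n + 1)) (Fin (n + 1)) ℝ :=
  (Ω \ closure D).indicator Du x - Du₀ x

namespace IsHolePair

variable {n : ℕ} {Ω D : Set (Space n)} {g u₀ u : Space n → Space n}
  {Du₀ Du : Space n → Matrix (Fin (n + 1)) (Fin (n + 1)) ℝ} {p₀ p : Space n → ℝ} {W₀ W B : ℝ}

lemma hasH1BoundaryValues₀ (h : IsHolePair Ω D g u₀ u Du₀ Du p₀ p) :
    HasH1BoundaryValues Ω (frontier Ω) u₀ Du₀ g :=
  h.values₀.hasH1BoundaryValues h.hole.isOpen h.stokes₀.memH1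

lemma hasH1BoundaryValues (h : IsHolePair Ω D g u₀ u Du₀ Du p₀ p) :
    HasH1BoundaryValues (Ω \ closure D) (frontier Ω) u Du g :=
  h.values.hasH1BoundaryValues h.hole.isOpen_sdiff h.stokes.memH1

lemma hasH1BoundaryValues_hole (h : IsHolePair Ω D g u₀ u Du₀ Du p₀ p) :
    HasH1BoundaryValues (Ω \ closure D) (frontier D) u Du (fun _ => 0) :=
  h.values_hole.hasH1BoundaryValues h.hole.isOpen_sdiff h.stokes.memH1

lemma hasH1BoundaryValues_gradDiff (h : IsHolePair Ω D g u₀ u Du₀ Du p₀ p) :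
    HasH1BoundaryValues Ω (frontier Ω) (fun x => (Ω \ closure D).indicator u x - u₀ x)
      (gradDiff Ω D Du₀ Du) (fun _ => 0) := by
  simpa only [sub_self] using! (h.hole.hasH1BoundaryValues_indicator h.hasH1BoundaryValues
    h.hasH1BoundaryValues_hole).sub h.hasH1BoundaryValues₀

lemma trace_gradDiff (h : IsHolePair Ω D g u₀ u Du₀ Du p₀ p) :
    ∀ᵐ x ∂volume.restrict Ω, (gradDiff Ω D Du₀ Du x).trace = 0 := by
  have div_free := (ae_restrict_iff' h.hole.isOpen_sdiff.measurableSet).1 h.stokes.div_free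
  filter_upwards [h.stokes₀.div_free, ae_restrict_of_ae div_free] with x hx₀ hx
  rw [gradDiff, Matrix.trace_sub, hx₀, sub_zero]
  by_cases hxU : x ∈ Ω \ closure D
  · rw [indicator_of_mem hxU, hx hxU]
  · rw [indicator_of_notMem hxU, Matrix.trace_zero]

lemma dissipation_gradDiff (h : IsHolePair Ω D g u₀ u Du₀ Du p₀ p) :
    dissipation Ω Du₀ (gradDiff Ω D Du₀ Du) = 0 :=
  h.stokes₀.dissipation_eq_zero h.hasH1BoundaryValues_gradDiff h.trace_gradDiff

lemma tractionPairing_unperturbed (h : IsHolePair Ω D g u₀ u Du₀ Du p₀ p)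
    (hW₀ : IsTractionPairing Ω (frontier Ω) (stress Du₀ p₀) u₀ Du₀ W₀) :
    W₀ = dissipation Ω Du₀ Du₀ :=
  h.stokes₀.tractionPairing_eq_dissipation h.hole.isBounded isClosed_frontier isClosed_empty
    (union_empty _).symm hW₀
    h.hasH1BoundaryValues₀.sub_self h.hasH1BoundaryValues₀.empty h.stokes₀.div_free

lemma tractionPairing_perturbed (h : IsHolePair Ω D g u₀ u Du₀ Du p₀ p)
    (hW : IsTractionPairing (Ω \ closure D) (frontier Ω) (stress Du p) u Du W) :
    W = dissipation (Ω \ closure D) Du Du :=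
  h.stokes.tractionPairing_eq_dissipation h.hole.isBounded_sdiff isClosed_frontier
    isClosed_frontier h.hole.frontier_sdiff hW
    h.hasH1BoundaryValues.sub_self h.hasH1BoundaryValues_hole h.stokes.div_free

lemma tractionPairing_hole (h : IsHolePair Ω D g u₀ u Du₀ Du p₀ p)
    (hB : IsTractionPairing (Ω \ closure D) (frontier D) (stress Du p) u₀ Du₀ (-B)) :
    B = dissipation (Ω \ closure D) Du Du - dissipation (Ω \ closure D) Du Du₀ := by
  have values : HasH1BoundaryValues (Ω \ closure D) (frontier Ω) (fun x => u₀ x - u x)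
      (fun x => Du₀ x - Du x) (fun _ => 0) := by
    simpa only [sub_self] using
      (h.hasH1BoundaryValues₀.mono sdiff_subset .rfl).sub h.hasH1BoundaryValues
  have div_free : ∀ᵐ x ∂volume.restrict (Ω \ closure D), (Du₀ x - Du x).trace = 0 := by
    filter_upwards [h.stokes.div_free, ae_mono (Measure.restrict_mono_set _ sdiff_subset)
      h.stokes₀.div_free] with x hx hx₀
    rw [Matrix.trace_sub, hx, hx₀, sub_zero]
  have pairing := h.stokes.tractionPairing_eq_dissipation h.hole.isBounded_sdiff isClosed_frontier
    isClosed_frontier (h.hole.frontier_sdiff.trans (union_comm _ _)) hB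
    (by simpa only [sub_sub_cancel] using h.hasH1BoundaryValues_hole) values div_free
  rw [dissipation_sub_right h.stokes.matrixMemL2
    (fun i j => (h.stokes₀.matrixMemL2 i j).mono_measure
      (Measure.restrict_mono_set _ sdiff_subset)) h.stokes.matrixMemL2] at pairing
  linarith

lemma dissipation_gradDiff_self (h : IsHolePair Ω D g u₀ u Du₀ Du p₀ p) :
    dissipation Ω (gradDiff Ω D Du₀ Du) (gradDiff Ω D Du₀ Du)
      = dissipation (Ω \ closure D) Du Du - dissipation (Ω \ closure D) Du Du₀ := by
  have measurable := h.hole.isOpen_sdiff.measurableSet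
  have memL2 : MatrixMemL2 Ω ((Ω \ closure D).indicator Du) :=
    h.stokes.matrixMemL2.indicator measurable
  have memL2₀ := h.stokes₀.matrixMemL2
  calc dissipation Ω (gradDiff Ω D Du₀ Du) (gradDiff Ω D Du₀ Du)
      = dissipation Ω (gradDiff Ω D Du₀ Du) ((Ω \ closure D).indicator Du)
          - dissipation Ω (gradDiff Ω D Du₀ Du) Du₀ :=
        dissipation_sub_right h.hasH1BoundaryValues_gradDiff.matrixMemL2 memL2 memL2₀
    _ = dissipation Ω ((Ω \ closure D).indicator Du) (gradDiff Ω D Du₀ Du) := by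
        rw [dissipation_comm Ω _ Du₀, h.dissipation_gradDiff, sub_zero, dissipation_comm]
    _ = dissipation (Ω \ closure D) Du Du - dissipation (Ω \ closure D) Du Du₀ := by
        rw [← dissipation_indicator_self measurable sdiff_subset,
          ← dissipation_indicator_left measurable sdiff_subset Du Du₀]
        exact dissipation_sub_right memL2 memL2 memL2₀

lemma dissipation_sub_dissipation (h : IsHolePair Ω D g u₀ u Du₀ Du p₀ p) :
    dissipation (Ω \ closure D) Du Du - dissipation Ω Du₀ Du₀
      = dissipation Ω (gradDiff Ω D Du₀ Du) (gradDiff Ω D Du₀ Du) := by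
  have dissipation_mixed :
      dissipation (Ω \ closure D) Du Du₀ - dissipation Ω Du₀ Du₀ = 0 := by
    have measurable := h.hole.isOpen_sdiff.measurableSet
    rw [← dissipation_indicator_left measurable sdiff_subset Du Du₀,
      dissipation_comm Ω _ Du₀, ← h.dissipation_gradDiff]
    exact (dissipation_sub_right h.stokes₀.matrixMemL2 (h.stokes.matrixMemL2.indicator measurable)
      h.stokes₀.matrixMemL2).symm
  rw [h.dissipation_gradDiff_self]
  linarith

/-- By the positivity of `∑ ∫ ∂_j w_i ∂_i w_j` for `w ∈ H¹₀(Ω)^d`, no Korn constant is lost. -/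
lemma integral_sq_le_dissipation (h : IsHolePair Ω D g u₀ u Du₀ Du p₀ p) :
    ∫ x in D, ∑ i, ∑ j, Du₀ x i j ^ 2
      ≤ dissipation Ω (gradDiff Ω D Du₀ Du) (gradDiff Ω D Du₀ Du) := by
  have values := h.hasH1BoundaryValues_gradDiff
  have integrable : IntegrableOn (fun x => ∑ i, ∑ j, gradDiff Ω D Du₀ Du x i j ^ 2) Ω := by
    simpa only [sq] using values.matrixMemL2.integrable_sum_mul values.matrixMemL2
  calc ∫ x in D, ∑ i, ∑ j, Du₀ x i j ^ 2
      = ∫ x in D, ∑ i, ∑ j, gradDiff Ω D Du₀ Du x i j ^ 2 :=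
        setIntegral_congr_fun h.hole.isOpen_hole.measurableSet fun x hx => by
          simp [gradDiff, indicator_of_notMem fun hxU : x ∈ Ω \ closure D =>
            hxU.2 (subset_closure hx)]
    _ ≤ ∫ x in Ω, ∑ i, ∑ j, gradDiff Ω D Du₀ Du x i j ^ 2 :=
        setIntegral_mono_set integrable (.of_forall fun x => by positivity)
          (subset_closure.trans h.hole.closure_subset).eventuallyLE
    _ ≤ dissipation Ω (gradDiff Ω D Du₀ Du) (gradDiff Ω D Du₀ Du) := by
        rw [dissipation_self values.matrixMemL2]
        exact le_add_of_nonneg_right <|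
          h.hole.hasLipschitzBoundary.sum_integral_deriv_mul_deriv_nonneg h.hole.isOpen
            h.hole.isBounded values

theorem energy_estimate (h : IsHolePair Ω D g u₀ u Du₀ Du p₀ p)
    (hW₀ : IsTractionPairing Ω (frontier Ω) (stress Du₀ p₀) u₀ Du₀ W₀)
    (hW : IsTractionPairing (Ω \ closure D) (frontier Ω) (stress Du p) u Du W)
    (hB : IsTractionPairing (Ω \ closure D) (frontier D) (stress Du p) u₀ Du₀ (-B)) :
    ∫ x in D, ∑ i, ∑ j, Du₀ x i j ^ 2 ≤ W - W₀ ∧ W - W₀ = B := by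
  rw [h.tractionPairing_unperturbed hW₀, h.tractionPairing_perturbed hW,
    h.tractionPairing_hole hB, h.dissipation_sub_dissipation]
  exact ⟨h.integral_sq_le_dissipation, h.dissipation_gradDiff_self⟩

end IsHolePair

/-! ### Surface integrals of the traction -/

lemma hasH1Trace_of_test {n : ℕ} {U : Set (Space n)} {τ : Space n → ℝ} (hU : IsOpen U)
    (hτ : ContDiff ℝ ∞ τ) (hτc : HasCompactSupport τ) (hτU : tsupport τ ⊆ U) :
    HasH1Trace U (frontier U) τ (fun j => partialDeriv j τ) (fun _ => 0) := by
  have τ_zero : (fun _ => 0) =ᵐ[surfaceMeasure (frontier U)] τ :=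
    (ae_restrict_mem isClosed_frontier.measurableSet).mono fun x hx =>
      (image_eq_zero_of_notMem_tsupport fun hxτ =>
        disjoint_left.1 (disjoint_frontier_of_isOpen hU) (hτU hxτ) hx).symm
  have memLp_deriv (j : Fin (n + 1)) : MemLp (partialDeriv j τ) 2 volume :=
    memLp_of_test (contDiff_partialDeriv j hτ) (hτc.fderiv_apply ℝ _)
  exact ⟨fun _ => τ, fun _ => hτ, .const ((memLp_of_test hτ hτc).restrict U),
    fun j => .const ((memLp_deriv j).restrict U),
    (L2Tendsto.const MemLp.zero').congr' (fun _ => τ_zero) .rfl⟩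

lemma IsStokesSolution.integral_sum_stress_mul_partialDeriv {n : ℕ} {U : Set (Space n)}
    {u : Space n → Space n} {Du : Space n → Matrix (Fin (n + 1)) (Fin (n + 1)) ℝ}
    {p τ : Space n → ℝ} (h : IsStokesSolution U u Du p) (hU : IsOpen U) (hτ : ContDiff ℝ ∞ τ)
    (hτc : HasCompactSupport τ) (hτU : tsupport τ ⊆ U) (i : Fin (n + 1)) :
    ∫ x in U, ∑ j, stress Du p x i j * partialDeriv j τ x = 0 := by
  let e : Space n := EuclideanSpace.single i 1
  have zero_values : HasH1BoundaryValues U (frontier U) (fun x => τ x • e)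
      (fun x => Matrix.of fun k j => partialDeriv j (fun y => τ y * e k) x) (fun _ => 0) :=
    fun k => hasH1Trace_of_test hU (hτ.mul contDiff_const) hτc.mul_right
      (tsupport_mul_subset_left.trans hτU)
  refine (integral_congr_ae (.of_forall fun x => ?_)).trans
    (h.integral_stress_mul_eq_zero zero_values)
  have partialDeriv_component (k j : Fin (n + 1)) :
      partialDeriv j (fun y => τ y * e k) x = e k * partialDeriv j τ x := by
    rw [partialDeriv, fderiv_mul_const (hτ.differentiable (by simp) x), smul_apply, smul_eq_mul,
      partialDeriv]
  simp only [Matrix.of_apply, partialDeriv_component]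
  rw [Finset.sum_eq_single (f := fun k => ∑ j, stress Du p x k j * _) i
    (fun k _ hk => by simp [e, hk]) (by simp)]
  simp [e]

lemma IsStokesSolution.sum_deriv_stress_ae_eq_zero {n : ℕ} {U : Set (Space n)}
    {u : Space n → Space n} {Du : Space n → Matrix (Fin (n + 1)) (Fin (n + 1)) ℝ} {p : Space n → ℝ}
    (h : IsStokesSolution U u Du p) (hU : IsOpen U) {i : Fin (n + 1)}
    {Dσ : Fin (n + 1) → Fin (n + 1) → Space n → ℝ}
    (hσ : ∀ j, MemH1 U (fun x => stress Du p x i j) (Dσ j)) :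
    (fun x => ∑ j, Dσ j j x) =ᵐ[volume.restrict U] 0 := by
  refine ae_eq_zero_of_forall_test hU (memLp_finsetSum _ fun j _ => (hσ j).memLp_deriv j)
    fun τ hτ hτc hτU => ?_
  have integrable (j : Fin (n + 1)) : IntegrableOn (fun x => Dσ j j x * τ x) U :=
    ((hσ j).memLp_deriv j).integrable_mul ((memLp_of_test hτ hτc).restrict U)
  have integrable_deriv (j : Fin (n + 1)) :
      IntegrableOn (fun x => stress Du p x i j * partialDeriv j τ x) U :=
    (hσ j).memLp.integrable_mul
      ((memLp_of_test (contDiff_partialDeriv j hτ) (hτc.fderiv_apply ℝ _)).restrict U)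
  calc ∫ x in U, (∑ j, Dσ j j x) * τ x = ∑ j, ∫ x in U, Dσ j j x * τ x := by
        simp only [Finset.sum_mul, integral_finsetSum _ fun j _ => integrable j]
    _ = -∑ j, ∫ x in U, stress Du p x i j * partialDeriv j τ x := by
        simp only [(hσ _).weak_deriv τ hτ hτc hτU _, Finset.sum_neg_distrib, neg_neg]
    _ = 0 := by
        rw [← integral_finsetSum _ fun j _ => integrable_deriv j,
          h.integral_sum_stress_mul_partialDeriv hU hτ hτc hτU i, neg_zero]

lemma IsGreenPair.integral_sum_sum_mul {n : ℕ} {U Γ : Set (Space n)} {ν : Space n → Space n}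
    {χ : Space n → ℝ} {σ a : Fin (n + 1) → Fin (n + 1) → Space n → ℝ}
    {Dσ : Fin (n + 1) → Fin (n + 1) → Fin (n + 1) → Space n → ℝ} {v b : Fin (n + 1) → Space n → ℝ}
    {Dv : Fin (n + 1) → Fin (n + 1) → Space n → ℝ} (h : IsGreenPair U Γ ν χ)
    (hσ : ∀ i j, HasH1Trace U Γ (σ i j) (Dσ i j) (a i j))
    (hv : ∀ i, HasH1Trace U Γ (v i) (Dv i) (b i))
    (div_free : ∀ i, (fun x => ∑ j, Dσ i j j x) =ᵐ[volume.restrict U] 0) :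
    ∫ x in U, ∑ i, ∑ j, σ i j x * (χ x * Dv i j x + partialDeriv j χ x * v i x)
      = ∫ x, ∑ i, (∑ j, a i j x * ν x j) * b i x ∂surfaceMeasure Γ := by
  have memH1 (i) := ((hv i).mul_smooth h.isBounded h.isBounded_boundary h.contDiff).memH1
  choose φ hφ using hσ
  choose ψ hψ using hv
  have integrable (i j) :
      IntegrableOn (fun x => σ i j x * (χ x * Dv i j x + partialDeriv j χ x * v i x)) U :=
    (hφ i j).tendsto.memLp_limit.integrable_mul ((memH1 i).memLp_deriv j)
  have integrable_deriv (i j) : IntegrableOn (fun x => Dσ i j j x * (χ x * v i x)) U :=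
    ((hφ i j).tendsto_deriv j).memLp_limit.integrable_mul (memH1 i).memLp
  have integrable_trace (i j) :
      Integrable (fun x => a i j x * (ν x j * b i x)) (surfaceMeasure Γ) :=
    (hφ i j).tendsto_trace.memLp_limit.integrable_mul
      (h.l2Tendsto_normal_mul (hψ i).tendsto_trace j).memLp_limit
  have divergence_term : ∑ i, ∑ j, ∫ x in U, Dσ i j j x * (χ x * v i x) = 0 := by
    rw [← integral_sum_sum integrable_deriv]
    refine integral_eq_zero_of_ae ((ae_all_iff.2 div_free).mono fun x hx => ?_)
    replace hx (i) : ∑ j, Dσ i j j x = 0 := hx i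
    simp only [← Finset.sum_mul, hx, zero_mul, Finset.sum_const_zero, Pi.zero_apply]
  calc ∫ x in U, ∑ i, ∑ j, σ i j x * (χ x * Dv i j x + partialDeriv j χ x * v i x)
      = (∑ i, ∑ j, ∫ x in U, σ i j x * (χ x * Dv i j x + partialDeriv j χ x * v i x))
          + ∑ i, ∑ j, ∫ x in U, Dσ i j j x * (χ x * v i x) := by
        rw [integral_sum_sum integrable, divergence_term, add_zero]
    _ = ∑ i, ∑ j, ∫ x, a i j x * (ν x j * b i x) ∂surfaceMeasure Γ := by
        simp only [← Finset.sum_add_distrib, h.integral_add_integral ⟨_, hφ _ _⟩ ⟨_, hψ _⟩]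
    _ = ∫ x, ∑ i, (∑ j, a i j x * ν x j) * b i x ∂surfaceMeasure Γ := by
        simp only [← integral_sum_sum integrable_trace, Finset.sum_mul, mul_assoc]

theorem IsStokesSolution.isTractionPairing_integral {n : ℕ} {U Γ : Set (Space n)}
    {u v b ν : Space n → Space n} {Du Dv T : Space n → Matrix (Fin (n + 1)) (Fin (n + 1)) ℝ}
    {p χ : Space n → ℝ} (h : IsStokesSolution U u Du p) (hχ : IsGreenPair U Γ ν χ)
    (χ_one : ∀ᶠ x in 𝓝ˢ Γ, χ x = 1) (χ_zero : ∀ᶠ x in 𝓝ˢ (frontier U \ Γ), χ x = 0)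
    (hT : HasMatrixTrace U Γ (stress Du p) T) (hv : HasH1BoundaryValues U Γ v Dv b) :
    IsTractionPairing U Γ (stress Du p) v Dv
      (∫ x, ∑ i, (∑ j, T x i j * ν x j) * b x i ∂surfaceMeasure Γ) := by
  refine ⟨χ, hχ.contDiff, χ_one, χ_zero, ?_⟩
  choose Dσ hσ using fun i j => (hT i j).imp fun _ => And.left
  rw [← hχ.integral_sum_sum_mul (fun i j => (hT i j).hasH1Trace hχ.isOpen (hσ i j)) hv
    fun i => h.sum_deriv_stress_ae_eq_zero hχ.isOpen (hσ i)]
  simp only [mul_comm (v _ _)]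

theorem IsHolePair.energy_estimate_trace {n : ℕ} {Ω D : Set (Space n)}
    {g u₀ u b : Space n → Space n}
    {Du₀ Du T₀ T S : Space n → Matrix (Fin (n + 1)) (Fin (n + 1)) ℝ} {p₀ p : Space n → ℝ}
    (h : IsHolePair Ω D g u₀ u Du₀ Du p₀ p)
    (hT₀ : HasMatrixTrace Ω (frontier Ω) (stress Du₀ p₀) T₀)
    (hT : HasMatrixTrace (Ω \ closure D) (frontier Ω) (stress Du p) T)
    (hS : HasMatrixTrace (Ω \ closure D) (frontier D) (stress Du p) S)
    (hb : HasBoundaryValues (Ω \ closure D) (frontier D) u₀ b) :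
    ∫ x in D, ∑ i, ∑ j, Du₀ x i j ^ 2 ≤ tractionIntegral Ω T g - tractionIntegral Ω T₀ g ∧
      tractionIntegral Ω T g - tractionIntegral Ω T₀ g = tractionIntegral D S b := by
  obtain ⟨χ, hχ, -, -, χ_one, χ_zero⟩ := h.hole.exists_cutoff
  replace χ_one := χ_one.filter_mono (nhdsSet_mono frontier_subset_closure)
  have one_sub_one : ∀ᶠ x in 𝓝ˢ (frontier Ω), 1 - χ x = 1 := χ_zero.mono fun x hx => by
    rw [hx, sub_zero]
  have one_sub_zero : ∀ᶠ x in 𝓝ˢ (frontier D), 1 - χ x = 0 := χ_one.mono fun x hx => by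
    rw [hx, sub_self]
  have pairing₀ := h.stokes₀.isTractionPairing_integral
    (h.hole.hasLipschitzBoundary.isGreenPair h.hole.isOpen h.hole.isBounded)
    (.of_forall fun _ => rfl) (by simp) hT₀ h.hasH1BoundaryValues₀
  have pairing := h.stokes.isTractionPairing_integral
    (h.hole.isGreenPair_outer (contDiff_const.sub hχ) one_sub_one one_sub_zero) one_sub_one
    (by rwa [h.hole.frontier_sdiff_sdiff_outer]) hT h.hasH1BoundaryValues
  have pairing_hole := h.stokes.isTractionPairing_integral
    (h.hole.isGreenPair_inner hχ χ_one χ_zero) χ_one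
    (by rwa [h.hole.frontier_sdiff_sdiff_inner]) hS
    (hb.hasH1BoundaryValues h.hole.isOpen_sdiff
      fun i => ((h.hasH1BoundaryValues₀ i).mono sdiff_subset .rfl).memH1)
  refine h.energy_estimate pairing₀ pairing ?_
  rw [tractionIntegral, ← integral_neg]
  simpa only [PiLp.neg_apply, mul_neg, Finset.sum_neg_distrib, neg_mul] using pairing_hole

theorem lemma3p4_general {n : ℕ} {Ω D : Set (Space n)} (hD : IsLipschitzHole Ω D)
    {g u₀ u : Space n → Space n} {Du₀ Du : Space n → Matrix (Fin (n + 1)) (Fin (n + 1)) ℝ}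
    {p₀ p : Space n → ℝ} (h₀ : IsStokesSolution Ω u₀ Du₀ p₀)
    (hg₀ : HasBoundaryValues Ω (frontier Ω) u₀ g) (h : IsStokesSolution (Ω \ closure D) u Du p)
    (hg : HasBoundaryValues (Ω \ closure D) (frontier Ω) u g)
    (hu : HasBoundaryValues (Ω \ closure D) (frontier D) u (fun _ => 0)) :
    (∀ W₀ W B : ℝ,
      IsTractionPairing Ω (frontier Ω) (stress Du₀ p₀) u₀ Du₀ W₀ →
      IsTractionPairing (Ω \ closure D) (frontier Ω) (stress Du p) u Du W →
      IsTractionPairing (Ω \ closure D) (frontier D) (stress Du p) u₀ Du₀ (-B) →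
      ∫ x in D, ∑ i, ∑ j, Du₀ x i j ^ 2 ≤ W - W₀ ∧ W - W₀ = B) ∧
    (∀ (T₀ T S : Space n → Matrix (Fin (n + 1)) (Fin (n + 1)) ℝ) (b : Space n → Space n),
      HasMatrixTrace Ω (frontier Ω) (stress Du₀ p₀) T₀ →
      HasMatrixTrace (Ω \ closure D) (frontier Ω) (stress Du p) T →
      HasMatrixTrace (Ω \ closure D) (frontier D) (stress Du p) S →
      HasBoundaryValues (Ω \ closure D) (frontier D) u₀ b →
      ∫ x in D, ∑ i, ∑ j, Du₀ x i j ^ 2 ≤ tractionIntegral Ω T g - tractionIntegral Ω T₀ g ∧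
        tractionIntegral Ω T g - tractionIntegral Ω T₀ g = tractionIntegral D S b) :=
  have pair : IsHolePair Ω D g u₀ u Du₀ Du p₀ p := ⟨hD, h₀, hg₀, h, hg, hu⟩
  ⟨fun _ _ _ => pair.energy_estimate, fun _ _ _ _ => pair.energy_estimate_trace⟩

/-- Here `d = n + 1`, `U = Ω \ closure D`. The first part is the claim for arbitrary weak solutions
in `H^1 × L²`, with the boundary integrals read as duality pairings (the exterior normal to `U` on
`∂D` is the opposite of the exterior normal to `D`, hence the sign of `B`). The second part is the
claim with genuine surface integrals, when the stresses are in `H^1`. -/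
theorem lemma3p4 (n : ℕ) (hd : n + 1 = 2 ∨ n + 1 = 3) (Ω : Set (Space n)) (ρ₀ M₀ : ℝ)
    (hΩ : IsDomainOfClass 0 1 ρ₀ M₀ Ω) (hΩ' : IsConnected (frontier Ω)) :
    ∃ C : ℝ, 0 < C ∧ ∀ D : Set (Space n), IsCavity Ω D →
      ∀ (g u₀ u : Space n → Space n)
        (Du₀ Du : Space n → Matrix (Fin (n + 1)) (Fin (n + 1)) ℝ) (p₀ p : Space n → ℝ),
        IsStokesSolution Ω u₀ Du₀ p₀ →
        HasBoundaryValues Ω (frontier Ω) u₀ g →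
        IsStokesSolution (Ω \ closure D) u Du p →
        HasBoundaryValues (Ω \ closure D) (frontier Ω) u g →
        HasBoundaryValues (Ω \ closure D) (frontier D) u (fun _ => 0) →
        (∀ W₀ W B : ℝ,
          IsTractionPairing Ω (frontier Ω) (stress Du₀ p₀) u₀ Du₀ W₀ →
          IsTractionPairing (Ω \ closure D) (frontier Ω) (stress Du p) u Du W →
          IsTractionPairing (Ω \ closure D) (frontier D) (stress Du p) u₀ Du₀ (-B) →
          (∫ x in D, ∑ i, ∑ j, (Du₀ x i j) ^ 2) ≤ C * (W - W₀) ∧ W - W₀ = B) ∧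
        (∀ (T₀ T S : Space n → Matrix (Fin (n + 1)) (Fin (n + 1)) ℝ) (h : Space n → Space n),
          HasMatrixTrace Ω (frontier Ω) (stress Du₀ p₀) T₀ →
          HasMatrixTrace (Ω \ closure D) (frontier Ω) (stress Du p) T →
          HasMatrixTrace (Ω \ closure D) (frontier D) (stress Du p) S →
          HasBoundaryValues (Ω \ closure D) (frontier D) u₀ h →
          (∫ x in D, ∑ i, ∑ j, (Du₀ x i j) ^ 2)
            ≤ C * (tractionIntegral Ω T g - tractionIntegral Ω T₀ g) ∧
          tractionIntegral Ω T g - tractionIntegral Ω T₀ g = tractionIntegral D S h) := by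
  refine ⟨1, one_pos, fun D hD g u₀ u Du₀ Du p₀ p h₀ hg₀ h hg hu => ?_⟩
  simpa only [one_mul] using lemma3p4_general (hD.isLipschitzHole hΩ) h₀ hg₀ h hg hu
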